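/- **Theorem (Consistency).** *Setting.* Let $K\ge 1$. For $r=1,2$ let $B_r\in[0,1]^{K\times K}$ be symmetric, let $\pi_r$ be a probability vector on $[K]$ with positive entries, and let $N_r\ge1$. We observe independent networks $A_{rt}\sim\mathrm{SBM}_{n_{rt}}(B_r,\pi_r)$, $t\in[N_r]$: the labels $z_{rt}\in[K]^{n_{rt}}$ have i.i.d. entries with law $\pi_r$, and given $z_{rt}$ the entries $(A_{rt})_{ij}$, $i<j$, are independent Bernoulli with parameter $(B_r)_{z_{rti}z_{rtj}}$, $A_{rt}$ being symmetric with zero diagonal. *Test statistic.* Write $[\mathrm{Sum}(A,z)]_{k\ell}=\sum_{i,j}A_{ij}1\{z_i=k,z_j=\ell\}$, $n_k(z)=\#\{i:z_i=k\}$, $[\mathrm{Count}(z)]_{k\ell}=n_k(z)(n_\ell(z)-1\{k=\ell\})$, and $\oslash$ for entrywise division. For symmetric $M_1,M_2$ with eigenvalue decompositions $M_r=Q_r\Lambda_rQ_r^\top$ (eigenvalues in nonincreasing order), $\mathrm{match}(M_1\to M_2)$ is a permutation matrix $P$ maximizing $\mathrm{tr}(PQ_1SQ_2^\top)$, where $S$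 is diagonal with $S_{kk}=\mathrm{sign}([Q_2^\top\mathbf 1]_k/[Q_1^\top\mathbf 1]_k)$; any choice of eigenvectors and of maximizer is allowed. Given initial label estimates $\hat z^{(0)}_{rt}$ and independent uniform random permutations $\sigma_{rt}$ of $[K]$, independent of everything else, put $\hat z_{rt}=\sigma_{rt}\circ\hat z_{rt}^{(0)}$, $\hat S_{rt}=\mathrm{Sum}(A_{rt},\hat z_{rt})$, $\hat m_{rt}=\mathrm{Count}(\hat z_{rt})$, $\hat B_{rt}=\hat S_{rt}\oslash\hat m_{rt}$, $\hat P_{rt}=\mathrm{match}(\hat B_{rt}\to\hat B_{r1})$, $\hat B_r=\frac1{N_r}\sum_t\hat P_{rt}\hat B_{rt}\hat P_{rt}^\top$, $\hat P=\mathrm{match}(\hat B_2\to\hat B_1)$, $\hat S_r=\sum_t\hat P_{rt}\hat S_{rt}\hat P_{rt}^\top$, $\hat m_r=\sum_t\hat P_{rt}\hat m_{rt}\hat P_{rt}^\top$, $\hat S_2'=\hat P\hat S_2\hat P^\top$, $\hat m_2'=\hat P\hat m_2\hat P^\top$. Let $\hat B=(\hat S_1+\hat S_2')\oslash(\hat m_1+\hat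 m_2')$, $\hat\sigma^2_{k\ell}=\hat B_{k\ell}(1-\hat B_{k\ell})$, let $\hat h_{k\ell}$ be the harmonic mean of $\hat m_{1k\ell}$ and $\hat m'_{2k\ell}$, and $$\hat T_n=\sum_{k\le\ell}\frac{\hat h_{k\ell}}{2\hat\sigma^2_{k\ell}}\bigl([\hat S_1\oslash\hat m_1]_{k\ell}-[\hat S_2'\oslash\hat m_2']_{k\ell}\bigr)^2$$ (terms with $\hat\sigma_{k\ell}^2=0$ count as $0$). *Notation.* $d_{\mathrm{match}}(B_1,B_2)=\min_P\|B_2-PB_1P^\top\|_F$ over $K\times K$ permutation matrices; $\tilde\varepsilon=\max_{r,t}\min_\sigma\frac1{n_{rt}}\#\{i:(z_{rt})_i\ne\sigma((\hat z_{rt})_i)\}$; $\pi_{\min}=\min_{r,k}\pi_{rk}$; $N=\min\{N_1,N_2\}$; $N_+=N_1+N_2$. For $\kappa\in(0,1)$ and $\alpha>0$ put $$\beta=\frac1{(1-\kappa)\pi_{\min}},\qquad \delta_n^{(M)}=\sqrt{\frac{3\beta^2\alpha\log n}{Mn\nu_n}},$$ $$\gamma_n=C_1\bigl(56\beta^3\tilde\varepsilon+\delta_n^{(1)}\bigr),\qquad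 \xi_r=C_1\bigl(40\beta^3\tilde\varepsilon+\delta_n^{(N_r)}\bigr).$$ A symmetric $B=\sum_k\lambda_kq_kq_k^\top$ ($q_k$ orthonormal) is $(\theta,\eta)$-friendly if $|\lambda_k-\lambda_\ell|>\eta$ for $k\ne\ell$ and $|q_k^\top\mathbf 1|>\theta$ for all $k$. *Assumptions.* $n\ge1$, $\nu_n>0$; $n\le n_{rt}\le C_2n$ and $\nu_n/n\le(B_r)_{k\ell}\le C_1\nu_n/n$ for all $r,t,k,\ell$; $\delta_n^{(1)}\le1$; $\frac{\log n}n\le\frac{\kappa^2\pi_{\min}}{3\alpha}$; $\nu_n\ge3(1+\alpha)\log n$; $B_1$ and $B_2$ are $(\theta,\eta)$-friendly with $0<\theta<\frac1{4\sqrt K}$ and $\eta>0$. *Conclusion.* Let $\mathcal G$ be the event that $\frac{\nu_n}n\gamma_n\le\frac{\theta\eta}{2\sqrt2K}$ and $48C_2\beta^4\tilde\varepsilon\le1$, and let $\mathcal H$ be the event that $$\sqrt{12}\,K\max_{r=1,2}\xi_r\le\frac{d_{\mathrm{match}}(B_1,B_2)}{\nu_n/n}.$$ Then, with probability at least $1-19N_+K^2n^{-\alpha}-\mathbb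 P((\mathcal G\cap\mathcal H)^c)$, $$\hat T_n\ge\frac{Nn^2}{12\beta^2}\,d_{\mathrm{match}}(B_1,B_2)^2.$$ In particular, if $\mathcal H$ holds almost surely, this probability is at least $1-19N_+K^2n^{-\alpha}-\mathbb P(\mathcal G^c)$. Consequently the test is consistent: along any sequence of such problems with the same $K$ for which $N_+K^2n^{-\alpha}\to0$, $\mathbb P((\mathcal G\cap\mathcal H)^c)\to0$ and $\frac{Nn^2}{12\beta^2}d_{\mathrm{match}}(B_1,B_2)^2\to\infty$, we have $\mathbb P(\hat T_n\ge M)\to1$ for every real $M$. -/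

import Mathlib

open MeasureTheory ProbabilityTheory Matrix Filter Topology

noncomputable section

namespace SBMTest

/-! ### Matrix notions -/

/-- The matrix `P_σ B P_σᵀ`, where `P_σ` is the permutation matrix with `(P_σ v)_i = v_{σ i}`. -/
def permConj {K : ℕ} (σ : Equiv.Perm (Fin K)) (B : Matrix (Fin K) (Fin K) ℝ) :
    Matrix (Fin K) (Fin K) ℝ :=
  σ.permMatrix ℝ * B * (σ.permMatrix ℝ)ᵀ

theorem permConj_apply {K : ℕ} (σ : Equiv.Perm (Fin K)) (B : Matrix (Fin K) (Fin K) ℝ)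
    (k l : Fin K) : permConj σ B k l = B (σ k) (σ l) := by
  simp [permConj, Matrix.mul_apply, Equiv.Perm.permMatrix, PEquiv.toMatrix_apply,
    Equiv.symm_apply_eq]

open scoped Matrix.Norms.Frobenius in
/-- The Frobenius norm. -/
def frobNorm {K : ℕ} (M : Matrix (Fin K) (Fin K) ℝ) : ℝ := ‖M‖

/-- The matching distance `min_P ‖B₂ - P B₁ Pᵀ‖_F` over permutation matrices `P`. -/
def matchDist {K : ℕ} (B₁ B₂ : Matrix (Fin K) (Fin K) ℝ) : ℝ :=
  ⨅ σ : Equiv.Perm (Fin K), frobNorm (B₂ - permConj σ B₁)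

/-- `B = Q diag(lam) Qᵀ` is an eigenvalue decomposition of the real matrix `B`, with `Q` orthogonal
and the eigenvalues listed in nonincreasing order. -/
structure IsEVD {K : ℕ} (B Q : Matrix (Fin K) (Fin K) ℝ) (lam : Fin K → ℝ) : Prop where
  orthogonal : Q ∈ Matrix.orthogonalGroup (Fin K) ℝ
  sorted : Antitone lam
  decomp : B = Q * Matrix.diagonal lam * Qᵀ

/-- `(θ, η)`-friendly matrices: the eigenvalues are more than `η` apart, and the unit eigenvectors
`q_k` satisfy `|q_kᵀ 1| > θ`. -/
def IsFriendly {K : ℕ} (θ η : ℝ) (B : Matrix (Fin K) (Fin K) ℝ) : Prop :=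
  ∃ (Q : Matrix (Fin K) (Fin K) ℝ) (lam : Fin K → ℝ), IsEVD B Q lam ∧
    (∀ k l, k ≠ l → η < |lam k - lam l|) ∧ ∀ k, θ < |∑ i, Q i k|

/-- `σ` is a possible result of a linear assignment problem: `P_σ` maximizes `tr (P M)`. -/
def IsLAP {K : ℕ} (M : Matrix (Fin K) (Fin K) ℝ) (σ : Equiv.Perm (Fin K)) : Prop :=
  ∀ τ : Equiv.Perm (Fin K), (τ.permMatrix ℝ * M).trace ≤ (σ.permMatrix ℝ * M).trace

/-- `σ` is a possible output of the spectral matching algorithm for `B₁ → B₂`: for some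
eigenvalue decompositions of `B₁` and `B₂` with eigenvector matrices `Q₁`, `Q₂`, and with
`S` the diagonal matrix of the signs of `[Q₂ᵀ 1]_k / [Q₁ᵀ 1]_k`,
it solves the linear assignment problem for `Q₁ S Q₂ᵀ`. -/
def IsSpectralMatch {K : ℕ} (B₁ B₂ : Matrix (Fin K) (Fin K) ℝ) (σ : Equiv.Perm (Fin K)) : Prop :=
  ∃ (Q₁ Q₂ : Matrix (Fin K) (Fin K) ℝ) (lam₁ lam₂ : Fin K → ℝ),
    IsEVD B₁ Q₁ lam₁ ∧ IsEVD B₂ Q₂ lam₂ ∧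
    IsLAP (Q₁ * Matrix.diagonal (fun k => Real.sign ((∑ i, Q₂ i k) / ∑ i, Q₁ i k)) * Q₂ᵀ) σ

/-- `f` is an implementation of the spectral matching algorithm (with its own choice of
eigenvectors and of the maximizing permutation where these are not unique). -/
def IsSpectralMatching {K : ℕ}
    (f : Matrix (Fin K) (Fin K) ℝ → Matrix (Fin K) (Fin K) ℝ → Equiv.Perm (Fin K)) : Prop :=
  ∀ B₁ B₂, B₁.IsSymm → B₂.IsSymm → IsSpectralMatch B₁ B₂ (f B₁ B₂)

/-- Every symmetric matrix has an eigenvalue decomposition with sorted eigenvalues. -/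
theorem exists_isEVD {K : ℕ} {B : Matrix (Fin K) (Fin K) ℝ} (hB : B.IsSymm) :
    ∃ (Q : Matrix (Fin K) (Fin K) ℝ) (lam : Fin K → ℝ), IsEVD B Q lam := by
  have hH : B.IsHermitian := by
    rw [Matrix.IsHermitian, Matrix.conjTranspose_eq_transpose_of_trivial]
    exact hB
  set U : Matrix (Fin K) (Fin K) ℝ := hH.eigenvectorUnitary.1 with hU
  have hUU : U * Uᵀ = 1 := by
    have := (Matrix.mem_unitaryGroup_iff).1 hH.eigenvectorUnitary.2
    simpa [Matrix.star_eq_conjTranspose, Matrix.conjTranspose_eq_transpose_of_trivial] using this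
  have hdec : B = U * Matrix.diagonal hH.eigenvalues * Uᵀ := by
    have := hH.spectral_theorem
    simpa [Unitary.conjStarAlgAut_apply, Matrix.star_eq_conjTranspose,
      Matrix.conjTranspose_eq_transpose_of_trivial, Function.comp_def] using this
  set s : Equiv.Perm (Fin K) := Tuple.sort (fun i => - hH.eigenvalues i)
  have hs : Monotone ((fun i => - hH.eigenvalues i) ∘ s) := Tuple.monotone_sort _
  refine ⟨U.submatrix id s, hH.eigenvalues ∘ s, ?_, ?_, ?_⟩
  · rw [Matrix.mem_orthogonalGroup_iff, Matrix.transpose_submatrix,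
      Matrix.submatrix_mul_equiv, hUU]
    simp
  · intro i j hij
    have := hs hij
    simp only [Function.comp_apply] at this ⊢
    linarith
  · rw [← Matrix.submatrix_diagonal_equiv, Matrix.transpose_submatrix,
      Matrix.submatrix_mul_equiv, Matrix.submatrix_mul_equiv, ← hdec]
    simp

/-- Implementations of spectral matching exist. -/
theorem exists_isSpectralMatching (K : ℕ) :
    ∃ f : Matrix (Fin K) (Fin K) ℝ → Matrix (Fin K) (Fin K) ℝ → Equiv.Perm (Fin K),
      IsSpectralMatching f := by
  have h : ∀ B₁ B₂ : Matrix (Fin K) (Fin K) ℝ, ∃ σ : Equiv.Perm (Fin K),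
      B₁.IsSymm → B₂.IsSymm → IsSpectralMatch B₁ B₂ σ := by
    intro B₁ B₂
    by_cases h : B₁.IsSymm ∧ B₂.IsSymm
    · obtain ⟨Q₁, l₁, h₁⟩ := exists_isEVD h.1
      obtain ⟨Q₂, l₂, h₂⟩ := exists_isEVD h.2
      obtain ⟨σ, hσ⟩ := Finite.exists_max (fun σ : Equiv.Perm (Fin K) => (σ.permMatrix ℝ *
        (Q₁ * Matrix.diagonal (fun k => Real.sign ((∑ i, Q₂ i k) / ∑ i, Q₁ i k)) * Q₂ᵀ)).trace)
      exact ⟨σ, fun _ _ => ⟨Q₁, Q₂, l₁, l₂, h₁, h₂, hσ⟩⟩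
    · exact ⟨1, fun h₁ h₂ => absurd ⟨h₁, h₂⟩ h⟩
  choose f hf using h
  exact ⟨f, hf⟩

/-! ### Labels, block sums and block counts -/

/-- Normalized Hamming distance of two label vectors. -/
def normHamming {K m : ℕ} (z w : Fin m → Fin K) : ℝ := (hammingDist z w : ℝ) / m

/-- Misclassification rate: the least normalized Hamming distance after relabelling. -/
def misclass {K m : ℕ} (z w : Fin m → Fin K) : ℝ :=
  ⨅ σ : Equiv.Perm (Fin K), normHamming z (σ ∘ w)

/-- Block sums `∑_{i,j} A_ij 1{z_i = k, z_j = l}`. -/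
def blockSum {K m : ℕ} (A : Matrix (Fin m) (Fin m) ℝ) (z : Fin m → Fin K) :
    Matrix (Fin K) (Fin K) ℝ :=
  Matrix.of fun k l => ∑ i, ∑ j, if z i = k ∧ z j = l then A i j else 0

/-- Number of nodes with label `k`. -/
def commSize {K m : ℕ} (z : Fin m → Fin K) (k : Fin K) : ℕ :=
  (Finset.univ.filter fun i => z i = k).card

/-- Block counts `n_k(z) (n_l(z) - 1{k = l})`. -/
def blockCount {K m : ℕ} (z : Fin m → Fin K) : Matrix (Fin K) (Fin K) ℝ :=
  Matrix.of fun k l => (commSize z k : ℝ) * ((commSize z l : ℝ) - if k = l then 1 else 0)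

/-- Elementwise division of matrices. -/
def hdiv {K : ℕ} (S m : Matrix (Fin K) (Fin K) ℝ) : Matrix (Fin K) (Fin K) ℝ :=
  Matrix.of fun k l => S k l / m k l

open scoped Classical in
/-- The adjacency matrix of a graph, with real entries. -/
def adjacency {m : ℕ} (G : SimpleGraph (Fin m)) : Matrix (Fin m) (Fin m) ℝ := G.adjMatrix ℝ

/-! ### The two-sample stochastic block model and the test statistic -/

/-- Permutations of a finite set carry the full sigma-algebra. -/
instance instMeasurableSpacePerm (K : ℕ) : MeasurableSpace (Equiv.Perm (Fin K)) := ⊤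

open scoped Classical in
/-- The probability of the label vector `z` and the graph `G` under the stochastic block model
with connectivity matrix `B` and class prior `p`: the labels are independent with law `p`, and,
given the labels, the edges `ij`, `i < j`, are independent Bernoulli with parameter
`B_{z_i z_j}`. -/
def sbmWeight {K m : ℕ} (B : Matrix (Fin K) (Fin K) ℝ) (p : Fin K → ℝ)
    (z : Fin m → Fin K) (G : SimpleGraph (Fin m)) : ℝ :=
  (∏ i, p (z i)) *
    ∏ i, ∏ j ∈ Finset.Ioi i, if G.Adj i j then B (z i) (z j) else 1 - B (z i) (z j)

/-- Two independent samples of networks from stochastic block models with `K` communities, on the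
probability space `(Ω, μ)`, together with the inputs of the two-sample test: initial label
estimates (arbitrary random label vectors), the random relabellings, and an implementation of
spectral matching. The two samples are indexed by `r : Fin 2`. -/
structure TwoSampleSBM (K : ℕ) (Ω : Type*) [MeasurableSpace Ω] where
  μ : Measure Ω
  isProb : IsProbabilityMeasure μ
  /-- sample sizes -/
  N : Fin 2 → ℕ
  N_pos : ∀ r, 0 < N r
  /-- numbers of nodes -/
  size : (r : Fin 2) → Fin (N r) → ℕ
  /-- connectivity matrices -/
  B : Fin 2 → Matrix (Fin K) (Fin K) ℝ
  B_symm : ∀ r, (B r).IsSymm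
  B_mem : ∀ r k l, B r k l ∈ Set.Icc (0 : ℝ) 1
  /-- class priors -/
  prior : Fin 2 → Fin K → ℝ
  prior_pos : ∀ r k, 0 < prior r k
  prior_sum : ∀ r, ∑ k, prior r k = 1
  /-- true labels -/
  label : (r : Fin 2) → (t : Fin (N r)) → Ω → Fin (size r t) → Fin K
  /-- observed networks -/
  graph : (r : Fin 2) → (t : Fin (N r)) → Ω → SimpleGraph (Fin (size r t))
  label_meas : ∀ r t, Measurable (label r t)
  graph_meas : ∀ r t, Measurable (graph r t)
  sbm_law : ∀ r t z G,
    μ.real {ω | label r t ω = z ∧ graph r t ω = G} = sbmWeight (B r) (prior r) z G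
  sbm_indep :
    iIndepFun (fun (p : Σ r : Fin 2, Fin (N r)) ω => (label p.1 p.2 ω, graph p.1 p.2 ω)) μ
  /-- initial label estimates -/
  initLabel : (r : Fin 2) → (t : Fin (N r)) → Ω → Fin (size r t) → Fin K
  initLabel_meas : ∀ r t, Measurable (initLabel r t)
  /-- random relabellings: uniform, independent of each other and of everything above -/
  relabel : (r : Fin 2) → Fin (N r) → Ω → Equiv.Perm (Fin K)
  relabel_meas : ∀ r t, Measurable (relabel r t)
  relabel_law : ∀ r t σ, μ.real {ω | relabel r t ω = σ} = 1 / (K.factorial : ℝ)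
  relabel_indep : iIndepFun (fun (p : Σ r : Fin 2, Fin (N r)) => relabel p.1 p.2) μ
  relabel_indep_data :
    IndepFun (fun ω (p : Σ r : Fin 2, Fin (N r)) => relabel p.1 p.2 ω)
      (fun ω (p : Σ r : Fin 2, Fin (N r)) =>
        (label p.1 p.2 ω, graph p.1 p.2 ω, initLabel p.1 p.2 ω)) μ
  /-- the implementation of spectral matching that the test uses -/
  specMatch : Matrix (Fin K) (Fin K) ℝ → Matrix (Fin K) (Fin K) ℝ → Equiv.Perm (Fin K)
  specMatch_spec : IsSpectralMatching specMatch

namespace TwoSampleSBM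

variable {K : ℕ} {Ω : Type*} [MeasurableSpace Ω] (X : TwoSampleSBM K Ω)

/-- Index of the first network of sample `r`. -/
def first (r : Fin 2) : Fin (X.N r) := ⟨0, X.N_pos r⟩

/-- Randomized labels `ẑ_rt = σ_rt ∘ ẑ_rt⁽⁰⁾`. -/
def zhat (r : Fin 2) (t : Fin (X.N r)) (ω : Ω) : Fin (X.size r t) → Fin K :=
  X.relabel r t ω ∘ X.initLabel r t ω

/-- `Ŝ_rt`. -/
def Shat1 (r : Fin 2) (t : Fin (X.N r)) (ω : Ω) : Matrix (Fin K) (Fin K) ℝ :=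
  blockSum (adjacency (X.graph r t ω)) (X.zhat r t ω)

/-- `m̂_rt`. -/
def mhat1 (r : Fin 2) (t : Fin (X.N r)) (ω : Ω) : Matrix (Fin K) (Fin K) ℝ :=
  blockCount (X.zhat r t ω)

/-- `B̂_rt`. -/
def Bhat1 (r : Fin 2) (t : Fin (X.N r)) (ω : Ω) : Matrix (Fin K) (Fin K) ℝ :=
  hdiv (X.Shat1 r t ω) (X.mhat1 r t ω)

/-- `P̂_rt`, the matching of network `t` to the first network of sample `r`. -/
def Phat1 (r : Fin 2) (t : Fin (X.N r)) (ω : Ω) : Equiv.Perm (Fin K) :=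
  X.specMatch (X.Bhat1 r t ω) (X.Bhat1 r (X.first r) ω)

/-- `B̂_r = (1 / N_r) ∑_t P̂_rt B̂_rt P̂_rtᵀ`. -/
def Bhat (r : Fin 2) (ω : Ω) : Matrix (Fin K) (Fin K) ℝ :=
  (1 / (X.N r : ℝ)) • ∑ t, permConj (X.Phat1 r t ω) (X.Bhat1 r t ω)

/-- The global matching `P̂` of sample 2 to sample 1. -/
def Phat (ω : Ω) : Equiv.Perm (Fin K) := X.specMatch (X.Bhat 1 ω) (X.Bhat 0 ω)

/-- `Ŝ_r`. -/
def Shat (r : Fin 2) (ω : Ω) : Matrix (Fin K) (Fin K) ℝ :=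
  ∑ t, permConj (X.Phat1 r t ω) (X.Shat1 r t ω)

/-- `m̂_r`. -/
def mhat (r : Fin 2) (ω : Ω) : Matrix (Fin K) (Fin K) ℝ :=
  ∑ t, permConj (X.Phat1 r t ω) (X.mhat1 r t ω)

/-- `Ŝ₂'`. -/
def Shat2' (ω : Ω) : Matrix (Fin K) (Fin K) ℝ := permConj (X.Phat ω) (X.Shat 1 ω)

/-- `m̂₂'`. -/
def mhat2' (ω : Ω) : Matrix (Fin K) (Fin K) ℝ := permConj (X.Phat ω) (X.mhat 1 ω)

/-- The pooled estimate `(Ŝ₁ + Ŝ₂') / (m̂₁ + m̂₂')`. -/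
def Bpool (ω : Ω) : Matrix (Fin K) (Fin K) ℝ :=
  hdiv (X.Shat 0 ω + X.Shat2' ω) (X.mhat 0 ω + X.mhat2' ω)

/-- `σ̂²_kl`. -/
def varHat (ω : Ω) (k l : Fin K) : ℝ := X.Bpool ω k l * (1 - X.Bpool ω k l)

/-- Harmonic mean of `m̂₁` and `m̂₂'`. -/
def hHat (ω : Ω) (k l : Fin K) : ℝ :=
  2 * X.mhat 0 ω k l * X.mhat2' ω k l / (X.mhat 0 ω k l + X.mhat2' ω k l)

/-- The test statistic `T̂_n`. A term with `σ̂²_kl = 0` has both estimates equal and counts as `0`. -/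
def That (ω : Ω) : ℝ :=
  ∑ k, ∑ l ∈ Finset.Ici k, X.hHat ω k l / (2 * X.varHat ω k l) *
    (hdiv (X.Shat 0 ω) (X.mhat 0 ω) k l - hdiv (X.Shat2' ω) (X.mhat2' ω) k l) ^ 2

/-- The largest misclassification rate over all networks. -/
def epsMax (ω : Ω) : ℝ :=
  ⨆ p : Σ r : Fin 2, Fin (X.N r), misclass (X.label p.1 p.2 ω) (X.zhat p.1 p.2 ω)

/-- The smallest class probability. -/
def priorMin : ℝ := ⨅ p : Fin 2 × Fin K, X.prior p.1 p.2

end TwoSampleSBM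

/-! ### Parameters, assumptions and events -/

/-- The numerical parameters. -/
structure Params where
  n : ℕ
  ν : ℝ
  C₁ : ℝ
  C₂ : ℝ
  κ : ℝ
  α : ℝ
  θ : ℝ
  η : ℝ

namespace TwoSampleSBM

variable {K : ℕ} {Ω : Type*} [MeasurableSpace Ω] (X : TwoSampleSBM K Ω) (q : Params)

/-- `β = 1 / ((1 - κ) π_min)`. -/
def beta : ℝ := 1 / ((1 - q.κ) * X.priorMin)

/-- `δ_n^{(M)} = √(3 β² α log n / (M n ν_n))`. -/
def delta (M : ℕ) : ℝ :=
  Real.sqrt (3 * X.beta q ^ 2 * q.α * Real.log q.n / (M * q.n * q.ν))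

/-- `ξ_r = C₁ (40 β³ ε + δ_n^{(N_r)})`. -/
def xi (r : Fin 2) (ω : Ω) : ℝ := q.C₁ * (40 * X.beta q ^ 3 * X.epsMax ω + X.delta q (X.N r))

/-- `γ_n = C₁ (56 β³ ε + δ_n^{(1)})`. -/
def gamma (ω : Ω) : ℝ := q.C₁ * (56 * X.beta q ^ 3 * X.epsMax ω + X.delta q 1)

/-- The standing assumptions: sizes, sparsity, scaling, and friendliness. -/
structure Assumptions : Prop where
  n_pos : 0 < q.n
  ν_pos : 0 < q.ν
  κ_mem : q.κ ∈ Set.Ioo (0 : ℝ) 1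
  α_pos : 0 < q.α
  sizes : ∀ r t, (q.n : ℝ) ≤ X.size r t ∧ (X.size r t : ℝ) ≤ q.C₂ * q.n
  sparsity : ∀ r k l, q.ν / q.n ≤ X.B r k l ∧ X.B r k l ≤ q.C₁ * q.ν / q.n
  delta_le : X.delta q 1 ≤ 1
  log_le : Real.log q.n / q.n ≤ q.κ ^ 2 * X.priorMin / (3 * q.α)
  degree : 3 * (1 + q.α) * Real.log q.n ≤ q.ν
  θ_pos : 0 < q.θ
  θ_lt : q.θ < 1 / (4 * Real.sqrt K)
  η_pos : 0 < q.η
  friendly : ∀ r, IsFriendly q.θ q.η (X.B r)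

/-- The event `𝒢` on which the misclassification rate is small enough for the matching step. -/
def goodEvent : Set Ω :=
  {ω | q.ν / q.n * X.gamma q ω ≤ q.θ * q.η / (2 * Real.sqrt 2 * K) ∧
    48 * q.C₂ * X.beta q ^ 4 * X.epsMax ω ≤ 1}

/-- The event that the two connectivity matrices are well separated. -/
def signalEvent : Set Ω :=
  {ω | Real.sqrt 12 * K * max (X.xi q 0 ω) (X.xi q 1 ω) ≤
    matchDist (X.B 0) (X.B 1) / (q.ν / q.n)}

/-- `19 N₊ K² n^{-α}` with `N₊ = N₁ + N₂`. -/
def errorBound : ℝ := 19 * ((X.N 0 : ℝ) + X.N 1) * (K : ℝ) ^ 2 * (q.n : ℝ) ^ (-q.α)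

/-- `N n² / (12 β²) · d_match(B₁, B₂)²` with `N = min (N₁, N₂)`. -/
def lowerBound : ℝ :=
  (min (X.N 0) (X.N 1) : ℕ) * (q.n : ℝ) ^ 2 / (12 * X.beta q ^ 2) *
    matchDist (X.B 0) (X.B 1) ^ 2

end TwoSampleSBM

end SBMTest

end

/-! Concentration isolates a set of regular outcomes; everything after that is deterministic.

Regular outcomes. Communities have size at least 1 + m/β, degrees are at most 3mC₁ν/n, and the block
sums for the true labels are close to their means, both pooled over a sample and, if K ≥ 2, in each
network; for K ≥ 2 also one linear form of the noise per eigenvector is small. Given the labels the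
edges are independent, so moment generating functions of linear forms in the block sums factorize
over edges (`sum_edgeWeight_mul_exp_block_le`), and independence multiplies them over networks
(`prob_nonneg_sum_le`). Each failure has probability at most n^{-α}; `prob_not_regular_le` counts
the failures.

Matching inside a sample. Under the best relabelling, the estimated labels of a network with m nodes
are wrong at no more than ε̃m nodes, and each of these changes a block sum by at most twice the
degree bound. So B̂_rt is a relabelled B_r + E with E small. Weyl's inequality and the eigenvalue
gap keep the eigenvectors close up to sign. The algorithm reads the sign off the column sum q_kᵀ1,
for which the crude bound √K‖E‖/η may be too large by a factor of order √K. The column sum is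
therefore expanded to first order: the linear term is the linear form above, which concentrates by
itself, and the remainder is of second order and small because θ√K < 1/4 (`IsEVD.exists_sign`). With
the right signs the matrix of the assignment problem is entrywise within 2/5 of a permutation
matrix, so its maximizer is the true relative relabelling (`IsSpectralMatch.eq_inv_mul`,
`Phat1_eq`).

The statistic. The pooled estimates are thus relabelled versions of B₁ and B₂ up to errors governed
by ξ₁ and ξ₂. The matching between the samples needs no analysis: d_match is a minimum over
permutations, so for every P̂ the two estimates differ by at least d_match minus the errors
(`frobNorm_sub_ge`), and on ℋ the errors add up to at most d_match/√2. Variance estimates are at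
most 1/4 and counts at least 0.99·Nn²/β², so the constant follows from 0.99·(1 − 1/√2)² > 1/12. -/

namespace SBMTest

/-! ### Euclidean norms of vectors and Frobenius norms of matrices -/

/-- The Euclidean norm of a vector. -/
noncomputable def vnorm {K : ℕ} (v : Fin K → ℝ) : ℝ :=
  ‖(WithLp.toLp 2 v : EuclideanSpace ℝ (Fin K))‖

section Norms

variable {K : ℕ}

theorem vnorm_nonneg (v : Fin K → ℝ) : 0 ≤ vnorm v := norm_nonneg _

theorem vnorm_sq (v : Fin K → ℝ) : vnorm v ^ 2 = ∑ i, v i ^ 2 := by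
  simp [vnorm, EuclideanSpace.norm_sq_eq]

theorem vnorm_sq_eq_dotProduct (v : Fin K → ℝ) : vnorm v ^ 2 = v ⬝ᵥ v := by
  rw [vnorm_sq, dotProduct]; simp only [sq]

theorem vnorm_smul (c : ℝ) (v : Fin K → ℝ) : vnorm (c • v) = |c| * vnorm v :=
  norm_smul c (WithLp.toLp 2 v : EuclideanSpace ℝ (Fin K))

theorem abs_dotProduct_le (v w : Fin K → ℝ) : |v ⬝ᵥ w| ≤ vnorm v * vnorm w := by
  refine abs_le_of_sq_le_sq ?_ (mul_nonneg (vnorm_nonneg _) (vnorm_nonneg _))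
  rw [mul_pow, vnorm_sq, vnorm_sq]
  exact Finset.sum_mul_sq_le_sq_mul_sq _ _ _

theorem abs_le_vnorm (v : Fin K → ℝ) (i : Fin K) : |v i| ≤ vnorm v := by
  refine abs_le_of_sq_le_sq ?_ (vnorm_nonneg _)
  rw [vnorm_sq]
  exact Finset.single_le_sum (f := fun i => v i ^ 2) (fun _ _ => sq_nonneg _) (Finset.mem_univ i)

theorem frobNorm_nonneg (M : Matrix (Fin K) (Fin K) ℝ) : 0 ≤ frobNorm M := by
  let _ := Matrix.frobeniusNormedAddCommGroup (m := Fin K) (n := Fin K) (α := ℝ)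
  exact norm_nonneg M

theorem frobNorm_sq (M : Matrix (Fin K) (Fin K) ℝ) : frobNorm M ^ 2 = ∑ i, ∑ j, M i j ^ 2 := by
  have : frobNorm M = (∑ i, ∑ j, ‖M i j‖ ^ (2 : ℝ)) ^ (1 / 2 : ℝ) := Matrix.frobenius_norm_def M
  rw [this, ← Real.sqrt_eq_rpow, Real.sq_sqrt (by positivity)]
  simp

theorem frobNorm_add_le (M N : Matrix (Fin K) (Fin K) ℝ) :
    frobNorm (M + N) ≤ frobNorm M + frobNorm N := by
  let _ := Matrix.frobeniusNormedAddCommGroup (m := Fin K) (n := Fin K) (α := ℝ)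
  exact norm_add_le M N

theorem frobNorm_neg (M : Matrix (Fin K) (Fin K) ℝ) : frobNorm (-M) = frobNorm M := by
  let _ := Matrix.frobeniusNormedAddCommGroup (m := Fin K) (n := Fin K) (α := ℝ)
  exact norm_neg M

theorem frobNorm_le_of_forall {M : Matrix (Fin K) (Fin K) ℝ} {e : ℝ} (he : 0 ≤ e)
    (h : ∀ i j, |M i j| ≤ e) : frobNorm M ≤ K * e := by
  refine le_of_sq_le_sq ?_ (by positivity)
  rw [frobNorm_sq]
  calc ∑ i, ∑ j, M i j ^ 2 ≤ ∑ _i : Fin K, ∑ _j : Fin K, e ^ 2 :=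
        Finset.sum_le_sum fun i _ => Finset.sum_le_sum fun j _ =>
          sq_le_sq' (abs_le.1 (h i j)).1 (abs_le.1 (h i j)).2
    _ = (K * e) ^ 2 := by simp; ring

theorem frobNorm_permConj (σ : Equiv.Perm (Fin K)) (M : Matrix (Fin K) (Fin K) ℝ) :
    frobNorm (permConj σ M) = frobNorm M := by
  have : frobNorm (permConj σ M) ^ 2 = frobNorm M ^ 2 := by
    rw [frobNorm_sq, frobNorm_sq]
    simp only [permConj_apply]
    rw [Equiv.sum_comp σ (fun i => ∑ j, M i (σ j) ^ 2)]
    exact Finset.sum_congr rfl fun i _ => Equiv.sum_comp σ (fun j => M i j ^ 2)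
  exact (pow_left_inj₀ (frobNorm_nonneg _) (frobNorm_nonneg _) two_ne_zero).1 this

theorem vnorm_mulVec_le (M : Matrix (Fin K) (Fin K) ℝ) (v : Fin K → ℝ) :
    vnorm (M *ᵥ v) ≤ frobNorm M * vnorm v := by
  refine le_of_sq_le_sq ?_ (mul_nonneg (frobNorm_nonneg _) (vnorm_nonneg _))
  rw [mul_pow, vnorm_sq, vnorm_sq, frobNorm_sq, Finset.sum_mul]
  exact Finset.sum_le_sum fun i _ => Finset.sum_mul_sq_le_sq_mul_sq Finset.univ (M i) v

theorem abs_dotProduct_mulVec_le (M : Matrix (Fin K) (Fin K) ℝ) (v w : Fin K → ℝ) :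
    |v ⬝ᵥ M *ᵥ w| ≤ frobNorm M * vnorm v * vnorm w := by
  calc |v ⬝ᵥ M *ᵥ w| ≤ vnorm v * vnorm (M *ᵥ w) := abs_dotProduct_le _ _
    _ ≤ vnorm v * (frobNorm M * vnorm w) :=
        mul_le_mul_of_nonneg_left (vnorm_mulVec_le _ _) (vnorm_nonneg _)
    _ = _ := by ring

end Norms

/-! ### Perturbation of eigenvalues and eigenvectors -/

section EVD

variable {K : ℕ} {B Q : Matrix (Fin K) (Fin K) ℝ} {lam : Fin K → ℝ}

namespace IsEVD

theorem mul_transpose (h : IsEVD B Q lam) : Q * Qᵀ = 1 :=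
  (Matrix.mem_orthogonalGroup_iff (Fin K) ℝ).1 h.orthogonal

theorem transpose_mul (h : IsEVD B Q lam) : Qᵀ * Q = 1 :=
  (Matrix.mem_orthogonalGroup_iff' (Fin K) ℝ).1 h.orthogonal

theorem dotProduct_mulVec (h : IsEVD B Q lam) (v w : Fin K → ℝ) :
    (Q *ᵥ v) ⬝ᵥ (Q *ᵥ w) = v ⬝ᵥ w := by
  rw [Matrix.dotProduct_mulVec, Matrix.vecMul_mulVec, h.transpose_mul, Matrix.vecMul_one]

theorem vnorm_mulVec (h : IsEVD B Q lam) (v : Fin K → ℝ) : vnorm (Q *ᵥ v) = vnorm v := by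
  refine (pow_left_inj₀ (vnorm_nonneg _) (vnorm_nonneg _) two_ne_zero).1 ?_
  rw [vnorm_sq_eq_dotProduct, vnorm_sq_eq_dotProduct, h.dotProduct_mulVec]

theorem vnorm_transpose_mulVec (h : IsEVD B Q lam) (v : Fin K → ℝ) :
    vnorm (Qᵀ *ᵥ v) = vnorm v := by
  rw [← h.vnorm_mulVec, Matrix.mulVec_mulVec, h.mul_transpose, Matrix.one_mulVec]

theorem vnorm_col (h : IsEVD B Q lam) (k : Fin K) : vnorm (Q.col k) = 1 := by
  rw [← Matrix.mulVec_single_one, h.vnorm_mulVec]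
  simp [vnorm]

theorem vnorm_row (h : IsEVD B Q lam) (k : Fin K) : vnorm (Q k) = 1 := by
  have : Qᵀ *ᵥ (Pi.single k 1) = Q k := by simp; rfl
  rw [← this, h.vnorm_transpose_mulVec]
  simp [vnorm]

theorem transpose_mulVec_mulVec (h : IsEVD B Q lam) (v : Fin K → ℝ) (l : Fin K) :
    (Qᵀ *ᵥ (B *ᵥ v)) l = lam l * (Qᵀ *ᵥ v) l := by
  have : Qᵀ * B = Matrix.diagonal lam * Qᵀ := by
    conv_lhs => rw [h.decomp]
    rw [← Matrix.mul_assoc, ← Matrix.mul_assoc, h.transpose_mul, Matrix.one_mul]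
  rw [Matrix.mulVec_mulVec, this, ← Matrix.mulVec_mulVec, Matrix.mulVec_diagonal]

theorem mulVec_col (h : IsEVD B Q lam) (k : Fin K) : B *ᵥ Q.col k = lam k • Q.col k := by
  have : B * Q = Q * Matrix.diagonal lam := by
    conv_lhs => rw [h.decomp]
    rw [Matrix.mul_assoc, h.transpose_mul, Matrix.mul_one]
  rw [← Matrix.mulVec_single_one, Matrix.mulVec_mulVec, this, ← Matrix.mulVec_mulVec]
  ext i
  simp [Matrix.mulVec_single]
  ring

theorem quadForm (h : IsEVD B Q lam) (v : Fin K → ℝ) :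
    v ⬝ᵥ B *ᵥ v = ∑ l, lam l * (Qᵀ *ᵥ v) l ^ 2 := by
  have hv : v = Q *ᵥ (Qᵀ *ᵥ v) := by rw [Matrix.mulVec_mulVec, h.mul_transpose, Matrix.one_mulVec]
  have hB : B *ᵥ v = Q *ᵥ (Qᵀ *ᵥ (B *ᵥ v)) := by
    rw [Matrix.mulVec_mulVec, h.mul_transpose, Matrix.one_mulVec]
  conv_lhs => rw [hB]; arg 1; rw [hv]
  rw [h.dotProduct_mulVec, dotProduct]
  refine Finset.sum_congr rfl fun l _ => ?_
  rw [h.transpose_mulVec_mulVec]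
  ring

/-- Weyl's inequality by counting dimensions: the span of the first k + 1 eigenvectors of `N`
contains a nonzero x orthogonal to the first k eigenvectors of `M`. At x the form of `N` is at least
`nu k` and that of `M` at most `mu k` times the squared norm, and the forms differ by at most ‖N −
M‖ times it. -/
theorem eigenvalue_le {M N P R : Matrix (Fin K) (Fin K) ℝ} {mu nu : Fin K → ℝ}
    (hM : IsEVD M P mu) (hN : IsEVD N R nu) (k : Fin K) :
    nu k ≤ mu k + frobNorm (N - M) := by
  -- `f` extends coefficients on the indices ≤ k by zero; `g` takes the corresponding combination of
  -- eigenvectors of `N` to its coordinates of index < k in the eigenbasis of `M`.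
  let f : ({i : Fin K // i ≤ k} → ℝ) →ₗ[ℝ] (Fin K → ℝ) :=
    { toFun := fun c i => if h : i ≤ k then c ⟨i, h⟩ else 0
      map_add' := by intro c d; ext i; by_cases h : i ≤ k <;> simp [h]
      map_smul' := by intro c d; ext i; by_cases h : i ≤ k <;> simp [h] }
  let g : ({i : Fin K // i ≤ k} → ℝ) →ₗ[ℝ] ({j : Fin K // j < k} → ℝ) :=
    (LinearMap.funLeft ℝ ℝ Subtype.val) ∘ₗ (Matrix.mulVecLin (Pᵀ * R)) ∘ₗ f
  have hker : LinearMap.ker g ≠ ⊥ := by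
    apply LinearMap.ker_ne_bot_of_finrank_lt
    rw [Module.finrank_fintype_fun_eq_card, Module.finrank_fintype_fun_eq_card]
    refine Fintype.card_lt_of_injective_of_notMem
      (fun j : {j : Fin K // j < k} => (⟨j.1, j.2.le⟩ : {i : Fin K // i ≤ k}))
      (fun a b hab => Subtype.ext (congrArg (fun z => z.1) hab)) (b := ⟨k, le_refl k⟩) ?_
    rintro ⟨j, hj⟩
    exact j.2.ne (congrArg (fun z => z.1) hj)
  obtain ⟨c, hc, hc0⟩ := Submodule.exists_mem_ne_zero_of_ne_bot hker
  set d := f c with hd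
  set x := R *ᵥ d with hx
  have hdx : Rᵀ *ᵥ x = d := by rw [hx, Matrix.mulVec_mulVec, hN.transpose_mul, Matrix.one_mulVec]
  have hd1 : ∀ i, k < i → d i = 0 := by
    intro i hi
    simp [hd, f, not_le.2 hi]
  have hPx : ∀ j, j < k → (Pᵀ *ᵥ x) j = 0 := by
    intro j hj
    have := congrFun (LinearMap.mem_ker.1 hc) ⟨j, hj⟩
    rw [hx, Matrix.mulVec_mulVec]
    exact this
  have hd0 : d ≠ 0 := by
    intro h0
    apply hc0
    ext i
    have := congrFun h0 i.1
    simpa [hd, f, i.2] using this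
  have hxpos : 0 < vnorm x ^ 2 := by
    rw [hx, hN.vnorm_mulVec, vnorm_sq]
    obtain ⟨i, hi⟩ := Function.ne_iff.1 hd0
    exact Finset.sum_pos' (fun _ _ => sq_nonneg _) ⟨i, Finset.mem_univ _, sq_pos_of_ne_zero hi⟩
  have h1 : nu k * vnorm x ^ 2 ≤ x ⬝ᵥ N *ᵥ x := by
    rw [hN.quadForm, hdx, hx, hN.vnorm_mulVec, vnorm_sq, Finset.mul_sum]
    refine Finset.sum_le_sum fun i _ => ?_
    rcases le_or_gt i k with h | h
    · exact mul_le_mul_of_nonneg_right (hN.sorted h) (sq_nonneg _)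
    · simp [hd1 i h]
  have h2 : x ⬝ᵥ M *ᵥ x ≤ mu k * vnorm x ^ 2 := by
    rw [hM.quadForm, ← hM.vnorm_transpose_mulVec, vnorm_sq, Finset.mul_sum]
    refine Finset.sum_le_sum fun i _ => ?_
    rcases lt_or_ge i k with h | h
    · simp [hPx i h]
    · exact mul_le_mul_of_nonneg_right (hM.sorted h) (sq_nonneg _)
  have h3 := (abs_le.1 (abs_dotProduct_mulVec_le (N - M) x x)).2
  rw [Matrix.sub_mulVec, dotProduct_sub] at h3
  refine le_of_mul_le_mul_right ?_ hxpos
  nlinarith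

theorem abs_eigenvalue_sub_le {M N P R : Matrix (Fin K) (Fin K) ℝ} {mu nu : Fin K → ℝ}
    (hM : IsEVD M P mu) (hN : IsEVD N R nu) (k : Fin K) :
    |nu k - mu k| ≤ frobNorm (N - M) := by
  have h1 := hM.eigenvalue_le hN k
  have h2 := hN.eigenvalue_le hM k
  rw [← frobNorm_neg, neg_sub] at h2
  rw [abs_le]
  constructor <;> linarith

end IsEVD

end EVD

end SBMTest

namespace SBMTest

/-! ### Spectral matching of perturbed friendly matrices -/

section Matching

variable {K : ℕ}

/-- The vector `∑_{l ≠ k} (q_lᵀ 1) / (lam_k - lam_l) q_l`, whose product with `E q_k` is the first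
order change of the column sum `q_kᵀ 1` under a perturbation `E`. -/
noncomputable def resolventVec (Q : Matrix (Fin K) (Fin K) ℝ) (lam : Fin K → ℝ) (k : Fin K) :
    Fin K → ℝ :=
  Q *ᵥ fun l => if l = k then 0 else (∑ i, Q i l) / (lam k - lam l)

variable {B Q : Matrix (Fin K) (Fin K) ℝ} {lam : Fin K → ℝ} {θ η : ℝ}

theorem IsEVD.sum_colSum_sq (h : IsEVD B Q lam) : ∑ l, (∑ i, Q i l) ^ 2 = K := by
  have h1 : vnorm (Qᵀ *ᵥ fun _ => (1 : ℝ)) ^ 2 = vnorm (fun _ : Fin K => (1 : ℝ)) ^ 2 := by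
    rw [h.vnorm_transpose_mulVec]
  rw [vnorm_sq, vnorm_sq] at h1
  simpa [Matrix.mulVec, dotProduct] using h1

/-- The coefficients are column sums divided by gaps larger than η, and the squared column sums add
up to K by Parseval for the all-ones vector. -/
theorem IsEVD.vnorm_resolventVec_le (h : IsEVD B Q lam) (hη : 0 < η)
    (hgap : ∀ k l, k ≠ l → η < |lam k - lam l|) (k : Fin K) :
    vnorm (resolventVec Q lam k) ≤ Real.sqrt K / η := by
  refine le_of_sq_le_sq ?_ (by positivity)
  rw [resolventVec, h.vnorm_mulVec, vnorm_sq, div_pow, Real.sq_sqrt (by positivity),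
    ← h.sum_colSum_sq, Finset.sum_div]
  refine Finset.sum_le_sum fun l _ => ?_
  by_cases hl : l = k
  · rw [if_pos hl, zero_pow two_ne_zero]; positivity
  · rw [if_neg hl, div_pow]
    refine div_le_div_of_nonneg_left (sq_nonneg _) (by positivity) ?_
    rw [← sq_abs (lam k - lam l)]
    exact pow_le_pow_left₀ hη.le (hgap k l (Ne.symm hl)).le 2

/-- Signs of the coefficients `q̂_kᵀ q_k` of perturbed eigenvectors, together with the closeness of
the eigenvectors and the signs of the column sums. -/
theorem IsEVD.exists_sign {Q' E : Matrix (Fin K) (Fin K) ℝ} {lam' : Fin K → ℝ}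
    (h : IsEVD B Q lam) (h' : IsEVD (B + E) Q' lam') (hθ : 0 < θ) (hθ' : θ * Real.sqrt K < 1 / 4)
    (hη : 0 < η) (hgap : ∀ k l, k ≠ l → η < |lam k - lam l|) (hcol : ∀ k, θ < |∑ i, Q i k|)
    (hE : frobNorm E ≤ 7 / 16 * (θ * η))
    (hlin : ∀ k, |resolventVec Q lam k ⬝ᵥ E *ᵥ Q.col k| ≤ 4 / 7 * θ) (k : Fin K) :
    ∃ s : ℝ, s ^ 2 = 1 ∧ vnorm (s • Q'.col k - Q.col k) ^ 2 ≤ θ ^ 2 / 2 ∧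
      0 < s * (∑ i, Q' i k) * ∑ i, Q i k := by
  have hK : (1 : ℝ) ≤ Real.sqrt K := by
    rw [Real.one_le_sqrt]
    exact_mod_cast (Nat.one_le_iff_ne_zero.2 (by rintro rfl; exact k.elim0))
  have hθ4 : θ < 1 / 4 := by nlinarith
  -- In the basis `Q`, with y the perturbed eigenvector and g its image under `E`, the eigenvalue
  -- equation reads (λ'_k − λ_l) y_l = g_l.
  set y := Qᵀ *ᵥ Q'.col k with hy
  have hQy : Q *ᵥ y = Q'.col k := by
    rw [hy, Matrix.mulVec_mulVec, h.mul_transpose, Matrix.one_mulVec]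
  have hy1 : vnorm y = 1 := by rw [hy, h.vnorm_transpose_mulVec, h'.vnorm_col]
  have hsumy : ∑ l, y l ^ 2 = 1 := by rw [← vnorm_sq, hy1]; norm_num
  have hlam : |lam' k - lam k| ≤ 7 / 16 * (θ * η) := by
    have := h.abs_eigenvalue_sub_le h' k
    rw [add_sub_cancel_left] at this
    exact this.trans hE
  set g := Qᵀ *ᵥ (E *ᵥ Q'.col k) with hg
  have hgn : vnorm g ≤ 7 / 16 * (θ * η) := by
    rw [hg, h.vnorm_transpose_mulVec]
    refine (vnorm_mulVec_le _ _).trans ?_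
    rw [h'.vnorm_col, mul_one]
    exact hE
  have heq : ∀ l, lam l * y l + g l = lam' k * y l := by
    intro l
    have h1 := h'.mulVec_col k
    rw [Matrix.add_mulVec] at h1
    have h2 := congrFun (congrArg (fun v => Qᵀ *ᵥ v) h1) l
    simp only [Matrix.mulVec_add, Matrix.mulVec_smul, Pi.add_apply, Pi.smul_apply, smul_eq_mul,
      h.transpose_mulVec_mulVec] at h2
    exact h2
  -- the component orthogonal to `q_k`
  set p : Fin K → ℝ := fun l => if l = k then 0 else y l with hp
  have hpk : ∀ l, l ≠ k → p l = y l := fun l hl => if_neg hl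
  have hp1 : vnorm p ≤ θ / 2 := by
    -- Weyl and θ < 1/4 give |λ'_k − λ_l| ≥ η − 7/16·θη ≥ 57/64·η for l ≠ k; then 7/16·64/57 < 1/2
    -- yields the bound on p.
    have h1 : (57 / 64 * η) * vnorm p ≤ vnorm g := by
      refine le_of_sq_le_sq ?_ (vnorm_nonneg _)
      rw [mul_pow, vnorm_sq, vnorm_sq, Finset.mul_sum]
      refine Finset.sum_le_sum fun l _ => ?_
      by_cases hl : l = k
      · simp only [hp, hl, if_true]
        nlinarith [sq_nonneg (g k)]
      · rw [hpk l hl]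
        have h2 : g l = (lam' k - lam l) * y l := by linarith [heq l]
        rw [h2, mul_pow (lam' k - lam l)]
        refine mul_le_mul_of_nonneg_right ?_ (sq_nonneg _)
        rw [← sq_abs (lam' k - lam l)]
        refine pow_le_pow_left₀ (by positivity) ?_ 2
        have h3 := hgap k l (Ne.symm hl)
        have h4 := abs_sub_le (lam k) (lam' k) (lam l)
        rw [abs_sub_comm (lam k) (lam' k)] at h4
        nlinarith
    have h2 : (57 / 64 * η) * vnorm p ≤ (57 / 64 * η) * (θ / 2) := by
      nlinarith [mul_pos hθ hη]
    exact le_of_mul_le_mul_left h2 (by positivity)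
  have hyk : y k ^ 2 = 1 - vnorm p ^ 2 := by
    have h1 : ∑ l ∈ Finset.univ.erase k, p l ^ 2 = ∑ l ∈ Finset.univ.erase k, y l ^ 2 :=
      Finset.sum_congr rfl fun l hl => by rw [hpk l (Finset.ne_of_mem_erase hl)]
    have h2 : p k = 0 := if_pos rfl
    rw [vnorm_sq, ← hsumy, ← Finset.add_sum_erase _ _ (Finset.mem_univ k),
      ← Finset.add_sum_erase _ (fun l => p l ^ 2) (Finset.mem_univ k), h1, h2]
    ring
  have hpsq : vnorm p ^ 2 ≤ (θ / 2) ^ 2 := pow_le_pow_left₀ (vnorm_nonneg _) hp1 2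
  have hyk1 : |y k| ≤ 1 := by
    rw [← hy1]; exact abs_le_vnorm y k
  have hyk2 : 63 / 64 ≤ |y k| := by
    have : |y k| ^ 2 = 1 - vnorm p ^ 2 := by rw [sq_abs, hyk]
    nlinarith [abs_nonneg (y k)]
  -- With this sign, the squared distance of the eigenvectors is 2 − 2|y_k| ≤ 2(1 − y_k²) = 2‖p‖².
  set s : ℝ := ((SignType.sign (y k) : SignType) : ℝ) with hs
  have hyk0 : y k ≠ 0 := by
    intro h0; rw [h0] at hyk2; norm_num at hyk2
  have hs2 : s ^ 2 = 1 := by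
    rcases lt_or_gt_of_ne hyk0 with h0 | h0 <;> simp [hs, h0]
  have hsy : s * y k = |y k| := by rw [hs]; exact sign_mul_self _
  refine ⟨s, hs2, ?_, ?_⟩
  · have h1 : vnorm (s • Q'.col k - Q.col k) ^ 2 = 2 - 2 * |y k| := by
      have h2 : Q'.col k ⬝ᵥ Q.col k = y k := by
        rw [hy, dotProduct_comm]; rfl
      have h3 : Q'.col k ⬝ᵥ Q'.col k = 1 := by
        rw [← vnorm_sq_eq_dotProduct, h'.vnorm_col, one_pow]
      have h4 : Q.col k ⬝ᵥ Q.col k = 1 := by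
        rw [← vnorm_sq_eq_dotProduct, h.vnorm_col, one_pow]
      rw [vnorm_sq_eq_dotProduct, sub_dotProduct, dotProduct_sub, dotProduct_sub, smul_dotProduct,
        dotProduct_smul, dotProduct_smul, smul_dotProduct, dotProduct_comm (Q.col k), h2, h3, h4]
      simp only [smul_eq_mul]
      linear_combination hs2 - 2 * hsy
    have h2 : |y k| ^ 2 = 1 - vnorm p ^ 2 := by rw [sq_abs, hyk]
    rw [h1]
    nlinarith
  · set u : Fin K → ℝ := fun l => ∑ i, Q i l with hu
    set b : Fin K → ℝ := fun l => if l = k then 0 else u l / (lam k - lam l) with hb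
    have ha : resolventVec Q lam k = Q *ᵥ b := rfl
    have hbn : vnorm b ≤ Real.sqrt K / η := by
      have := h.vnorm_resolventVec_le hη hgap k
      rwa [ha, h.vnorm_mulVec] at this
    -- expansion of the perturbed column sum
    have h1 : ∑ i, Q' i k = ∑ l, u l * y l := by
      have h2 : ∀ i, Q' i k = ∑ l, Q i l * y l := fun i => (congrFun hQy i).symm
      simp only [h2, hu, Finset.sum_mul]
      exact Finset.sum_comm
    -- Writing u_l = b_l (λ_k − λ_l) lets the eigenvalue equation replace the unknown y_l by g_l,
    -- which carries a factor E, plus a shift of the eigenvalue.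
    have h2 : ∑ l, u l * y l = u k * y k + ∑ l, b l * (lam k - lam l) * y l := by
      rw [← Finset.add_sum_erase _ _ (Finset.mem_univ k),
        ← Finset.add_sum_erase _ (fun l => b l * (lam k - lam l) * y l) (Finset.mem_univ k)]
      simp only [hb, if_true, zero_mul, zero_add]
      congr 1
      refine Finset.sum_congr rfl fun l hl => ?_
      have hl := Finset.ne_of_mem_erase hl
      have : lam k - lam l ≠ 0 := by
        intro h0
        have := hgap k l (Ne.symm hl)
        rw [h0, abs_zero] at this
        linarith
      rw [if_neg hl, div_mul_cancel₀ _ this]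
    have h3 : ∑ l, b l * (lam k - lam l) * y l = b ⬝ᵥ g + (lam k - lam' k) * (b ⬝ᵥ p) := by
      rw [dotProduct, dotProduct, Finset.mul_sum, ← Finset.sum_add_distrib]
      refine Finset.sum_congr rfl fun l _ => ?_
      by_cases hl : l = k
      · simp [hb, hl]
      · rw [hpk l hl]
        linear_combination -(b l) * (heq l)
    have h4 : Q'.col k = y k • Q.col k + Q *ᵥ p := by
      rw [← hQy, ← Matrix.mulVec_single_one, ← Matrix.mulVec_smul, ← Matrix.mulVec_add]
      congr 1
      ext l
      by_cases hl : l = k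
      · subst hl; simp [hp]
      · simp [hp, hl]
    have h5 : b ⬝ᵥ g = y k * (resolventVec Q lam k ⬝ᵥ E *ᵥ Q.col k) +
        resolventVec Q lam k ⬝ᵥ E *ᵥ (Q *ᵥ p) := by
      have : b ⬝ᵥ g = resolventVec Q lam k ⬝ᵥ E *ᵥ Q'.col k := by
        rw [hg, ha, ← h.dotProduct_mulVec, Matrix.mulVec_mulVec, h.mul_transpose, Matrix.one_mulVec]
      rw [this, h4, Matrix.mulVec_add, Matrix.mulVec_smul, dotProduct_add, dotProduct_smul,
        smul_eq_mul]
    -- Common bound for the two second-order remainders, products of ‖p‖, ‖b‖ and a perturbation of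
    -- size 7/16·θη. The factor θ√K < 1/4 makes it small compared with θ.
    have hsec : θ / 2 * (Real.sqrt K / η) * (7 / 16 * (θ * η)) ≤ 7 / 128 * θ := by
      have : θ / 2 * (Real.sqrt K / η) * (7 / 16 * (θ * η)) = 7 / 32 * θ * (θ * Real.sqrt K) := by
        field_simp; ring
      rw [this]
      nlinarith
    have h6 : |resolventVec Q lam k ⬝ᵥ E *ᵥ (Q *ᵥ p)| ≤ 7 / 128 * θ := by
      refine (abs_dotProduct_mulVec_le _ _ _).trans (le_trans ?_ hsec)
      rw [ha, h.vnorm_mulVec, h.vnorm_mulVec]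
      calc frobNorm E * vnorm b * vnorm p
          ≤ (7 / 16 * (θ * η)) * (Real.sqrt K / η) * (θ / 2) := by
            gcongr
            exact vnorm_nonneg _
            exact vnorm_nonneg _
        _ = _ := by ring
    have h7 : |(lam k - lam' k) * (b ⬝ᵥ p)| ≤ 7 / 128 * θ := by
      rw [abs_mul, abs_sub_comm]
      refine le_trans ?_ hsec
      calc |lam' k - lam k| * |b ⬝ᵥ p|
          ≤ (7 / 16 * (θ * η)) * ((Real.sqrt K / η) * (θ / 2)) := by
            refine mul_le_mul hlam ((abs_dotProduct_le _ _).trans ?_) (abs_nonneg _) (by positivity)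
            exact mul_le_mul hbn hp1 (vnorm_nonneg _) (by positivity)
        _ = _ := by ring
    set L := resolventVec Q lam k ⬝ᵥ E *ᵥ Q.col k
    set R := resolventVec Q lam k ⬝ᵥ E *ᵥ (Q *ᵥ p) + (lam k - lam' k) * (b ⬝ᵥ p) with hR
    have h8 : ∑ i, Q' i k = y k * (u k + L) + R := by
      rw [h1, h2, h3, h5, hR]; ring
    have hRle : |s * R| ≤ 7 / 64 * θ := by
      have hs1 : |s| = 1 := by
        have := (sq_eq_sq₀ (abs_nonneg s) zero_le_one).1 (by rw [sq_abs, hs2, one_pow])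
        exact this
      rw [abs_mul, hs1, one_mul, hR]
      exact (abs_add_le _ _).trans (by linarith)
    have hL := hlin k
    have hck : θ < |u k| := hcol k
    have h9 : s * (∑ i, Q' i k) = |y k| * (u k + L) + s * R := by
      rw [h8, ← hsy]; ring
    change 0 < s * (∑ i, Q' i k) * u k
    rw [h9]
    have hL' := abs_le.1 hL
    have hR' := abs_le.1 hRle
    -- The linear term removes at most 4/7·θ from |u_k| > θ. What remains, 63/64·3/7·θ = 27/64·θ,
    -- beats the remainder 7/64·θ.
    rcases abs_cases (u k) with ⟨hc, hc0⟩ | ⟨hc, hc0⟩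
    · refine mul_pos ?_ (by linarith)
      have := mul_le_mul hyk2 (show 3 / 7 * θ ≤ u k + L by linarith) (by positivity) (abs_nonneg _)
      linarith
    · refine mul_pos_of_neg_of_neg ?_ (by linarith)
      have := mul_le_mul hyk2 (show 3 / 7 * θ ≤ -(u k + L) by linarith) (by positivity)
        (abs_nonneg _)
      linarith

theorem IsEVD.permConj {Q : Matrix (Fin K) (Fin K) ℝ} (h : IsEVD B Q lam)
    (σ : Equiv.Perm (Fin K)) : IsEVD (permConj σ B) (Q.submatrix σ id) lam where
  orthogonal := by
    rw [Matrix.mem_orthogonalGroup_iff, Matrix.transpose_submatrix,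
      ← Matrix.submatrix_mul _ _ _ _ _ Function.bijective_id, h.mul_transpose]
    simp
  sorted := h.sorted
  decomp := by
    ext k l
    rw [permConj_apply]
    conv_lhs => rw [h.decomp]
    simp [Matrix.mul_apply, Matrix.diagonal_apply]

theorem permConj_permConj (σ τ : Equiv.Perm (Fin K)) (M : Matrix (Fin K) (Fin K) ℝ) :
    SBMTest.permConj τ (SBMTest.permConj σ M) = SBMTest.permConj (σ * τ) M := by
  ext k l
  simp [permConj_apply]

/-- If two matrices are small perturbations of relabelled versions of one friendly matrix, then
spectral matching recovers the relative relabelling. -/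
theorem IsSpectralMatch.eq_inv_mul {E₁ E₂ : Matrix (Fin K) (Fin K) ℝ} {σ₁ σ₂ τ : Equiv.Perm (Fin K)}
    (hm : IsSpectralMatch (SBMTest.permConj σ₁ (B + E₁)) (SBMTest.permConj σ₂ (B + E₂)) τ)
    (h : IsEVD B Q lam) (hθ : 0 < θ) (hθ' : θ * Real.sqrt K < 1 / 4)
    (hη : 0 < η) (hgap : ∀ k l, k ≠ l → η < |lam k - lam l|) (hcol : ∀ k, θ < |∑ i, Q i k|)
    (hE₁ : frobNorm E₁ ≤ 7 / 16 * (θ * η)) (hE₂ : frobNorm E₂ ≤ 7 / 16 * (θ * η))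
    (hlin₁ : ∀ k, |resolventVec Q lam k ⬝ᵥ E₁ *ᵥ Q.col k| ≤ 4 / 7 * θ)
    (hlin₂ : ∀ k, |resolventVec Q lam k ⬝ᵥ E₂ *ᵥ Q.col k| ≤ 4 / 7 * θ) :
    τ = σ₁⁻¹ * σ₂ := by
  obtain ⟨Q₁, Q₂, lam₁, lam₂, h₁, h₂, hlap⟩ := hm
  have h₁' : IsEVD (B + E₁) (Q₁.submatrix ⇑(σ₁⁻¹) id) lam₁ := by
    have := h₁.permConj σ₁⁻¹
    rw [permConj_permConj, mul_inv_cancel] at this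
    convert this
    ext; simp [permConj_apply]
  have h₂' : IsEVD (B + E₂) (Q₂.submatrix ⇑(σ₂⁻¹) id) lam₂ := by
    have := h₂.permConj σ₂⁻¹
    rw [permConj_permConj, mul_inv_cancel] at this
    convert this
    ext; simp [permConj_apply]
  choose s₁ hs₁ hv₁ hp₁ using h.exists_sign h₁' hθ hθ' hη hgap hcol hE₁ hlin₁
  choose s₂ hs₂ hv₂ hp₂ using h.exists_sign h₂' hθ hθ' hη hgap hcol hE₂ hlin₂
  have hK4 : (K : ℝ) * θ ^ 2 ≤ 1 / 16 := by
    have h0 : Real.sqrt K ^ 2 = K := Real.sq_sqrt (by positivity)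
    rw [← h0]
    nlinarith [mul_nonneg hθ.le (Real.sqrt_nonneg K)]
  have hi₁ : ∀ x, σ₁⁻¹ (σ₁ x) = x := fun x => by simp
  have hi₂ : ∀ x, σ₂⁻¹ (σ₂ x) = x := fun x => by simp
  have hi₃ : ∀ x, σ₁ (σ₁⁻¹ x) = x := fun x => by simp
  -- the signs used by the algorithm
  have hsign : ∀ k, Real.sign ((∑ i, Q₂ i k) / ∑ i, Q₁ i k) = s₁ k * s₂ k := by
    intro k
    have e₁ : ∑ i, Q₁.submatrix (⇑(σ₁⁻¹)) id i k = ∑ i, Q₁ i k :=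
      Equiv.sum_comp σ₁⁻¹ fun i => Q₁ i k
    have e₂ : ∑ i, Q₂.submatrix (⇑(σ₂⁻¹)) id i k = ∑ i, Q₂ i k :=
      Equiv.sum_comp σ₂⁻¹ fun i => Q₂ i k
    have p₁ := hp₁ k
    have p₂ := hp₂ k
    rw [e₁] at p₁
    rw [e₂] at p₂
    set x₁ := ∑ i, Q₁ i k
    set x₂ := ∑ i, Q₂ i k
    set u := ∑ i, Q i k
    have hx₁ : x₁ ≠ 0 := by rintro h0; simp [h0] at p₁
    have hprod : 0 < s₁ k * s₂ k * (x₁ * x₂) := by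
      have h3 := mul_pos p₁ p₂
      have h4 : s₁ k * x₁ * u * (s₂ k * x₂ * u) = s₁ k * s₂ k * (x₁ * x₂) * u ^ 2 := by ring
      rw [h4] at h3
      exact pos_of_mul_pos_left h3 (sq_nonneg _)
    have hdiv : x₂ / x₁ = x₁ * x₂ / x₁ ^ 2 := by field_simp
    have hss : s₁ k * s₂ k = 1 ∨ s₁ k * s₂ k = -1 := by
      rw [← sq_eq_one_iff, mul_pow, hs₁, hs₂, one_mul]
    rcases hss with h0 | h0 <;> rw [h0] at hprod ⊢
    · exact Real.sign_of_pos (by rw [hdiv]; exact div_pos (by linarith) (by positivity))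
    · exact Real.sign_of_neg (by rw [hdiv]; exact div_neg_of_neg_of_pos (by linarith) (by positivity))
  -- the signed eigenvector matrices and their product
  set U₁ : Matrix (Fin K) (Fin K) ℝ := fun i k => s₁ k * Q₁ (σ₁⁻¹ i) k with hU₁
  set U₂ : Matrix (Fin K) (Fin K) ℝ := fun i k => s₂ k * Q₂ (σ₂⁻¹ i) k with hU₂
  -- The assignment matrix consists of inner products of rows, while closeness is known for columns;
  -- summing over the columns costs a factor K, and Kθ²/2 ≤ 1/32 < (1/5)².
  have hrow : ∀ (U : Matrix (Fin K) (Fin K) ℝ),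
      (∀ k, vnorm (U.col k - Q.col k) ^ 2 ≤ θ ^ 2 / 2) → ∀ i, vnorm (U i - Q i) ≤ 1 / 5 := by
    intro U hU i
    have h1 : vnorm (U i - Q i) ^ 2 ≤ K * (θ ^ 2 / 2) := by
      calc vnorm (U i - Q i) ^ 2 = ∑ k, (U i k - Q i k) ^ 2 := by rw [vnorm_sq]; rfl
        _ ≤ ∑ _k : Fin K, θ ^ 2 / 2 := by
            refine Finset.sum_le_sum fun k _ => le_trans ?_ (hU k)
            rw [← sq_abs]
            exact pow_le_pow_left₀ (abs_nonneg _) (abs_le_vnorm (U.col k - Q.col k) i) 2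
        _ = K * (θ ^ 2 / 2) := by simp
    refine le_of_sq_le_sq (h1.trans ?_) (by norm_num)
    linarith
  have hr₁ := hrow U₁ hv₁
  have hr₂ := hrow U₂ hv₂
  have hU₂n : ∀ j, vnorm (U₂ j) = 1 := by
    intro j
    have h0 := h₂.vnorm_row (σ₂⁻¹ j)
    refine (pow_left_inj₀ (vnorm_nonneg _) zero_le_one two_ne_zero).1 ?_
    rw [← h0, vnorm_sq, vnorm_sq]
    refine Finset.sum_congr rfl fun k _ => ?_
    rw [hU₂]
    simp only [mul_pow, hs₂, one_mul]
  have hW : ∀ i j, |U₁ i ⬝ᵥ U₂ j - Q i ⬝ᵥ Q j| ≤ 2 / 5 := by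
    intro i j
    have e : U₁ i ⬝ᵥ U₂ j - Q i ⬝ᵥ Q j = (U₁ i - Q i) ⬝ᵥ U₂ j + Q i ⬝ᵥ (U₂ j - Q j) := by
      rw [sub_dotProduct, dotProduct_sub]; ring
    rw [e]
    have b₁ := abs_dotProduct_le (U₁ i - Q i) (U₂ j)
    have b₂ := abs_dotProduct_le (Q i) (U₂ j - Q j)
    rw [hU₂n] at b₁
    rw [h.vnorm_row] at b₂
    refine (abs_add_le _ _).trans ?_
    linarith [hr₁ i, hr₂ j]
  have hQQ : ∀ i j, Q i ⬝ᵥ Q j = (1 : Matrix (Fin K) (Fin K) ℝ) i j := by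
    intro i j
    rw [← h.mul_transpose]; rfl
  -- the objective of the assignment problem
  have hobj : ∀ ρ : Equiv.Perm (Fin K), (ρ.permMatrix ℝ * (Q₁ * Matrix.diagonal (fun k =>
      Real.sign ((∑ i, Q₂ i k) / ∑ i, Q₁ i k)) * Q₂ᵀ)).trace =
      ∑ i, U₁ (σ₁ (ρ i)) ⬝ᵥ U₂ (σ₂ i) := by
    intro ρ
    rw [Matrix.trace]
    refine Finset.sum_congr rfl fun i _ => ?_
    rw [Matrix.diag_apply, Equiv.Perm.permMatrix, PEquiv.toMatrix_toPEquiv_mul]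
    simp only [Matrix.submatrix_apply, id, Matrix.mul_apply, Matrix.diagonal_apply, hsign, mul_ite,
      mul_zero, Finset.sum_ite_eq', Finset.mem_univ, if_true, Matrix.transpose_apply, dotProduct,
      hU₁, hU₂, hi₁, hi₂]
    exact Finset.sum_congr rfl fun k _ => by ring
  by_contra hne
  have h0 := hlap (σ₁⁻¹ * σ₂)
  rw [hobj, hobj] at h0
  refine absurd h0 (not_le.2 ?_)
  -- A correct match gains at least 3/5 and a wrong one at most 2/5, so a permutation with any wrong
  -- match is not optimal.
  have hdiag : ∀ i, 3 / 5 ≤ U₁ i ⬝ᵥ U₂ i := by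
    intro i
    have := (abs_le.1 (hW i i)).1
    rw [hQQ, Matrix.one_apply_eq] at this
    linarith
  have hoff : ∀ i j, i ≠ j → U₁ i ⬝ᵥ U₂ j ≤ 2 / 5 := by
    intro i j hij
    have := (abs_le.1 (hW i j)).2
    rw [hQQ, Matrix.one_apply_ne hij] at this
    linarith
  have hne' : ∃ i, σ₁ (τ i) ≠ σ₂ i := by
    by_contra hall
    push Not at hall
    apply hne
    ext i
    rw [Equiv.Perm.mul_apply, ← hall i, hi₁]
  obtain ⟨i₀, hi₀⟩ := hne'
  simp only [Equiv.Perm.mul_apply, hi₃]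
  refine Finset.sum_lt_sum (fun i _ => ?_) ⟨i₀, Finset.mem_univ _, ?_⟩
  · by_cases hi : σ₁ (τ i) = σ₂ i
    · rw [hi]
    · linarith [hdiag (σ₂ i), hoff _ _ hi]
  · linarith [hdiag (σ₂ i₀), hoff _ _ hi₀]

end Matching

end SBMTest

namespace SBMTest

/-! ### Block sums as sums over pairs of nodes -/

section Blocks

variable {K m : ℕ}

/-- Weights of blocks are weights of pairs of nodes, so a linear form in the block sums is a linear
form in the independent edges. -/
theorem sum_mul_blockSum (A : Matrix (Fin m) (Fin m) ℝ) (z : Fin m → Fin K)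
    (g : Fin K → Fin K → ℝ) :
    ∑ k, ∑ l, g k l * blockSum A z k l = ∑ i, ∑ j, A i j * g (z i) (z j) := by
  have h1 : ∀ k l, g k l * blockSum A z k l =
      ∑ i, ∑ j, if z i = k then (if z j = l then A i j * g k l else 0) else 0 := by
    intro k l
    simp only [blockSum, Matrix.of_apply, Finset.mul_sum, ite_and]
    refine Finset.sum_congr rfl fun i _ => Finset.sum_congr rfl fun j _ => ?_
    split_ifs <;> ring
  simp only [h1]
  calc ∑ k, ∑ l, ∑ i, ∑ j, (if z i = k then (if z j = l then A i j * g k l else 0) else 0)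
      = ∑ k, ∑ i, ∑ j, ∑ l, (if z i = k then (if z j = l then A i j * g k l else 0) else 0) := by
        refine Finset.sum_congr rfl fun k _ => ?_
        rw [Finset.sum_comm]
        exact Finset.sum_congr rfl fun i _ => Finset.sum_comm
    _ = ∑ i, ∑ j, ∑ k, ∑ l, (if z i = k then (if z j = l then A i j * g k l else 0) else 0) := by
        rw [Finset.sum_comm]
        exact Finset.sum_congr rfl fun i _ => Finset.sum_comm
    _ = _ := by
        refine Finset.sum_congr rfl fun i _ => Finset.sum_congr rfl fun j _ => ?_
        simp

/-- The adjacency matrix of the complete graph. -/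
def offDiagOnes (m : ℕ) : Matrix (Fin m) (Fin m) ℝ := Matrix.of fun i j => if i = j then 0 else 1

/-- Viewing counts as block sums of the complete graph lets symmetry, relabelling and the effect of
wrong labels be treated once for sums and counts. -/
theorem blockCount_eq_blockSum (z : Fin m → Fin K) :
    blockCount z = blockSum (offDiagOnes m) z := by
  ext k l
  have h1 : ∀ k, (commSize z k : ℝ) = ∑ i, if z i = k then 1 else 0 := by
    intro k; simp [commSize]
  have h2 : ∀ i j : Fin m, (if z i = k ∧ z j = l then offDiagOnes m i j else 0) =
      (if z i = k then 1 else 0) * (if z j = l then 1 else 0) -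
        if i = j then (if z i = k then (if k = l then 1 else 0) else 0) else 0 := by
    intro i j
    by_cases hij : i = j
    · subst hij
      by_cases hk : z i = k
      · subst hk; simp [offDiagOnes]
      · simp [hk]
    · by_cases hk : z i = k <;> simp [offDiagOnes, hij, hk]
  simp only [blockCount, blockSum, Matrix.of_apply, h2, Finset.sum_sub_distrib,
    ← Finset.mul_sum, ← Finset.sum_mul, ← h1]
  simp only [Finset.sum_ite_eq, Finset.mem_univ, if_true]
  by_cases hkl : k = l
  · simp only [hkl, if_true, ← h1]; ring
  · simp [hkl]

theorem blockSum_comp (A : Matrix (Fin m) (Fin m) ℝ) (z : Fin m → Fin K)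
    (σ : Equiv.Perm (Fin K)) : permConj σ (blockSum A (σ ∘ z)) = blockSum A z := by
  ext k l
  simp [permConj_apply, blockSum]

theorem blockCount_comp (z : Fin m → Fin K) (σ : Equiv.Perm (Fin K)) :
    permConj σ (blockCount (σ ∘ z)) = blockCount z := by
  rw [blockCount_eq_blockSum, blockSum_comp, blockCount_eq_blockSum]

theorem blockSum_symm {A : Matrix (Fin m) (Fin m) ℝ} (hA : ∀ i j, A i j = A j i)
    (z : Fin m → Fin K) (k l : Fin K) : blockSum A z k l = blockSum A z l k := by
  simp only [blockSum, Matrix.of_apply]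
  rw [Finset.sum_comm]
  refine Finset.sum_congr rfl fun i _ => Finset.sum_congr rfl fun j _ => ?_
  rw [hA i j]
  simp only [and_comm]

theorem blockSum_mono {A A' : Matrix (Fin m) (Fin m) ℝ} (h : ∀ i j, A i j ≤ A' i j)
    (z : Fin m → Fin K) (k l : Fin K) : blockSum A z k l ≤ blockSum A' z k l := by
  simp only [blockSum, Matrix.of_apply]
  refine Finset.sum_le_sum fun i _ => Finset.sum_le_sum fun j _ => ?_
  split_ifs
  · exact h i j
  · exact le_rfl

theorem blockSum_nonneg {A : Matrix (Fin m) (Fin m) ℝ} (h : ∀ i j, 0 ≤ A i j)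
    (z : Fin m → Fin K) (k l : Fin K) : 0 ≤ blockSum A z k l := by
  simp only [blockSum, Matrix.of_apply]
  refine Finset.sum_nonneg fun i _ => Finset.sum_nonneg fun j _ => ?_
  split_ifs
  · exact h i j
  · exact le_rfl

theorem offDiagOnes_symm (i j : Fin m) : offDiagOnes m i j = offDiagOnes m j i := by
  simp [offDiagOnes, eq_comm]

theorem offDiagOnes_nonneg (i j : Fin m) : 0 ≤ offDiagOnes m i j := by
  simp only [offDiagOnes, Matrix.of_apply]; split_ifs <;> norm_num

open scoped Classical in
theorem adjacency_apply (G : SimpleGraph (Fin m)) (i j : Fin m) :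
    adjacency G i j = if G.Adj i j then 1 else 0 := by
  rw [adjacency, SimpleGraph.adjMatrix_apply]

theorem adjacency_symm (G : SimpleGraph (Fin m)) (i j : Fin m) :
    adjacency G i j = adjacency G j i := by
  classical
  rw [adjacency_apply, adjacency_apply, G.adj_comm]

theorem adjacency_nonneg (G : SimpleGraph (Fin m)) (i j : Fin m) : 0 ≤ adjacency G i j := by
  classical
  rw [adjacency_apply]; split_ifs <;> norm_num

theorem adjacency_le (G : SimpleGraph (Fin m)) (i j : Fin m) :
    adjacency G i j ≤ offDiagOnes m i j := by
  classical
  rw [adjacency_apply, offDiagOnes, Matrix.of_apply]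
  by_cases h : i = j
  · simp [h]
  · simp only [h, if_false]; split_ifs <;> norm_num

/-- Sums of symmetric functions over ordered pairs of distinct nodes. -/
theorem sum_sum_eq_two_mul {h : Fin m → Fin m → ℝ} (hs : ∀ i j, h i j = h j i)
    (hd : ∀ i, h i i = 0) :
    ∑ i, ∑ j, h i j = 2 * ∑ i, ∑ j ∈ Finset.Ioi i, h i j := by
  have h1 : ∀ i, ∑ j, h i j = ∑ j ∈ Finset.Ioi i, h i j + ∑ j ∈ Finset.Iio i, h i j := by
    intro i
    have hu : (Finset.univ : Finset (Fin m)) = insert i (Finset.Ioi i ∪ Finset.Iio i) := by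
      ext j
      rcases lt_trichotomy i j with h | h | h
      · simp [h]
      · simp [h]
      · simp [h]
    rw [hu, Finset.sum_insert (by simp), hd, zero_add, Finset.sum_union]
    rw [Finset.disjoint_left]
    intro j hj hj'
    exact absurd (Finset.mem_Ioi.1 hj) (not_lt.2 (Finset.mem_Iio.1 hj').le)
  have h2 : ∑ i, ∑ j ∈ Finset.Iio i, h i j = ∑ i, ∑ j ∈ Finset.Ioi i, h i j := by
    rw [Finset.sum_comm' (t' := Finset.univ) (s' := fun j => Finset.Ioi j) (by simp)]
    exact Finset.sum_congr rfl fun i _ => Finset.sum_congr rfl fun j _ => hs _ _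
  simp only [h1, Finset.sum_add_distrib, h2]
  ring

end Blocks

/-! ### Moment generating functions of a stochastic block model given the labels -/

section Mgf

variable {K m : ℕ}

open scoped Classical in
/-- The conditional probability of the graph `G` given the labels `z`. -/
noncomputable def edgeWeight (B : Matrix (Fin K) (Fin K) ℝ) (z : Fin m → Fin K)
    (G : SimpleGraph (Fin m)) : ℝ :=
  ∏ i, ∏ j ∈ Finset.Ioi i, if G.Adj i j then B (z i) (z j) else 1 - B (z i) (z j)

theorem sbmWeight_eq (B : Matrix (Fin K) (Fin K) ℝ) (p : Fin K → ℝ) (z : Fin m → Fin K)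
    (G : SimpleGraph (Fin m)) : sbmWeight B p z G = (∏ i, p (z i)) * edgeWeight B z G := rfl

theorem edgeWeight_nonneg {B : Matrix (Fin K) (Fin K) ℝ} (hB : ∀ k l, B k l ∈ Set.Icc (0 : ℝ) 1)
    (z : Fin m → Fin K) (G : SimpleGraph (Fin m)) : 0 ≤ edgeWeight B z G := by
  refine Finset.prod_nonneg fun i _ => Finset.prod_nonneg fun j _ => ?_
  have := hB (z i) (z j)
  split_ifs
  · exact this.1
  · linarith [this.2]

-- A graph is a set of pairs i < j, so summing over graphs is expanding a product of binomials.
open scoped Classical in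
theorem sum_graph_prod (a b : Fin m → Fin m → ℝ) :
    ∑ G : SimpleGraph (Fin m), ∏ i, ∏ j ∈ Finset.Ioi i, (if G.Adj i j then a i j else b i j) =
      ∏ i, ∏ j ∈ Finset.Ioi i, (a i j + b i j) := by
  set s : Finset (Fin m × Fin m) := Finset.univ.filter fun p => p.1 < p.2 with hs
  have hprod : ∀ f : Fin m → Fin m → ℝ,
      ∏ i, ∏ j ∈ Finset.Ioi i, f i j = ∏ p ∈ s, f p.1 p.2 := by
    intro f
    rw [hs, Finset.prod_filter, ← Finset.univ_product_univ, Finset.prod_product]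
    refine Finset.prod_congr rfl fun i _ => ?_
    rw [← Finset.prod_filter]
    refine Finset.prod_congr ?_ fun _ _ => rfl
    ext j; simp
  simp only [hprod]
  rw [Finset.prod_add]
  refine Finset.sum_bij' (fun G _ => s.filter fun p => G.Adj p.1 p.2)
    (fun t _ => SimpleGraph.fromRel fun i j => i < j ∧ (i, j) ∈ t) ?_ ?_ ?_ ?_ ?_
  · intro G _
    exact Finset.mem_powerset.2 (Finset.filter_subset _ _)
  · intro t _
    exact Finset.mem_univ _
  · intro G _
    ext i j
    simp only [SimpleGraph.fromRel_adj, hs, Finset.mem_filter, Finset.mem_univ, true_and]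
    constructor
    · rintro ⟨_, ⟨_, _, h⟩ | ⟨_, _, h⟩⟩
      · exact h
      · exact h.symm
    · intro h
      refine ⟨h.ne, ?_⟩
      rcases lt_or_gt_of_ne h.ne with h' | h'
      · exact Or.inl ⟨h', h', h⟩
      · exact Or.inr ⟨h', h', h.symm⟩
  · intro t ht
    ext ⟨i, j⟩
    have ht := Finset.mem_powerset.1 ht
    simp only [SimpleGraph.fromRel_adj, Finset.mem_filter]
    constructor
    · rintro ⟨h, _, ⟨_, h'⟩ | ⟨h', _⟩⟩
      · exact h'
      · simp only [hs, Finset.mem_filter, Finset.mem_univ, true_and] at h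
        exact absurd h (not_lt.2 h'.le)
    · intro h
      have h' := ht h
      simp only [hs, Finset.mem_filter, Finset.mem_univ, true_and] at h'
      exact ⟨ht h, h'.ne, Or.inl ⟨h', h⟩⟩
  · intro G _
    rw [Finset.prod_ite, Finset.filter_not]

theorem sum_edgeWeight (B : Matrix (Fin K) (Fin K) ℝ) (z : Fin m → Fin K) :
    ∑ G, edgeWeight B z G = 1 := by
  classical
  simp only [edgeWeight]
  rw [sum_graph_prod]
  simp

/-- The moment generating function of a linear function of the adjacency matrix. -/
theorem sum_edgeWeight_mul_exp_le {B : Matrix (Fin K) (Fin K) ℝ} (hs : B.IsSymm)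
    (hB : ∀ k l, B k l ∈ Set.Icc (0 : ℝ) 1) (z : Fin m → Fin K) {c : Fin m → Fin m → ℝ}
    (hc : ∀ i j, c i j = c j i) :
    ∑ G, edgeWeight B z G * Real.exp (∑ i, ∑ j, adjacency G i j * c i j) ≤
      Real.exp (∑ i, ∑ j, offDiagOnes m i j *
        (B (z i) (z j) * (Real.exp (2 * c i j) - 1) / 2)) := by
  classical
  have hBs : ∀ k l, B k l = B l k := fun k l => (hs.apply k l).symm
  have h1 : ∀ G : SimpleGraph (Fin m),
      edgeWeight B z G * Real.exp (∑ i, ∑ j, adjacency G i j * c i j) =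
        ∏ i, ∏ j ∈ Finset.Ioi i, (if G.Adj i j then B (z i) (z j) * Real.exp (2 * c i j)
          else 1 - B (z i) (z j)) := by
    intro G
    rw [sum_sum_eq_two_mul (fun i j => by rw [adjacency_symm, hc])
      (fun i => by rw [adjacency_apply]; simp), Finset.mul_sum, Real.exp_sum, edgeWeight,
      ← Finset.prod_mul_distrib]
    refine Finset.prod_congr rfl fun i _ => ?_
    rw [Finset.mul_sum, Real.exp_sum, ← Finset.prod_mul_distrib]
    refine Finset.prod_congr rfl fun j _ => ?_
    rw [adjacency_apply]
    split_ifs <;> simp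
  simp only [h1]
  rw [sum_graph_prod, sum_sum_eq_two_mul, Finset.mul_sum, Real.exp_sum]
  · refine Finset.prod_le_prod (fun i _ => Finset.prod_nonneg fun j _ => ?_) fun i _ => ?_
    · have := hB (z i) (z j)
      have := mul_nonneg this.1 (Real.exp_pos (2 * c i j)).le
      linarith [(hB (z i) (z j)).2]
    · rw [Finset.mul_sum, Real.exp_sum]
      refine Finset.prod_le_prod (fun j _ => ?_) fun j hj => ?_
      · have := hB (z i) (z j)
        have := mul_nonneg this.1 (Real.exp_pos (2 * c i j)).le
        linarith [(hB (z i) (z j)).2]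
      · have hne : i ≠ j := (Finset.mem_Ioi.1 hj).ne
        -- Each factor is 1 + B(e^{2c} − 1) ≤ exp(B(e^{2c} − 1)); the 2, and the division by 2 in
        -- the statement, appear because the double sums count every edge in both orders.
        have := Real.add_one_le_exp (B (z i) (z j) * (Real.exp (2 * c i j) - 1))
        have e : 2 * (offDiagOnes m i j * (B (z i) (z j) * (Real.exp (2 * c i j) - 1) / 2)) =
            B (z i) (z j) * (Real.exp (2 * c i j) - 1) := by
          simp [offDiagOnes, hne]; ring
        rw [e]
        linarith
  · intro i j
    rw [offDiagOnes_symm, hc i j, hBs]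
  · intro i
    simp [offDiagOnes]

/-- Taylor expansion with 1/2 + 1/18 + 5/864 < 9/16. It is applied at s = 2g, whence the restriction
|g| ≤ 1/6 and the constant 9/8 in the next bound. -/
theorem exp_le_of_abs_le {s : ℝ} (hs : |s| ≤ 1 / 3) : Real.exp s ≤ 1 + s + 9 / 16 * s ^ 2 := by
  have h := Real.exp_bound (x := s) (by linarith) (n := 4) (by norm_num)
  have h1 := (abs_le.1 h).2
  simp only [Finset.sum_range_succ, Finset.sum_range_zero] at h1
  norm_num [Nat.factorial] at h1
  have hs' := abs_le.1 hs
  have h2 : |s| ^ 4 = s ^ 4 := by rw [← abs_pow, abs_of_nonneg (by positivity)]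
  rw [h2] at h1
  have h3 : s ^ 2 ≤ 1 / 9 := by nlinarith
  have h4 : s ^ 3 ≤ 1 / 3 * s ^ 2 := by nlinarith [sq_nonneg s]
  have h5 : s ^ 4 ≤ 1 / 9 * s ^ 2 := by nlinarith [sq_nonneg s]
  nlinarith

/-- Moment generating function of linear functions of the centred block sums. -/
theorem sum_edgeWeight_mul_exp_block_le {B : Matrix (Fin K) (Fin K) ℝ} (hs : B.IsSymm)
    (hB : ∀ k l, B k l ∈ Set.Icc (0 : ℝ) 1) (z : Fin m → Fin K) {g : Fin K → Fin K → ℝ}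
    (hg : ∀ k l, g k l = g l k) (hg' : ∀ k l, |g k l| ≤ 1 / 6) :
    ∑ G, edgeWeight B z G * Real.exp (∑ k, ∑ l, g k l *
        (blockSum (adjacency G) z k l - blockCount z k l * B k l)) ≤
      Real.exp (9 / 8 * ∑ k, ∑ l, g k l ^ 2 * (blockCount z k l * B k l)) := by
  have h1 : ∀ G : SimpleGraph (Fin m), edgeWeight B z G * Real.exp (∑ k, ∑ l, g k l *
        (blockSum (adjacency G) z k l - blockCount z k l * B k l)) =
      (edgeWeight B z G * Real.exp (∑ i, ∑ j, adjacency G i j * g (z i) (z j))) *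
        Real.exp (-∑ i, ∑ j, offDiagOnes m i j * (g (z i) (z j) * B (z i) (z j))) := by
    intro G
    rw [mul_assoc, ← Real.exp_add, ← sum_mul_blockSum,
      ← sum_mul_blockSum (offDiagOnes m) z (fun k l => g k l * B k l), ← blockCount_eq_blockSum,
      ← sub_eq_add_neg, ← Finset.sum_sub_distrib]
    congr 2
    refine Finset.sum_congr rfl fun k _ => ?_
    rw [← Finset.sum_sub_distrib]
    exact Finset.sum_congr rfl fun l _ => by ring
  simp only [h1]
  rw [← Finset.sum_mul]
  refine (mul_le_mul_of_nonneg_right (sum_edgeWeight_mul_exp_le hs hB z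
    (fun i j => hg (z i) (z j))) (Real.exp_pos _).le).trans ?_
  rw [← Real.exp_add]
  refine Real.exp_le_exp.2 ?_
  have h2 : 9 / 8 * ∑ k, ∑ l, g k l ^ 2 * (blockCount z k l * B k l) =
      ∑ i, ∑ j, offDiagOnes m i j * (9 / 8 * g (z i) (z j) ^ 2 * B (z i) (z j)) := by
    rw [← sum_mul_blockSum (offDiagOnes m) z (fun k l => 9 / 8 * g k l ^ 2 * B k l),
      ← blockCount_eq_blockSum, Finset.mul_sum]
    refine Finset.sum_congr rfl fun k _ => ?_
    rw [Finset.mul_sum]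
    exact Finset.sum_congr rfl fun l _ => by ring
  rw [h2, ← sub_eq_add_neg, ← Finset.sum_sub_distrib]
  refine Finset.sum_le_sum fun i _ => ?_
  rw [← Finset.sum_sub_distrib]
  refine Finset.sum_le_sum fun j _ => ?_
  rw [← mul_sub]
  refine mul_le_mul_of_nonneg_left ?_ (offDiagOnes_nonneg i j)
  have h3 := exp_le_of_abs_le (s := 2 * g (z i) (z j)) (by
    rw [abs_mul, abs_two]; linarith [hg' (z i) (z j)])
  have h4 := mul_le_mul_of_nonneg_left h3 (hB (z i) (z j)).1
  nlinarith

/-- Moment generating function of the degree of a node. -/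
theorem sum_edgeWeight_mul_exp_degree_le {B : Matrix (Fin K) (Fin K) ℝ} (hs : B.IsSymm)
    (hB : ∀ k l, B k l ∈ Set.Icc (0 : ℝ) 1) {b : ℝ} (hb : ∀ k l, B k l ≤ b) (z : Fin m → Fin K)
    (v : Fin m) :
    ∑ G, edgeWeight B z G * Real.exp (∑ j, adjacency G v j) ≤ Real.exp (2 * (m * b)) := by
  classical
  -- Sharing the degree of `v` between both orders of a pair makes `c` symmetric; each pair at `v`
  -- has 2c = 1, and e − 1 ≤ 2.
  set c : Fin m → Fin m → ℝ := fun i j => ((if i = v then 1 else 0) + if j = v then 1 else 0) / 2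
    with hc
  have hb0 : 0 ≤ b := (hB (z v) (z v)).1.trans (hb _ _)
  have h1 : ∀ G : SimpleGraph (Fin m), ∑ i, ∑ j, adjacency G i j * c i j = ∑ j, adjacency G v j := by
    intro G
    have h2 : ∀ i j, adjacency G i j * c i j =
        (if i = v then adjacency G i j / 2 else 0) + if j = v then adjacency G i j / 2 else 0 := by
      intro i j
      rw [hc]; dsimp only
      split_ifs <;> ring
    simp only [h2, Finset.sum_add_distrib]
    rw [Finset.sum_comm]
    simp only [Finset.sum_ite_eq', Finset.mem_univ, if_true]
    rw [← Finset.sum_add_distrib]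
    refine Finset.sum_congr rfl fun j _ => ?_
    rw [adjacency_symm G j v]; ring
  have h3 := sum_edgeWeight_mul_exp_le hs hB z (c := c) (fun i j => by
    rw [hc]; dsimp only; rw [add_comm])
  simp only [h1] at h3
  refine h3.trans (Real.exp_le_exp.2 ?_)
  have he : Real.exp 1 - 1 ≤ 2 := by linarith [Real.exp_one_lt_three]
  calc ∑ i, ∑ j, offDiagOnes m i j * (B (z i) (z j) * (Real.exp (2 * c i j) - 1) / 2)
      ≤ ∑ i, ∑ j, (2 * c i j * b) := by
        refine Finset.sum_le_sum fun i _ => Finset.sum_le_sum fun j _ => ?_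
        have hBb := hb (z i) (z j)
        have hB0 := (hB (z i) (z j)).1
        simp only [offDiagOnes, Matrix.of_apply, hc]
        have key : B (z i) (z j) * (Real.exp 1 - 1) / 2 ≤ b := by nlinarith
        by_cases hi : i = v <;> by_cases hj : j = v
        · simp [hi, hj]; linarith
        · subst hi
          have : i ≠ j := Ne.symm hj
          simpa [hj, this] using key
        · subst hj
          simpa [hi] using key
        · simp [hi, hj]
    _ = 2 * (m * b) := by
        have h2 : ∀ i j, 2 * c i j * b = (if i = v then b else 0) + if j = v then b else 0 := by
          intro i j
          rw [hc]; dsimp only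
          split_ifs <;> ring
        simp only [h2, Finset.sum_add_distrib]
        simp
        ring

end Mgf

/-! ### The label distribution -/

section Labels

variable {K m : ℕ}

theorem sum_prod_labels (p : Fin K → ℝ) (f : Fin K → ℝ) :
    ∑ z : Fin m → Fin K, ∏ i, (p (z i) * f (z i)) = (∑ k, p k * f k) ^ m := by
  rw [Finset.sum_pow', Fintype.piFinset_univ]

theorem sum_labels (p : Fin K → ℝ) (hp : ∑ k, p k = 1) :
    ∑ z : Fin m → Fin K, ∏ i, p (z i) = 1 := by
  have := sum_prod_labels (m := m) p (fun _ => 1)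
  simpa [hp] using this

/-- Community sizes are binomial, with Laplace transform (1 − p_k(1 − e^{-s}))^m. -/
theorem sum_labels_exp_le (p : Fin K → ℝ) (hp : ∑ k, p k = 1) (hp0 : ∀ k, 0 ≤ p k) (k : Fin K)
    (s : ℝ) :
    ∑ z : Fin m → Fin K, (∏ i, p (z i)) * Real.exp (-(s * commSize z k)) ≤
      Real.exp (-(m * p k * (1 - Real.exp (-s)))) := by
  have h1 : ∀ z : Fin m → Fin K, (∏ i, p (z i)) * Real.exp (-(s * commSize z k)) =
      ∏ i, (p (z i) * if z i = k then Real.exp (-s) else 1) := by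
    intro z
    rw [Finset.prod_mul_distrib, Finset.prod_ite, Finset.prod_const, Finset.prod_const_one, mul_one,
      ← Real.exp_nat_mul, commSize]
    congr 2; ring
  simp only [h1]
  rw [sum_prod_labels p fun l => if l = k then Real.exp (-s) else 1]
  have h2 : ∑ l, p l * (if l = k then Real.exp (-s) else 1) = 1 - p k * (1 - Real.exp (-s)) := by
    have : ∀ l, p l * (if l = k then Real.exp (-s) else 1) =
        p l - if l = k then p l * (1 - Real.exp (-s)) else 0 := by
      intro l; split_ifs <;> ring
    simp only [this, Finset.sum_sub_distrib, hp]
    simp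
  have h3 : 0 ≤ ∑ l, p l * (if l = k then Real.exp (-s) else 1) :=
    Finset.sum_nonneg fun l _ => mul_nonneg (hp0 l) (by split_ifs <;> positivity)
  rw [h2] at h3 ⊢
  have h4 := Real.add_one_le_exp (-(p k * (1 - Real.exp (-s))))
  calc _ ≤ Real.exp (-(p k * (1 - Real.exp (-s)))) ^ m := pow_le_pow_left₀ h3 (by linarith) m
    _ = _ := by rw [← Real.exp_nat_mul]; congr 1; ring

/-- (1 − s + s²/2)(1 + s + s²/2) = 1 + s⁴/4 ≥ 1, and the second factor is at most e^s. -/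
theorem exp_neg_le {s : ℝ} (hs : 0 ≤ s) : Real.exp (-s) ≤ 1 - s + s ^ 2 / 2 := by
  have h1 := Real.quadratic_le_exp_of_nonneg hs
  rw [Real.exp_neg, inv_le_comm₀ (Real.exp_pos s) (by nlinarith [sq_nonneg (s - 1)])]
  refine le_trans ?_ h1
  rw [inv_le_iff_one_le_mul₀ (by nlinarith [sq_nonneg (s - 1)])]
  nlinarith [sq_nonneg (s ^ 2)]

end Labels

end SBMTest

namespace SBMTest

/-! ### Exponential Markov inequalities in the two-sample model -/

section Probability

/-- Finitely many measurable adjacency events determine a graph. With measurable singletons, every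
function of labels and graph is measurable and its integral is a finite sum. -/
instance instMeasurableSingletonClassSimpleGraph (m : ℕ) :
    MeasurableSingletonClass (SimpleGraph (Fin m)) where
  measurableSet_singleton G := by
    have h : ({G} : Set (SimpleGraph (Fin m))) =
        ⋂ u, ⋂ v, {H | H.Adj u v ↔ G.Adj u v} := by
      ext H
      simp only [Set.mem_singleton_iff, Set.mem_iInter, Set.mem_ofPred_eq]
      constructor
      · rintro rfl u v; rfl
      · intro hH; ext u v; exact hH u v
    rw [h]
    refine MeasurableSet.iInter fun u => MeasurableSet.iInter fun v => ?_
    have hm : Measurable fun H : SimpleGraph (Fin m) => H.Adj u v :=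
      SimpleGraph.measurable_iff_adj.1 measurable_id u v
    exact measurableSet_setOfPred.2 (hm.iff measurable_const)

namespace TwoSampleSBM

variable {K : ℕ} {Ω : Type*} [MeasurableSpace Ω] (X : TwoSampleSBM K Ω)

/-- The labels and the network with index `t` in sample `r`. -/
def datum (r : Fin 2) (t : Fin (X.N r)) (ω : Ω) :
    (Fin (X.size r t) → Fin K) × SimpleGraph (Fin (X.size r t)) :=
  (X.label r t ω, X.graph r t ω)

theorem measurable_datum (r : Fin 2) (t : Fin (X.N r)) : Measurable (X.datum r t) :=
  (X.label_meas r t).prodMk (X.graph_meas r t)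

theorem iIndepFun_datum (r : Fin 2) : iIndepFun (X.datum r) X.μ :=
  X.sbm_indep.precomp (g := fun t : Fin (X.N r) => (⟨r, t⟩ : Σ r : Fin 2, Fin (X.N r)))
    (fun a b h => by simpa using h)

theorem integral_datum (r : Fin 2) (t : Fin (X.N r))
    (f : (Fin (X.size r t) → Fin K) × SimpleGraph (Fin (X.size r t)) → ℝ) :
    ∫ ω, f (X.datum r t ω) ∂X.μ = ∑ z, ∑ G, sbmWeight (X.B r) (X.prior r) z G * f (z, G) := by
  have := X.isProb
  have hm := X.measurable_datum r t
  have hf : Measurable f := measurable_of_countable f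
  rw [← integral_map hm.aemeasurable hf.aestronglyMeasurable, integral_fintype Integrable.of_finite,
    Fintype.sum_prod_type]
  refine Finset.sum_congr rfl fun z _ => Finset.sum_congr rfl fun G _ => ?_
  rw [smul_eq_mul, ← X.sbm_law r t z G, map_measureReal_apply hm (measurableSet_singleton _)]
  congr 2
  ext ω
  simp [datum]

/-- Markov's inequality for products of functions of the independent networks of one sample. -/
theorem prob_one_le_prod_le (r : Fin 2) (T : Finset (Fin (X.N r)))
    (f : ∀ t, (Fin (X.size r t) → Fin K) × SimpleGraph (Fin (X.size r t)) → ℝ)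
    (hf : ∀ t x, 0 ≤ f t x) :
    X.μ.real {ω | 1 ≤ ∏ t ∈ T, f t (X.datum r t ω)} ≤
      ∏ t ∈ T, ∑ z, ∑ G, sbmWeight (X.B r) (X.prior r) z G * f t (z, G) := by
  classical
  have := X.isProb
  -- Networks outside `T` get the factor 1, so that independence applies to the whole family.
  set F : ∀ t, (Fin (X.size r t) → Fin K) × SimpleGraph (Fin (X.size r t)) → ℝ :=
    fun t x => if t ∈ T then f t x else 1 with hF
  have h1 : ∀ ω, ∏ t ∈ T, f t (X.datum r t ω) = ∏ t, F t (X.datum r t ω) := by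
    intro ω
    simp only [hF]
    rw [Finset.prod_ite_mem, Finset.univ_inter]
  have h2 : ∫ ω, ∏ t, F t (X.datum r t ω) ∂X.μ = ∏ t, ∫ ω, F t (X.datum r t ω) ∂X.μ :=
    (X.iIndepFun_datum r).integral_fun_prod_comp
      (fun t => (X.measurable_datum r t).aemeasurable)
      (fun t => (measurable_of_countable (F t)).aestronglyMeasurable)
  have h3 : ∏ t, ∫ ω, F t (X.datum r t ω) ∂X.μ =
      ∏ t ∈ T, ∑ z, ∑ G, sbmWeight (X.B r) (X.prior r) z G * f t (z, G) := by
    rw [← Finset.univ_inter T, ← Finset.prod_ite_mem]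
    refine Finset.prod_congr rfl fun t _ => ?_
    by_cases ht : t ∈ T
    · simp only [hF, ht, if_true]
      exact X.integral_datum r t (f t)
    · simp [hF, ht]
  have hint : Integrable (fun ω => ∏ t, F t (X.datum r t ω)) X.μ := by
    have hmeas : Measurable fun ω t => X.datum r t ω :=
      measurable_pi_iff.2 fun t => X.measurable_datum r t
    exact (Integrable.of_finite (f := fun x : (∀ t, (Fin (X.size r t) → Fin K) ×
      SimpleGraph (Fin (X.size r t))) => ∏ t, F t (x t)) (μ := X.μ.map _)).comp_measurable hmeas
  have h4 := mul_meas_ge_le_integral_of_nonneg (μ := X.μ)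
    (f := fun ω => ∏ t, F t (X.datum r t ω))
    (ae_of_all _ fun ω => Finset.prod_nonneg fun t _ => by
      simp only [hF]; split_ifs
      · exact hf _ _
      · exact zero_le_one) hint 1
  rw [one_mul, h2, h3] at h4
  simpa only [h1] using h4

/-- A conditional bound that is uniform in the labels survives averaging over them. -/
theorem sum_sbmWeight_mul_le (r : Fin 2) {m : ℕ} (f : (Fin m → Fin K) × SimpleGraph (Fin m) → ℝ)
    (R : ℝ) (h : ∀ z, ∑ G, edgeWeight (X.B r) z G * f (z, G) ≤ R) :
    ∑ z, ∑ G, sbmWeight (X.B r) (X.prior r) z G * f (z, G) ≤ R := by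
  calc ∑ z, ∑ G, sbmWeight (X.B r) (X.prior r) z G * f (z, G)
      = ∑ z : Fin m → Fin K, (∏ i, X.prior r (z i)) * ∑ G, edgeWeight (X.B r) z G * f (z, G) := by
        refine Finset.sum_congr rfl fun z _ => ?_
        rw [Finset.mul_sum]
        exact Finset.sum_congr rfl fun G _ => by rw [sbmWeight_eq, mul_assoc]
    _ ≤ ∑ z : Fin m → Fin K, (∏ i, X.prior r (z i)) * R :=
        Finset.sum_le_sum fun z _ => mul_le_mul_of_nonneg_left (h z)
          (Finset.prod_nonneg fun i _ => (X.prior_pos r _).le)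
    _ = R := by rw [← Finset.sum_mul, sum_labels _ (X.prior_sum r), one_mul]

/-- Exponential Markov inequality, conditionally on labels with a given property. -/
theorem prob_nonneg_sum_le (r : Fin 2) (T : Finset (Fin (X.N r)))
    (good : ∀ t, (Fin (X.size r t) → Fin K) → Prop)
    (φ : ∀ t, (Fin (X.size r t) → Fin K) → SimpleGraph (Fin (X.size r t)) → ℝ)
    (R : ℝ)
    (h : ∀ t ∈ T, ∀ z, good t z →
      ∑ G, edgeWeight (X.B r) z G * Real.exp (φ t z G) ≤ Real.exp (-R)) :
    X.μ.real {ω | (∀ t ∈ T, good t (X.label r t ω)) ∧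
      0 ≤ ∑ t ∈ T, φ t (X.label r t ω) (X.graph r t ω)} ≤ Real.exp (-(T.card * R)) := by
  classical
  have := X.isProb
  -- The indicator of good labels multiplies the exponential: on the event nothing changes, and bad
  -- labels contribute 0, so no conditional bound is needed for them.
  set f : ∀ t, (Fin (X.size r t) → Fin K) × SimpleGraph (Fin (X.size r t)) → ℝ :=
    fun t x => if good t x.1 then Real.exp (φ t x.1 x.2) else 0 with hf
  have h1 := X.prob_one_le_prod_le r T f (fun t x => by
    simp only [hf]; split_ifs
    · exact (Real.exp_pos _).le
    · exact le_rfl)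
  have hsub : {ω | (∀ t ∈ T, good t (X.label r t ω)) ∧
      0 ≤ ∑ t ∈ T, φ t (X.label r t ω) (X.graph r t ω)} ⊆
      {ω | 1 ≤ ∏ t ∈ T, f t (X.datum r t ω)} := by
    rintro ω ⟨hg, h0⟩
    have : ∏ t ∈ T, f t (X.datum r t ω) =
        ∏ t ∈ T, Real.exp (φ t (X.label r t ω) (X.graph r t ω)) :=
      Finset.prod_congr rfl fun t ht => by simp [hf, datum, hg t ht]
    rw [Set.mem_ofPred_eq, this, ← Real.exp_sum]
    exact Real.one_le_exp h0
  refine (measureReal_mono hsub).trans (h1.trans ?_)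
  have h2 : Real.exp (-(T.card * R)) = ∏ _t ∈ T, Real.exp (-R) := by
    rw [Finset.prod_const, ← Real.exp_nat_mul]; congr 1; ring
  rw [h2]
  refine Finset.prod_le_prod (fun t _ => ?_) fun t ht => X.sum_sbmWeight_mul_le r (f t) _ fun z => ?_
  · refine Finset.sum_nonneg fun z _ => Finset.sum_nonneg fun G _ => mul_nonneg ?_ ?_
    · rw [sbmWeight_eq]
      exact mul_nonneg (Finset.prod_nonneg fun i _ => (X.prior_pos r _).le)
        (edgeWeight_nonneg (X.B_mem r) z G)
    · simp only [hf]; split_ifs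
      · exact (Real.exp_pos _).le
      · exact le_rfl
  · by_cases hz : good t z
    · simpa [hf, hz] using h t ht z hz
    · simp [hf, hz, (Real.exp_pos (-R)).le]

/-- Small communities are unlikely. -/
theorem prob_commSize_le (r : Fin 2) (t : Fin (X.N r)) (k : Fin K) {x s R : ℝ} (hs : 0 ≤ s)
    (hR : s * x - X.size r t * X.prior r k * (s - s ^ 2 / 2) ≤ -R) :
    X.μ.real {ω | (commSize (X.label r t ω) k : ℝ) ≤ x} ≤ Real.exp (-R) := by
  have := X.isProb
  set f : ∀ t, (Fin (X.size r t) → Fin K) × SimpleGraph (Fin (X.size r t)) → ℝ :=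
    fun t y => Real.exp (s * (x - commSize y.1 k)) with hf
  have h1 := X.prob_one_le_prod_le r {t} f (fun t x => (Real.exp_pos _).le)
  rw [Finset.prod_singleton] at h1
  simp only [Finset.prod_singleton] at h1
  have hsub : {ω | (commSize (X.label r t ω) k : ℝ) ≤ x} ⊆ {ω | 1 ≤ f t (X.datum r t ω)} := by
    intro ω hω
    exact Real.one_le_exp (mul_nonneg hs (sub_nonneg.2 hω))
  refine (measureReal_mono hsub).trans (h1.trans ?_)
  have h2 : ∑ z, ∑ G, sbmWeight (X.B r) (X.prior r) z G * f t (z, G) =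
      Real.exp (s * x) * ∑ z : Fin (X.size r t) → Fin K,
        (∏ i, X.prior r (z i)) * Real.exp (-(s * commSize z k)) := by
    rw [Finset.mul_sum]
    refine Finset.sum_congr rfl fun z _ => ?_
    simp only [sbmWeight_eq, hf]
    rw [← Finset.sum_mul, ← Finset.mul_sum, sum_edgeWeight, mul_sub, sub_eq_add_neg, Real.exp_add]
    ring
  rw [h2]
  refine (mul_le_mul_of_nonneg_left (sum_labels_exp_le _ (X.prior_sum r)
    (fun k => (X.prior_pos r k).le) k s) (Real.exp_pos _).le).trans ?_
  rw [← Real.exp_add]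
  refine Real.exp_le_exp.2 (le_trans ?_ hR)
  have h3 := exp_neg_le hs
  have h4 : 0 ≤ (X.size r t : ℝ) * X.prior r k := mul_nonneg (by positivity) (X.prior_pos r k).le
  nlinarith

/-- Large degrees are unlikely. -/
theorem prob_degree_le (r : Fin 2) (t : Fin (X.N r)) {b : ℝ} (hb : ∀ k l, X.B r k l ≤ b)
    (v : Fin (X.size r t)) :
    X.μ.real {ω | 3 * (X.size r t * b) ≤ ∑ j, adjacency (X.graph r t ω) v j} ≤
      Real.exp (-(X.size r t * b)) := by
  have := X.isProb
  classical
  -- The family must be defined for all networks, but `v` is a node of network `t` only; hence the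
  -- transport along t' = t. The default 0 never occurs since T = {t}.
  set φ : ∀ t', (Fin (X.size r t') → Fin K) → SimpleGraph (Fin (X.size r t')) → ℝ :=
    fun t' _ G => if h : t' = t then
      (∑ j, adjacency (h ▸ G : SimpleGraph (Fin (X.size r t))) v j) - 3 * (X.size r t * b) else 0
    with hφ
  have h := X.prob_nonneg_sum_le r {t} (fun _ _ => True) φ (X.size r t * b) (by
    intro t' ht' z _
    rw [Finset.mem_singleton] at ht'
    subst ht'
    have h1 := sum_edgeWeight_mul_exp_degree_le (X.B_symm r) (X.B_mem r) hb z v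
    simp only [hφ, dite_true, sub_eq_add_neg, Real.exp_add, ← mul_assoc, ← Finset.sum_mul]
    refine (mul_le_mul_of_nonneg_right h1 (Real.exp_pos _).le).trans ?_
    rw [← Real.exp_add]
    exact Real.exp_le_exp.2 (by linarith))
  rw [Finset.card_singleton, Nat.cast_one, one_mul] at h
  refine (measureReal_mono ?_).trans h
  intro ω hω
  refine ⟨fun _ _ => trivial, ?_⟩
  simp only [Finset.sum_singleton, hφ, dite_true]
  exact sub_nonneg.2 hω

/-- Deviations of the pooled block sums of a set of networks with well-sized communities. -/
theorem prob_blockSum_dev_le (r : Fin 2) (T : Finset (Fin (X.N r)))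
    (good : ∀ t, (Fin (X.size r t) → Fin K) → Prop) (k l : Fin K) {e d R : ℝ}
    (he : e ^ 2 = 1) (hd0 : 0 ≤ d) (hd : d ≤ 3 / 8)
    (hm : ∀ t z, good t z → R ≤ 2 / 9 * d ^ 2 * (blockCount z k l * X.B r k l)) :
    X.μ.real {ω | (∀ t ∈ T, good t (X.label r t ω)) ∧
      d * ∑ t ∈ T, blockCount (X.label r t ω) k l * X.B r k l ≤
        e * ∑ t ∈ T, (blockSum (adjacency (X.graph r t ω)) (X.label r t ω) k l -
          blockCount (X.label r t ω) k l * X.B r k l)} ≤ Real.exp (-(T.card * R)) := by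
  have := X.isProb
  -- Minimizer of 9/8·s²/4 − sd/2, with minimum −2d²/9; d ≤ 3/8 gives s ≤ 1/3, so the weights below
  -- stay within 1/6.
  set s : ℝ := 8 / 9 * d with hs
  set I : Fin K → Fin K → ℝ := fun a b => if a = k ∧ b = l then 1 else 0 with hI
  -- The weight is divided between (k, l) and (l, k) to be symmetric. As these blocks have equal
  -- sums, the linear form is s/2 times the signed deviation, whether k = l or not.
  set g : Fin K → Fin K → ℝ := fun a b => e * (s / 4) * (I a b + I b a) with hg
  set φ : ∀ t, (Fin (X.size r t) → Fin K) → SimpleGraph (Fin (X.size r t)) → ℝ :=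
    fun t z G => s / 2 * (e * (blockSum (adjacency G) z k l - blockCount z k l * X.B r k l) -
      d * (blockCount z k l * X.B r k l)) with hφ
  have heabs : |e| = 1 := by
    rcases sq_eq_one_iff.1 he with h | h <;> simp [h]
  have hI0 : ∀ a b, 0 ≤ I a b := fun a b => by simp only [hI]; split_ifs <;> norm_num
  have hI1 : ∀ a b, I a b ≤ 1 := fun a b => by simp only [hI]; split_ifs <;> norm_num
  have hIsum : ∀ f : Fin K → Fin K → ℝ, ∑ a, ∑ b, I a b * f a b = f k l := by
    intro f
    simp only [hI, ite_and, ite_mul, one_mul, zero_mul]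
    simp
  have hIsum' : ∀ f : Fin K → Fin K → ℝ, ∑ a, ∑ b, I b a * f a b = f l k := by
    intro f
    rw [Finset.sum_comm]
    exact hIsum fun a b => f b a
  have h := X.prob_nonneg_sum_le r T good φ R (by
    intro t _ z hz
    have hsymm : ∀ a b, blockCount z a b = blockCount z b a := fun a b => by
      rw [blockCount_eq_blockSum, blockSum_symm offDiagOnes_symm]
    have hBs : ∀ a b, X.B r a b = X.B r b a := fun a b => ((X.B_symm r).apply a b).symm
    have hgs : ∀ a b, g a b = g b a := fun a b => by simp only [hg]; ring
    have hg6 : ∀ a b, |g a b| ≤ 1 / 6 := by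
      intro a b
      simp only [hg]
      rw [abs_mul, abs_mul, heabs, abs_of_nonneg (by positivity : 0 ≤ s / 4),
        abs_of_nonneg (add_nonneg (hI0 a b) (hI0 b a))]
      nlinarith [hI1 a b, hI1 b a, hI0 a b, hI0 b a]
    have h1 := sum_edgeWeight_mul_exp_block_le (X.B_symm r) (X.B_mem r) z hgs hg6
    set c := blockCount z k l * X.B r k l with hc
    have hc0 : 0 ≤ c := mul_nonneg (by
      rw [blockCount_eq_blockSum]; exact blockSum_nonneg offDiagOnes_nonneg _ _ _) (X.B_mem r k l).1
    have h2 : ∀ G, ∑ a, ∑ b, g a b * (blockSum (adjacency G) z a b - blockCount z a b * X.B r a b) =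
        s / 2 * (e * (blockSum (adjacency G) z k l - c)) := by
      intro G
      have h3 : ∀ a b, g a b * (blockSum (adjacency G) z a b - blockCount z a b * X.B r a b) =
          I a b * (e * (s / 4) * (blockSum (adjacency G) z a b - blockCount z a b * X.B r a b)) +
          I b a * (e * (s / 4) * (blockSum (adjacency G) z a b - blockCount z a b * X.B r a b)) := by
        intro a b; simp only [hg]; ring
      simp only [h3, Finset.sum_add_distrib]
      rw [hIsum fun a b => e * (s / 4) * (blockSum (adjacency G) z a b -
        blockCount z a b * X.B r a b), hIsum' fun a b => e * (s / 4) *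
        (blockSum (adjacency G) z a b - blockCount z a b * X.B r a b),
        blockSum_symm (adjacency_symm G) z l k, hsymm l k, hBs l k]
      ring
    have h4 : ∑ a, ∑ b, g a b ^ 2 * (blockCount z a b * X.B r a b) ≤ s ^ 2 / 4 * c := by
      have h5 : ∀ a b, g a b ^ 2 * (blockCount z a b * X.B r a b) ≤
          I a b * (s ^ 2 / 8 * (blockCount z a b * X.B r a b)) +
          I b a * (s ^ 2 / 8 * (blockCount z a b * X.B r a b)) := by
        intro a b
        have h6 : 0 ≤ blockCount z a b * X.B r a b := mul_nonneg (by
          rw [blockCount_eq_blockSum]; exact blockSum_nonneg offDiagOnes_nonneg _ _ _)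
          (X.B_mem r a b).1
        have h7 : g a b ^ 2 ≤ s ^ 2 / 8 * (I a b + I b a) := by
          simp only [hg]
          rw [mul_pow, mul_pow, he]
          have h8 : (I a b + I b a) ^ 2 ≤ 2 * (I a b + I b a) := by
            nlinarith [hI1 a b, hI1 b a, hI0 a b, hI0 b a]
          nlinarith [mul_le_mul_of_nonneg_left h8 (sq_nonneg s)]
        calc _ ≤ s ^ 2 / 8 * (I a b + I b a) * (blockCount z a b * X.B r a b) :=
              mul_le_mul_of_nonneg_right h7 h6
          _ = _ := by ring
      refine (Finset.sum_le_sum fun a _ => Finset.sum_le_sum fun b _ => h5 a b).trans ?_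
      simp only [Finset.sum_add_distrib]
      rw [hIsum fun a b => s ^ 2 / 8 * (blockCount z a b * X.B r a b),
        hIsum' fun a b => s ^ 2 / 8 * (blockCount z a b * X.B r a b), hsymm l k, hBs l k]
      exact le_of_eq (by ring)
    simp only [h2] at h1
    have h9 : ∀ G, edgeWeight (X.B r) z G * Real.exp (φ t z G) =
        edgeWeight (X.B r) z G * Real.exp (s / 2 * (e * (blockSum (adjacency G) z k l - c))) *
          Real.exp (-(s / 2 * (d * c))) := by
      intro G
      rw [mul_assoc, ← Real.exp_add]
      congr 2
      simp only [hφ]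
      ring
    simp only [h9]
    rw [← Finset.sum_mul]
    refine (mul_le_mul_of_nonneg_right h1 (Real.exp_pos _).le).trans ?_
    rw [← Real.exp_add]
    refine Real.exp_le_exp.2 ?_
    have := hm t z hz
    rw [← hc] at this
    have h10 : 9 / 8 * (s ^ 2 / 4 * c) - s / 2 * (d * c) = -(2 / 9 * d ^ 2 * c) := by
      rw [hs]; ring
    linarith)
  refine (measureReal_mono ?_).trans h
  rintro ω ⟨hgood, hω⟩
  refine ⟨hgood, ?_⟩
  simp only [hφ]
  rw [← Finset.mul_sum, Finset.sum_sub_distrib, ← Finset.mul_sum, ← Finset.mul_sum]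
  exact mul_nonneg (by positivity) (sub_nonneg.2 hω)

/-- Deviations of a bilinear form of the block averages of one network. -/
theorem prob_bilin_dev_le (r : Fin 2) (t : Fin (X.N r))
    (good : ∀ t, (Fin (X.size r t) → Fin K) → Prop) (a q : Fin K → ℝ) {b M A x s R : ℝ}
    (hb : ∀ k l, X.B r k l ≤ b) (hM : 0 < M)
    (hm : ∀ t z, good t z → ∀ k l, M ≤ blockCount z k l) (ha : vnorm a ≤ A) (hq : vnorm q = 1)
    (hs : 0 ≤ s) (hs' : s * A ≤ M / 6) (hR : 9 / 8 * (s ^ 2 * A ^ 2 * b / M) - s * x ≤ -R) :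
    X.μ.real {ω | good t (X.label r t ω) ∧
      x ≤ a ⬝ᵥ (hdiv (blockSum (adjacency (X.graph r t ω)) (X.label r t ω))
        (blockCount (X.label r t ω)) - X.B r) *ᵥ q} ≤ Real.exp (-R) := by
  have := X.isProb
  set φ : ∀ t, (Fin (X.size r t) → Fin K) → SimpleGraph (Fin (X.size r t)) → ℝ :=
    fun t z G => s * (a ⬝ᵥ (hdiv (blockSum (adjacency G) z) (blockCount z) - X.B r) *ᵥ q) - s * x
    with hφ
  have hA : 0 ≤ A := (vnorm_nonneg a).trans ha
  have h := X.prob_nonneg_sum_le r {t} good φ R (by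
    intro t _ z hz
    have hm := hm t z hz
    have hmp : ∀ k l, 0 < blockCount z k l := fun k l => hM.trans_le (hm k l)
    have hsymm : ∀ a b, blockCount z a b = blockCount z b a := fun a b => by
      rw [blockCount_eq_blockSum, blockSum_symm offDiagOnes_symm]
    have hBs : ∀ a b, X.B r a b = X.B r b a := fun a b => ((X.B_symm r).apply a b).symm
    -- Symmetrization of s a_k q_l / m_kl: the deviations are m_kl E_kl with E symmetric, so the
    -- linear form is exactly s aᵀEq.
    set g : Fin K → Fin K → ℝ := fun k l => s * (a k * q l + a l * q k) / (2 * blockCount z k l)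
      with hg
    have hgs : ∀ k l, g k l = g l k := fun k l => by simp only [hg]; rw [hsymm k l]; ring
    have hak : ∀ k, |a k| ≤ A := fun k => (abs_le_vnorm a k).trans ha
    have hqk : ∀ k, |q k| ≤ 1 := fun k => (abs_le_vnorm q k).trans hq.le
    have hg6 : ∀ k l, |g k l| ≤ 1 / 6 := by
      intro k l
      simp only [hg]
      rw [abs_div, abs_mul, abs_of_nonneg hs, abs_of_pos (mul_pos two_pos (hmp k l)),
        div_le_iff₀ (mul_pos two_pos (hmp k l))]
      have h1 : |a k * q l + a l * q k| ≤ 2 * A := by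
        refine (abs_add_le _ _).trans ?_
        rw [abs_mul, abs_mul]
        have := mul_le_mul (hak k) (hqk l) (abs_nonneg _) hA
        have := mul_le_mul (hak l) (hqk k) (abs_nonneg _) hA
        linarith
      have := mul_le_mul_of_nonneg_left h1 hs
      have := hm k l
      linarith
    have h1 := sum_edgeWeight_mul_exp_block_le (X.B_symm r) (X.B_mem r) z hgs hg6
    have h2 : ∀ G, ∑ k, ∑ l, g k l * (blockSum (adjacency G) z k l - blockCount z k l * X.B r k l) =
        s * (a ⬝ᵥ (hdiv (blockSum (adjacency G) z) (blockCount z) - X.B r) *ᵥ q) := by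
      intro G
      set E := hdiv (blockSum (adjacency G) z) (blockCount z) - X.B r with hE
      have hEs : ∀ k l, E k l = E l k := by
        intro k l
        simp only [hE, hdiv, Matrix.sub_apply, Matrix.of_apply]
        rw [blockSum_symm (adjacency_symm G) z k l, hsymm k l, hBs k l]
      have h3 : ∀ k l, g k l * (blockSum (adjacency G) z k l - blockCount z k l * X.B r k l) =
          s / 2 * (a k * (E k l * q l)) + s / 2 * (a l * (E l k * q k)) := by
        intro k l
        have e1 : blockSum (adjacency G) z k l - blockCount z k l * X.B r k l =
            blockCount z k l * E k l := by
          simp only [hE, hdiv, Matrix.sub_apply, Matrix.of_apply]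
          rw [mul_sub, mul_div_cancel₀ _ (hmp k l).ne']
        rw [e1, ← hEs k l]
        simp only [hg]
        have := (hmp k l).ne'
        field_simp
      simp only [h3, Finset.sum_add_distrib]
      rw [Finset.sum_comm (f := fun k l => s / 2 * (a l * (E l k * q k)))]
      simp only [dotProduct, Matrix.mulVec, ← Finset.mul_sum]
      ring
    have h4 : ∑ k, ∑ l, g k l ^ 2 * (blockCount z k l * X.B r k l) ≤ s ^ 2 * A ^ 2 * b / M := by
      have h5 : ∀ k l, g k l ^ 2 * (blockCount z k l * X.B r k l) ≤
          s ^ 2 * b / (2 * M) * (a k ^ 2 * q l ^ 2 + a l ^ 2 * q k ^ 2) := by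
        intro k l
        have e1 : g k l ^ 2 * (blockCount z k l * X.B r k l) =
            s ^ 2 / 4 * (a k * q l + a l * q k) ^ 2 * (X.B r k l / blockCount z k l) := by
          simp only [hg]
          have := (hmp k l).ne'
          field_simp
          ring
        have e2 : X.B r k l / blockCount z k l ≤ b / M :=
          div_le_div₀ ((X.B_mem r k l).1.trans (hb k l)) (hb k l) hM (hm k l)
        have e3 : (a k * q l + a l * q k) ^ 2 ≤ 2 * (a k ^ 2 * q l ^ 2 + a l ^ 2 * q k ^ 2) := by
          nlinarith [sq_nonneg (a k * q l - a l * q k)]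
        have e4 : 0 ≤ b / M := div_nonneg ((X.B_mem r k l).1.trans (hb k l)) hM.le
        calc _ = s ^ 2 / 4 * (a k * q l + a l * q k) ^ 2 * (X.B r k l / blockCount z k l) := e1
          _ ≤ s ^ 2 / 4 * (a k * q l + a l * q k) ^ 2 * (b / M) :=
              mul_le_mul_of_nonneg_left e2 (by positivity)
          _ ≤ s ^ 2 / 4 * (2 * (a k ^ 2 * q l ^ 2 + a l ^ 2 * q k ^ 2)) * (b / M) := by gcongr
          _ = _ := by field_simp; ring
      refine (Finset.sum_le_sum fun a _ => Finset.sum_le_sum fun b _ => h5 a b).trans ?_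
      simp only [← Finset.mul_sum, Finset.sum_add_distrib, ← Finset.sum_mul]
      have e5 : ∑ k, q k ^ 2 = 1 := by rw [← vnorm_sq, hq, one_pow]
      have e6 : ∑ k, a k ^ 2 ≤ A ^ 2 := by
        rw [← vnorm_sq]; exact pow_le_pow_left₀ (vnorm_nonneg a) ha 2
      rw [e5]
      rcases Nat.eq_zero_or_pos K with hK | hK
      · subst hK
        simp at e5
      · have hb0 : 0 ≤ b := (X.B_mem r ⟨0, hK⟩ ⟨0, hK⟩).1.trans (hb _ _)
        have : 0 ≤ s ^ 2 * b / (2 * M) := by positivity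
        calc s ^ 2 * b / (2 * M) * ((∑ k, a k ^ 2) * 1 + (∑ k, a k ^ 2) * 1)
            ≤ s ^ 2 * b / (2 * M) * (A ^ 2 * 1 + A ^ 2 * 1) := by gcongr
          _ = _ := by field_simp; ring
    simp only [h2] at h1
    simp only [hφ, sub_eq_add_neg, Real.exp_add, ← mul_assoc, ← Finset.sum_mul]
    simp only [sub_eq_add_neg] at h1
    refine (mul_le_mul_of_nonneg_right h1 (Real.exp_pos _).le).trans ?_
    rw [← Real.exp_add]
    exact Real.exp_le_exp.2 (by linarith))
  rw [Finset.card_singleton, Nat.cast_one, one_mul] at h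
  refine (measureReal_mono ?_).trans h
  rintro ω ⟨hgood, hω⟩
  refine ⟨fun t' ht' => by rw [Finset.mem_singleton] at ht'; subst ht'; exact hgood, ?_⟩
  simp only [Finset.sum_singleton, hφ]
  rw [← mul_sub]
  exact mul_nonneg hs (sub_nonneg.2 hω)

end TwoSampleSBM

end Probability

end SBMTest

namespace SBMTest

theorem measureReal_iUnion_le_card {Ω ι : Type*} [MeasurableSpace Ω] [Fintype ι] (μ : Measure Ω)
    [IsFiniteMeasure μ] {s : ι → Set Ω} {c : ℝ} (h : ∀ i, μ.real (s i) ≤ c) :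
    μ.real (⋃ i, s i) ≤ Fintype.card ι * c := by
  refine (measureReal_iUnion_fintype_le s).trans ((Finset.sum_le_sum fun i _ => h i).trans ?_)
  simp

namespace TwoSampleSBM

variable {K : ℕ} {Ω : Type*} [MeasurableSpace Ω] (X : TwoSampleSBM K Ω) (q : Params)

/-! ### Elementary facts about the parameters -/

theorem K_pos (X : TwoSampleSBM K Ω) : 0 < K := by
  rcases Nat.eq_zero_or_pos K with h | h
  · subst h
    have := X.prior_sum 0
    simp at this
  · exact h

theorem priorMin_le (r : Fin 2) (k : Fin K) : X.priorMin ≤ X.prior r k :=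
  ciInf_le (Set.finite_range _).bddBelow ((r, k) : Fin 2 × Fin K)

theorem priorMin_pos : 0 < X.priorMin := by
  have : Nonempty (Fin K) := ⟨⟨0, X.K_pos⟩⟩
  obtain ⟨p, hp⟩ := exists_eq_ciInf_of_finite (f := fun p : Fin 2 × Fin K => X.prior p.1 p.2)
  rw [priorMin, ← hp]
  exact X.prior_pos _ _

theorem mul_priorMin_le : K * X.priorMin ≤ 1 := by
  rw [← X.prior_sum 0]
  calc (K : ℝ) * X.priorMin = ∑ _k : Fin K, X.priorMin := by simp
    _ ≤ _ := Finset.sum_le_sum fun k _ => X.priorMin_le 0 k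

variable {X q}

namespace Assumptions

theorem beta_pos (h : X.Assumptions q) : 0 < X.beta q :=
  one_div_pos.2 (mul_pos (by linarith [h.κ_mem.2]) X.priorMin_pos)

theorem inv_beta (_h : X.Assumptions q) (x : ℝ) :
    x / X.beta q = x * ((1 - q.κ) * X.priorMin) := by
  rw [beta, div_div_eq_mul_div, div_one]

theorem K_le_beta (h : X.Assumptions q) : (K : ℝ) ≤ X.beta q := by
  have h1 : 0 < (1 - q.κ) * X.priorMin := mul_pos (by linarith [h.κ_mem.2]) X.priorMin_pos
  rw [beta, le_div_iff₀ h1]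
  have h2 := X.mul_priorMin_le
  have h3 : 0 ≤ K * X.priorMin := mul_nonneg (by positivity) X.priorMin_pos.le
  nlinarith [h.κ_mem.1]

theorem one_le_beta (h : X.Assumptions q) : 1 ≤ X.beta q :=
  le_trans (by exact_mod_cast X.K_pos) h.K_le_beta

theorem n_pos' (h : X.Assumptions q) : (0 : ℝ) < q.n := by exact_mod_cast h.n_pos

theorem log_nonneg (h : X.Assumptions q) : 0 ≤ Real.log q.n :=
  Real.log_nonneg (by exact_mod_cast h.n_pos)

theorem one_le_C₁ (h : X.Assumptions q) : 1 ≤ q.C₁ := by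
  have h1 := h.sparsity 0 ⟨0, X.K_pos⟩ ⟨0, X.K_pos⟩
  have h2 := h1.1.trans h1.2
  rw [mul_div_assoc] at h2
  have h3 : 0 < q.ν / q.n := div_pos h.ν_pos h.n_pos'
  by_contra hlt
  nlinarith

theorem one_le_C₂ (h : X.Assumptions q) : 1 ≤ q.C₂ := by
  have h1 := h.sizes 0 (X.first 0)
  have h2 := h1.1.trans h1.2
  by_contra hlt
  nlinarith [h.n_pos']

theorem scale_pos (h : X.Assumptions q) : 0 < q.ν / q.n := div_pos h.ν_pos h.n_pos'

theorem size_pos (h : X.Assumptions q) (r : Fin 2) (t : Fin (X.N r)) : (0 : ℝ) < X.size r t :=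
  h.n_pos'.trans_le (h.sizes r t).1

theorem delta_sq (h : X.Assumptions q) (M : ℕ) :
    X.delta q M ^ 2 = 3 * X.beta q ^ 2 * q.α * Real.log q.n / (M * q.n * q.ν) := by
  rw [delta, Real.sq_sqrt]
  have := h.log_nonneg
  have := h.α_pos
  have := h.ν_pos
  positivity

theorem delta_nonneg (_h : X.Assumptions q) (M : ℕ) : 0 ≤ X.delta q M := Real.sqrt_nonneg _

theorem exp_neg_mul_log (h : X.Assumptions q) :
    Real.exp (-(q.α * Real.log q.n)) = (q.n : ℝ) ^ (-q.α) := by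
  rw [Real.rpow_def_of_pos h.n_pos']
  congr 1; ring

/-- Otherwise n^{-α} ≥ e^{-2} ≥ 1/9 and the error bound is at least 19/9. So α log n ≥ 2 whenever
the claim is not trivial, which absorbs lower-order terms in the tail bounds. -/
theorem two_le_mul_log (h : X.Assumptions q) (he : X.errorBound q < 1) :
    2 ≤ q.α * Real.log q.n := by
  by_contra hlt
  push Not at hlt
  have h1 : Real.exp (-2) ≤ (q.n : ℝ) ^ (-q.α) := by
    rw [← h.exp_neg_mul_log]
    exact Real.exp_le_exp.2 (by linarith)
  have h2 : 1 / 9 ≤ Real.exp (-2) := by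
    rw [Real.exp_neg, ← one_div]
    refine one_div_le_one_div_of_le (Real.exp_pos _) ?_
    have : Real.exp 2 = Real.exp 1 * Real.exp 1 := by rw [← Real.exp_add]; norm_num
    rw [this]
    nlinarith [Real.exp_one_lt_three, Real.exp_pos 1]
  have h3 : (1 : ℝ) ≤ X.N 0 := by exact_mod_cast X.N_pos 0
  have h4 : (1 : ℝ) ≤ (K : ℝ) ^ 2 := by
    have : (1 : ℝ) ≤ K := by exact_mod_cast X.K_pos
    nlinarith
  have h5 : 19 ≤ 19 * ((X.N 0 : ℝ) + X.N 1) := by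
    have : (0 : ℝ) ≤ X.N 1 := by positivity
    linarith
  have h6 : 19 ≤ 19 * ((X.N 0 : ℝ) + X.N 1) * (K : ℝ) ^ 2 := by nlinarith
  rw [errorBound] at he
  nlinarith [h1.trans' h2]

end Assumptions

/-! ### Good labels -/

variable (X q)

/-- All communities have nearly the expected size. -/
def GoodLabels {m : ℕ} (z : Fin m → Fin K) : Prop :=
  ∀ k, 1 + (m : ℝ) / X.beta q ≤ commSize z k

variable {X q}

/-- The summand 1 in the size condition pays for the −1 in the diagonal counts. -/
theorem GoodLabels.le_blockCount (h : X.Assumptions q) {m : ℕ} {z : Fin m → Fin K}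
    (hz : X.GoodLabels q z) (k l : Fin K) : ((m : ℝ) / X.beta q) ^ 2 ≤ blockCount z k l := by
  have h0 : 0 ≤ (m : ℝ) / X.beta q := div_nonneg (by positivity) h.beta_pos.le
  have h1 := hz k
  have h2 := hz l
  simp only [blockCount, Matrix.of_apply]
  rw [sq]
  refine mul_le_mul (by linarith) ?_ h0 (by linarith)
  split_ifs <;> linarith

/-! ### Tail bounds of size n^{-α} -/

namespace Assumptions

theorem le_blockCount (h : X.Assumptions q) (r : Fin 2) (t : Fin (X.N r))
    {z : Fin (X.size r t) → Fin K} (hz : X.GoodLabels q z) (k l : Fin K) :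
    ((q.n : ℝ) / X.beta q) ^ 2 ≤ blockCount z k l := by
  refine le_trans ?_ (hz.le_blockCount h k l)
  have := h.beta_pos
  have := (h.sizes r t).1
  have := h.n_pos'
  gcongr

/-- With s = κ the exponent is at most κ − κ²mπ_k/2, and κ²mπ_k ≥ 3α log n. The surplus α log n / 2
≥ 1 covers the first κ. -/
theorem prob_not_goodLabels (h : X.Assumptions q) (he : X.errorBound q < 1) (r : Fin 2)
    (t : Fin (X.N r)) (k : Fin K) :
    X.μ.real {ω | ¬ 1 + (X.size r t : ℝ) / X.beta q ≤ commSize (X.label r t ω) k} ≤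
      (q.n : ℝ) ^ (-q.α) := by
  have := X.isProb
  rw [← h.exp_neg_mul_log]
  refine (measureReal_mono (fun ω hω => (not_le.1 hω).le)).trans
    (X.prob_commSize_le r t k (s := q.κ) h.κ_mem.1.le ?_)
  rw [h.inv_beta]
  have h1 := h.two_le_mul_log he
  have h2 := h.log_le
  rw [div_le_div_iff₀ h.n_pos' (mul_pos three_pos h.α_pos)] at h2
  have h3 := (h.sizes r t).1
  have h4 := X.priorMin_le r k
  have h5 := X.priorMin_pos
  have h6 := h.κ_mem
  have h7 : (q.n : ℝ) * X.priorMin ≤ X.size r t * X.prior r k :=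
    mul_le_mul h3 h4 h5.le (by positivity)
  have h8 : (X.size r t : ℝ) * X.priorMin ≤ X.size r t * X.prior r k :=
    mul_le_mul_of_nonneg_left h4 (by positivity)
  have h9 : q.κ ^ 2 * (q.n * X.priorMin) ≤ q.κ ^ 2 * (X.size r t * X.prior r k) :=
    mul_le_mul_of_nonneg_left h7 (sq_nonneg _)
  have h10 : q.κ * (1 - q.κ) * (X.size r t * X.priorMin) ≤
      q.κ * (1 - q.κ) * (X.size r t * X.prior r k) :=
    mul_le_mul_of_nonneg_left h8 (mul_nonneg h6.1.le (by linarith [h6.2]))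
  nlinarith [h6.1, h6.2]

/-- The union over nodes costs m = exp(log x + log n) with x = m/n ≥ 1, against a decay of at least
3(1 + α)x log n; log x ≤ x ≤ xα log n uses α log n ≥ 2. -/
theorem prob_degree (h : X.Assumptions q) (he : X.errorBound q < 1) (r : Fin 2)
    (t : Fin (X.N r)) :
    X.μ.real (⋃ v, {ω | 3 * (X.size r t * (q.C₁ * q.ν / q.n)) ≤
      ∑ j, adjacency (X.graph r t ω) v j}) ≤ (q.n : ℝ) ^ (-q.α) := by
  have := X.isProb
  refine (measureReal_iUnion_le_card X.μ
    (X.prob_degree_le r t fun k l => (h.sparsity r k l).2)).trans ?_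
  rw [← h.exp_neg_mul_log, Fintype.card_fin]
  have hn := h.n_pos'
  have hm := h.size_pos r t
  set x : ℝ := X.size r t / q.n with hx
  have hx1 : 1 ≤ x := by rw [hx, le_div_iff₀ hn]; linarith [(h.sizes r t).1]
  have hmx : (X.size r t : ℝ) = x * q.n := by rw [hx, div_mul_cancel₀ _ hn.ne']
  have hL := h.log_nonneg
  have h2 := h.two_le_mul_log he
  have h3 : (X.size r t : ℝ) = Real.exp (Real.log x + Real.log q.n) := by
    rw [Real.exp_add, Real.exp_log (by linarith), Real.exp_log hn, hmx]
  have h4 : x * (3 * (1 + q.α) * Real.log q.n) ≤ X.size r t * (q.C₁ * q.ν / q.n) := by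
    have h5 : (X.size r t : ℝ) * (q.C₁ * q.ν / q.n) = x * (q.C₁ * q.ν) := by rw [hx]; ring
    rw [h5]
    have := h.degree
    have := h.one_le_C₁
    have := h.ν_pos
    exact mul_le_mul_of_nonneg_left (by nlinarith) (by linarith)
  have h11 : (X.size r t : ℝ) * Real.exp (-(X.size r t * (q.C₁ * q.ν / q.n))) =
      Real.exp (Real.log x + Real.log q.n + -(X.size r t * (q.C₁ * q.ν / q.n))) := by
    rw [Real.exp_add (Real.log x + Real.log q.n), ← h3]
  rw [h11]
  refine Real.exp_le_exp.2 ?_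
  have h6 : Real.log x ≤ x := by linarith [Real.log_le_sub_one_of_pos (show 0 < x by linarith)]
  have h7 : x ≤ x * (q.α * Real.log q.n) := by nlinarith
  have h8 : Real.log q.n ≤ x * Real.log q.n := by nlinarith
  have h9 : q.α * Real.log q.n ≤ x * (q.α * Real.log q.n) := by nlinarith
  have h10 : 0 ≤ x * Real.log q.n := by positivity
  nlinarith

/-- Deviations of pooled block sums over `M` networks. -/
theorem prob_dev (h : X.Assumptions q) (r : Fin 2) (T : Finset (Fin (X.N r))) (hT : T.Nonempty)
    (hδ : X.delta q T.card ≤ 3 / 10) (k l : Fin K) {e : ℝ} (he : e ^ 2 = 1) :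
    X.μ.real {ω | (∀ t ∈ T, X.GoodLabels q (X.label r t ω)) ∧
      Real.sqrt (3 / 2) * X.delta q T.card * ∑ t ∈ T, blockCount (X.label r t ω) k l * X.B r k l ≤
        e * ∑ t ∈ T, (blockSum (adjacency (X.graph r t ω)) (X.label r t ω) k l -
          blockCount (X.label r t ω) k l * X.B r k l)} ≤ (q.n : ℝ) ^ (-q.α) := by
  have hcard : (0 : ℝ) < T.card := by exact_mod_cast hT.card_pos
  have h32 : Real.sqrt (3 / 2) ≤ 5 / 4 := Real.sqrt_le_iff.2 (by norm_num)
  -- The factor √(3/2) makes 2/9·3/2·3 = 1: since the mean of a block sum is at least (n/β)²ν/n,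
  -- each network of `T` supplies α log n / |T| to the exponent. Also 5/4·3/10 = 3/8.
  refine (X.prob_blockSum_dev_le r T (fun _ z => X.GoodLabels q z) k l
    (d := Real.sqrt (3 / 2) * X.delta q T.card) (R := q.α * Real.log q.n / T.card) he
    (mul_nonneg (Real.sqrt_nonneg _) (h.delta_nonneg _)) ?_ ?_).trans (le_of_eq ?_)
  · nlinarith [h.delta_nonneg T.card, Real.sqrt_nonneg (3 / 2)]
  · intro t z hz
    rw [mul_pow, Real.sq_sqrt (by norm_num), h.delta_sq]
    have h1 := h.le_blockCount r t hz k l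
    have h2 := (h.sparsity r k l).1
    have h3 := mul_le_mul h1 h2 h.scale_pos.le ((sq_nonneg _).trans h1)
    have hn := h.n_pos'
    have hν := h.ν_pos
    have hβ := h.beta_pos
    have hα := h.α_pos
    have hL := h.log_nonneg
    calc q.α * Real.log q.n / T.card
        = 2 / 9 * (3 / 2 * (3 * X.beta q ^ 2 * q.α * Real.log q.n / (T.card * q.n * q.ν))) *
          ((q.n / X.beta q) ^ 2 * (q.ν / q.n)) := by field_simp; ring
      _ ≤ _ := mul_le_mul_of_nonneg_left h3 (by positivity)
  · rw [← h.exp_neg_mul_log, mul_div_cancel₀ _ hcard.ne']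

/-- Deviations of the first order perturbations of column sums of eigenvectors. -/
theorem prob_bilin (h : X.Assumptions q) (r : Fin 2) (t : Fin (X.N r)) {a v : Fin K → ℝ}
    (ha : vnorm a ≤ Real.sqrt K / q.η) (hv : vnorm v = 1)
    (hη : q.η ≤ 2 * K * (q.C₁ * q.ν / q.n))
    (hG : q.C₁ * q.ν / q.n * X.delta q 1 ≤ q.θ * q.η / (2 * Real.sqrt 2 * K)) :
    X.μ.real {ω | X.GoodLabels q (X.label r t ω) ∧
      q.θ / 2 ≤ a ⬝ᵥ (hdiv (blockSum (adjacency (X.graph r t ω)) (X.label r t ω))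
        (blockCount (X.label r t ω)) - X.B r) *ᵥ v} ≤ (q.n : ℝ) ^ (-q.α) := by
  rw [← h.exp_neg_mul_log]
  have hn := h.n_pos'
  have hν := h.ν_pos
  have hβ := h.beta_pos
  have hα := h.α_pos
  have hL := h.log_nonneg
  have hC := h.one_le_C₁
  have hη0 := h.η_pos
  have hθ0 := h.θ_pos
  have hK : (1 : ℝ) ≤ K := by exact_mod_cast X.K_pos
  have hK0 : (0 : ℝ) < K := by linarith
  obtain ⟨b, hb⟩ : ∃ b, q.C₁ * q.ν / q.n = b := ⟨_, rfl⟩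
  rw [hb] at hη hG
  have hb0 : 0 < b := by rw [← hb]; positivity
  set A := Real.sqrt K / q.η with hA
  have hA0 : 0 < A := by positivity
  set M := ((q.n : ℝ) / X.beta q) ^ 2 with hM
  have hM0 : 0 < M := by positivity
  set W := A ^ 2 * b / M with hW
  have hW0 : 0 < W := by positivity
  have hθK : q.θ * Real.sqrt K ≤ 1 / 4 := by
    have := h.θ_lt
    rw [lt_div_iff₀ (by positivity)] at this
    linarith
  -- This s minimizes 9/8·s²W − sθ/2, with minimum −θ²/(18W).
  refine X.prob_bilin_dev_le r t (fun _ z => X.GoodLabels q z) a v (b := b) (M := M) (A := A)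
    (s := 2 * q.θ / (9 * W)) (fun k l => (h.sparsity r k l).2.trans hb.le) hM0
    (fun t z hz => h.le_blockCount r t hz) ha hv (by positivity) ?_ ?_
  · have h1 : 2 * q.θ / (9 * W) * A = 2 * q.θ * M / (9 * A * b) := by
      rw [hW]; field_simp
    rw [h1, div_le_iff₀ (by positivity)]
    -- Equivalent form of the side condition sA ≤ M/6; it rests on η ≤ 2Kb and θ√K ≤ 1/4.
    have h2 : 4 * q.θ ≤ 3 * (A * b) := by
      have h3 : q.θ * q.η ≤ 3 / 4 * (Real.sqrt K * b) := by
        have h4 : q.θ * q.η ≤ q.θ * (2 * K * b) := mul_le_mul_of_nonneg_left hη hθ0.le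
        have h5 : q.θ * (2 * K * b) = 2 * (q.θ * Real.sqrt K) * (Real.sqrt K * b) := by
          have : Real.sqrt K * Real.sqrt K = K := Real.mul_self_sqrt hK0.le
          linear_combination (-2) * q.θ * b * this
        have h6 : 0 ≤ Real.sqrt K * b := by positivity
        nlinarith
      have h7 : A * b = Real.sqrt K * b / q.η := by rw [hA]; ring
      rw [h7, ← mul_div_assoc, le_div_iff₀ hη0]
      linarith
    nlinarith
  · have h1 : 9 / 8 * ((2 * q.θ / (9 * W)) ^ 2 * A ^ 2 * b / M) - 2 * q.θ / (9 * W) * (q.θ / 2) =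
        -(q.θ ^ 2 / (18 * W)) := by
      have : (2 * q.θ / (9 * W)) ^ 2 * A ^ 2 * b / M = (2 * q.θ / (9 * W)) ^ 2 * W := by
        rw [hW]; ring
      rw [this]
      field_simp
      ring
    rw [h1, neg_le_neg_iff, le_div_iff₀ (by positivity)]
    have h2 : (b * X.delta q 1) ^ 2 ≤ (q.θ * q.η / (2 * Real.sqrt 2 * K)) ^ 2 :=
      pow_le_pow_left₀ (mul_nonneg hb0.le (h.delta_nonneg 1)) hG 2
    rw [mul_pow, h.delta_sq, div_pow, mul_pow, mul_pow, mul_pow, Real.sq_sqrt two_pos.le,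
      Nat.cast_one, one_mul, ← mul_div_assoc, div_le_div_iff₀ (by positivity) (by positivity)] at h2
    have h3 : q.α * Real.log q.n * (18 * W) =
        18 * K * b * X.beta q ^ 2 * (q.α * Real.log q.n) / (q.η ^ 2 * q.n ^ 2) := by
      rw [hW, hA, hM, div_pow, Real.sq_sqrt hK0.le]
      field_simp
    rw [h3, div_le_iff₀ (by positivity)]
    have h4 : q.ν ≤ b * q.n := by
      rw [← hb, div_mul_cancel₀ _ hn.ne']
      nlinarith
    have h5 : 0 ≤ b * X.beta q ^ 2 * (q.α * Real.log q.n) := by positivity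
    -- compare with the bound on `θ η` coming from `hG`
    have h6 : 24 * K ^ 2 * b ^ 2 * X.beta q ^ 2 * (q.α * Real.log q.n) ≤
        q.θ ^ 2 * q.η ^ 2 * (q.n * q.ν) := by linear_combination h2
    have h7 : 18 * K * b * X.beta q ^ 2 * (q.α * Real.log q.n) * q.ν ≤
        18 * K ^ 2 * b ^ 2 * X.beta q ^ 2 * (q.α * Real.log q.n) * q.n := by
      have e1 : q.ν ≤ K * b * q.n := by nlinarith [mul_pos hb0 hn]
      have e2 : 0 ≤ 18 * K * (b * X.beta q ^ 2 * (q.α * Real.log q.n)) := by positivity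
      linear_combination mul_le_mul_of_nonneg_left e1 e2
    have h8 : 18 * K * b * X.beta q ^ 2 * (q.α * Real.log q.n) * q.ν ≤
        q.θ ^ 2 * (q.η ^ 2 * q.n ^ 2) * q.ν := by
      have e0 : 0 ≤ K ^ 2 * b ^ 2 * X.beta q ^ 2 * (q.α * Real.log q.n) * q.n := by positivity
      linear_combination h7 + mul_le_mul_of_nonneg_right h6 hn.le + 6 * e0
    exact le_of_mul_le_mul_right h8 hν

end Assumptions

end TwoSampleSBM

end SBMTest

namespace SBMTest

/-! ### Regular outcomes and the union bound -/

namespace TwoSampleSBM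

variable {K : ℕ} {Ω : Type*} [MeasurableSpace Ω] (X : TwoSampleSBM K Ω) (q : Params)

/-- Block averages of network `t` of sample `r` with the true labels, minus their means. -/
noncomputable def avgDev (r : Fin 2) (t : Fin (X.N r)) (ω : Ω) : Matrix (Fin K) (Fin K) ℝ :=
  hdiv (blockSum (adjacency (X.graph r t ω)) (X.label r t ω)) (blockCount (X.label r t ω)) - X.B r

/-- Block sums of network `t` of sample `r` with the true labels, minus their means. -/
noncomputable def sumDev (r : Fin 2) (t : Fin (X.N r)) (ω : Ω) (k l : Fin K) : ℝ :=
  blockSum (adjacency (X.graph r t ω)) (X.label r t ω) k l -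
    blockCount (X.label r t ω) k l * X.B r k l

/-- The outcomes at which all quantities that concentrate are close to their means. -/
structure Regular (Q : Fin 2 → Matrix (Fin K) (Fin K) ℝ) (lam : Fin 2 → Fin K → ℝ) (ω : Ω) :
    Prop where
  good : ∀ r t, X.GoodLabels q (X.label r t ω)
  degree : ∀ r t v, ∑ j, adjacency (X.graph r t ω) v j ≤
    3 * (X.size r t * (q.C₁ * q.ν / q.n))
  pooled : ∀ r k l, |∑ t, X.sumDev r t ω k l| ≤
    Real.sqrt (3 / 2) * X.delta q (X.N r) * ∑ t, blockCount (X.label r t ω) k l * X.B r k l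
  single : 2 ≤ K → ∀ r t k l, |X.sumDev r t ω k l| ≤
    Real.sqrt (3 / 2) * X.delta q 1 * (blockCount (X.label r t ω) k l * X.B r k l)
  lin : 2 ≤ K → ∀ r t k,
    |resolventVec (Q r) (lam r) k ⬝ᵥ X.avgDev r t ω *ᵥ (Q r).col k| ≤ q.θ / 2

variable {X q}

/-- The five families of failures have at most 1, 1, 2, 2 and 2 times N₊K² members (the third has
4K², and N₊ ≥ 2), each of probability at most n^{-α}. The last two are needed only for matching,
hence only for K ≥ 2; for K = 1 an eigenvalue gap gives no bound on η. -/
theorem Assumptions.prob_not_regular_le (h : X.Assumptions q) (he : X.errorBound q < 1)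
    {Q : Fin 2 → Matrix (Fin K) (Fin K) ℝ} {lam : Fin 2 → Fin K → ℝ}
    (hQ : ∀ r, IsEVD (X.B r) (Q r) (lam r))
    (hgap : ∀ r k l, k ≠ l → q.η < |lam r k - lam r l|)
    (hδ : ∀ r, X.delta q (X.N r) ≤ 3 / 10)
    (hK : 2 ≤ K → X.delta q 1 ≤ 3 / 10 ∧ q.η ≤ 2 * K * (q.C₁ * q.ν / q.n) ∧
      q.C₁ * q.ν / q.n * X.delta q 1 ≤ q.θ * q.η / (2 * Real.sqrt 2 * K)) :
    X.μ.real {ω | ¬ X.Regular q Q lam ω} ≤ X.errorBound q := by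
  have := X.isProb
  set I := Σ r : Fin 2, Fin (X.N r)
  set c : ℝ := (q.n : ℝ) ^ (-q.α) with hc
  have hc0 : 0 ≤ c := Real.rpow_nonneg (by positivity) _
  set e : Bool → ℝ := fun b => if b then 1 else -1 with hedef
  have he2 : ∀ b, e b ^ 2 = 1 := by intro b; cases b <;> norm_num [hedef]
  have hzero : ∀ {p : Prop} {s : Set Ω}, (p → X.μ.real s ≤ c) → X.μ.real {ω | p ∧ ω ∈ s} ≤ c := by
    intro p s hp
    by_cases h0 : p
    · simpa [h0] using hp h0
    · simpa [h0] using hc0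
  set S₁ : I × Fin K → Set Ω := fun i =>
    {ω | ¬ 1 + (X.size i.1.1 i.1.2 : ℝ) / X.beta q ≤ commSize (X.label i.1.1 i.1.2 ω) i.2}
  set S₂ : I → Set Ω := fun i => ⋃ v, {ω | 3 * (X.size i.1 i.2 * (q.C₁ * q.ν / q.n)) ≤
      ∑ j, adjacency (X.graph i.1 i.2 ω) v j}
  set S₃ : (Fin 2 × Fin K × Fin K) × Bool → Set Ω := fun i =>
    {ω | (∀ t ∈ Finset.univ, X.GoodLabels q (X.label i.1.1 t ω)) ∧
      Real.sqrt (3 / 2) * X.delta q (Finset.univ : Finset (Fin (X.N i.1.1))).card *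
        ∑ t, blockCount (X.label i.1.1 t ω) i.1.2.1 i.1.2.2 * X.B i.1.1 i.1.2.1 i.1.2.2 ≤
        e i.2 * ∑ t, X.sumDev i.1.1 t ω i.1.2.1 i.1.2.2}
  set S₄ : (I × Fin K × Fin K) × Bool → Set Ω := fun i =>
    {ω | 2 ≤ K ∧ ω ∈ {ω | (∀ t ∈ ({i.1.1.2} : Finset _), X.GoodLabels q (X.label i.1.1.1 t ω)) ∧
      Real.sqrt (3 / 2) * X.delta q ({i.1.1.2} : Finset (Fin (X.N i.1.1.1))).card *
        ∑ t ∈ {i.1.1.2}, blockCount (X.label i.1.1.1 t ω) i.1.2.1 i.1.2.2 *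
          X.B i.1.1.1 i.1.2.1 i.1.2.2 ≤
        e i.2 * ∑ t ∈ {i.1.1.2}, X.sumDev i.1.1.1 t ω i.1.2.1 i.1.2.2}}
  set S₅ : (I × Fin K) × Bool → Set Ω := fun i =>
    {ω | 2 ≤ K ∧ ω ∈ {ω | X.GoodLabels q (X.label i.1.1.1 i.1.1.2 ω) ∧
      q.θ / 2 ≤ (e i.2 • resolventVec (Q i.1.1.1) (lam i.1.1.1) i.1.2) ⬝ᵥ
        X.avgDev i.1.1.1 i.1.1.2 ω *ᵥ (Q i.1.1.1).col i.1.2}}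
  have h₁ := measureReal_iUnion_le_card X.μ (s := S₁) (c := c)
    fun i => h.prob_not_goodLabels he i.1.1 i.1.2 i.2
  have h₂ := measureReal_iUnion_le_card X.μ (s := S₂) (c := c) fun i => h.prob_degree he i.1 i.2
  have h₃ := measureReal_iUnion_le_card X.μ (s := S₃) (c := c) fun i =>
    h.prob_dev i.1.1 Finset.univ ⟨X.first _, Finset.mem_univ _⟩
      (by rw [Finset.card_univ, Fintype.card_fin]; exact hδ _) i.1.2.1 i.1.2.2 (he2 i.2)
  have h₄ := measureReal_iUnion_le_card X.μ (s := S₄) (c := c) fun i => hzero fun h2 =>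
    h.prob_dev i.1.1.1 {i.1.1.2} (Finset.singleton_nonempty _)
      (by rw [Finset.card_singleton]; exact (hK h2).1) i.1.2.1 i.1.2.2 (he2 i.2)
  have h₅ := measureReal_iUnion_le_card X.μ (s := S₅) (c := c) fun i => hzero fun h2 =>
    h.prob_bilin i.1.1.1 i.1.1.2 (by
      rw [vnorm_smul]
      have : |e i.2| = 1 := by
        rcases sq_eq_one_iff.1 (he2 i.2) with h0 | h0 <;> simp [h0]
      rw [this, one_mul]
      exact (hQ _).vnorm_resolventVec_le h.η_pos (hgap _) _) ((hQ _).vnorm_col _)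
      (hK h2).2.1 (hK h2).2.2
  have habs : ∀ {x y : ℝ}, ¬ (y ≤ e true * x) → ¬ (y ≤ e false * x) → |x| ≤ y := by
    intro x y hx hx'
    simp only [hedef, if_true, one_mul, not_le] at hx
    simp only [hedef, Bool.false_eq_true, if_false, not_le] at hx'
    exact abs_le.2 ⟨by linarith, hx.le⟩
  have hsub : {ω | ¬ X.Regular q Q lam ω} ⊆
      (⋃ i, S₁ i) ∪ ((⋃ i, S₂ i) ∪ ((⋃ i, S₃ i) ∪ ((⋃ i, S₄ i) ∪ ⋃ i, S₅ i))) := by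
    intro ω hω
    by_contra hn
    simp only [Set.mem_union, Set.mem_iUnion, not_or, not_exists] at hn
    obtain ⟨n₁, n₂, n₃, n₄, n₅⟩ := hn
    have hgood : ∀ r t, X.GoodLabels q (X.label r t ω) := fun r t k =>
      not_not.1 (n₁ (⟨r, t⟩, k))
    refine hω ⟨hgood, fun r t v => ?_, fun r k l => ?_, fun h2 r t k l => ?_, fun h2 r t k => ?_⟩
    · have := n₂ ⟨r, t⟩
      simp only [S₂, Set.mem_iUnion, not_exists] at this
      exact (not_le.1 (this v)).le
    · have m := fun b => not_and.1 (n₃ ((r, k, l), b)) fun t _ => hgood r t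
      simp only [Finset.card_univ, Fintype.card_fin] at m
      exact habs (m true) (m false)
    · have m := fun b => not_and.1 (not_and.1 (n₄ ((⟨r, t⟩, k, l), b)) h2) fun t' _ => hgood r t'
      simp only [Finset.card_singleton, Finset.sum_singleton] at m
      exact habs (m true) (m false)
    · have m := fun b => not_and.1 (not_and.1 (n₅ ((⟨r, t⟩, k), b)) h2) (hgood r t)
      simp only [smul_dotProduct, smul_eq_mul] at m
      exact habs (m true) (m false)
  have hcardI : (Fintype.card I : ℝ) = (X.N 0 : ℝ) + X.N 1 := by
    simp [I, Fintype.card_sigma, Fin.sum_univ_two]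
  simp only [Fintype.card_prod, Fintype.card_fin, Fintype.card_bool, Nat.cast_mul, hcardI,
    Nat.cast_ofNat] at h₁ h₂ h₃ h₄ h₅
  have h6 := (measureReal_mono hsub).trans ((measureReal_union_le _ _).trans
    (add_le_add h₁ ((measureReal_union_le _ _).trans (add_le_add h₂ ((measureReal_union_le _ _).trans
      (add_le_add h₃ ((measureReal_union_le _ _).trans (add_le_add h₄ h₅))))))))
  refine h6.trans ?_
  rw [errorBound, ← hc]
  set N := (X.N 0 : ℝ) + X.N 1 with hN
  have hN2 : 2 ≤ N := by
    have a0 : (1 : ℝ) ≤ X.N 0 := by exact_mod_cast X.N_pos 0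
    have a1 : (1 : ℝ) ≤ X.N 1 := by exact_mod_cast X.N_pos 1
    linarith
  have hK1 : (1 : ℝ) ≤ K := by exact_mod_cast X.K_pos
  have b1 : (K : ℝ) ≤ K ^ 2 := by nlinarith
  have b2 : (1 : ℝ) ≤ K ^ 2 := by nlinarith
  have b3 : N * K ≤ N * K ^ 2 := mul_le_mul_of_nonneg_left b1 (by linarith)
  have b4 : N ≤ N * K ^ 2 := by nlinarith
  have b5 : 2 * (K : ℝ) ^ 2 ≤ N * K ^ 2 := by nlinarith
  have b6 : 0 ≤ N * (K : ℝ) ^ 2 := by positivity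
  have b7 : N * K + (N + (2 * (K * K) * 2 + (N * (K * K) * 2 + N * K * 2))) ≤
      19 * N * (K : ℝ) ^ 2 := by nlinarith
  have := mul_le_mul_of_nonneg_right b7 hc0
  linarith

end TwoSampleSBM

end SBMTest

namespace SBMTest

/-! ### The effect of misclassified nodes -/

section Misclassified

variable {K m : ℕ}

theorem hammingDist_eq_sum (z w : Fin m → Fin K) :
    (hammingDist z w : ℝ) = ∑ i, if z i = w i then 0 else 1 := by
  simp [hammingDist, Finset.sum_ite]

/-- An entry changes its block only if one of its two nodes is mislabelled. Ordered pairs with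
mislabelled first node contribute at most `D` per such node, and by symmetry so do those with
mislabelled second node. -/
theorem abs_blockSum_sub_le {A : Matrix (Fin m) (Fin m) ℝ} (hs : ∀ i j, A i j = A j i)
    (h0 : ∀ i j, 0 ≤ A i j) {D : ℝ} (hD : ∀ i, ∑ j, A i j ≤ D) (z w : Fin m → Fin K)
    (k l : Fin K) : |blockSum A w k l - blockSum A z k l| ≤ 2 * hammingDist z w * D := by
  set e : Fin m → ℝ := fun i => if z i = w i then 0 else 1 with he
  have h1 : |blockSum A w k l - blockSum A z k l| ≤ ∑ i, ∑ j, (e i * A i j + e j * A i j) := by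
    simp only [blockSum, Matrix.of_apply, ← Finset.sum_sub_distrib]
    refine (Finset.abs_sum_le_sum_abs _ _).trans (Finset.sum_le_sum fun i _ => ?_)
    refine (Finset.abs_sum_le_sum_abs _ _).trans (Finset.sum_le_sum fun j _ => ?_)
    have hA := h0 i j
    simp only [he]
    by_cases hi : z i = w i <;> by_cases hj : z j = w j
    · simp [hi, hj]
    all_goals
      simp only [hi, hj, if_true, if_false]
      split_ifs <;> simp [abs_of_nonneg hA, hA]
  have h2 : ∑ i, ∑ j, e j * A i j = ∑ i, ∑ j, e i * A i j := by
    rw [Finset.sum_comm]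
    exact Finset.sum_congr rfl fun i _ => Finset.sum_congr rfl fun j _ => by rw [hs]
  refine h1.trans ?_
  simp only [Finset.sum_add_distrib]
  rw [h2, hammingDist_eq_sum]
  have h3 : ∑ i, ∑ j, e i * A i j ≤ (∑ i, e i) * D := by
    rw [Finset.sum_mul]
    refine Finset.sum_le_sum fun i _ => ?_
    rw [← Finset.mul_sum]
    refine mul_le_mul_of_nonneg_left (hD i) ?_
    simp only [he]; split_ifs <;> norm_num
  linarith

theorem commSize_le_add (z w : Fin m → Fin K) (k : Fin K) :
    (commSize z k : ℝ) ≤ commSize w k + hammingDist z w := by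
  have : ∀ z : Fin m → Fin K, (commSize z k : ℝ) = ∑ i, if z i = k then 1 else 0 := by
    intro z; simp [commSize]
  rw [this, this, hammingDist_eq_sum, ← Finset.sum_add_distrib]
  refine Finset.sum_le_sum fun i _ => ?_
  by_cases h : z i = w i
  · simp [h]
  · simp only [h, if_false]; split_ifs <;> norm_num

theorem sum_offDiagOnes_le (i : Fin m) : ∑ j, offDiagOnes m i j ≤ m := by
  calc ∑ j, offDiagOnes m i j ≤ ∑ _j : Fin m, (1 : ℝ) := by
        refine Finset.sum_le_sum fun j _ => ?_
        simp only [offDiagOnes, Matrix.of_apply]; split_ifs <;> norm_num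
    _ = m := by simp

theorem exists_normHamming_eq_misclass (z w : Fin m → Fin K) :
    ∃ σ : Equiv.Perm (Fin K), normHamming z (σ ∘ w) = misclass z w :=
  exists_eq_ciInf_of_finite

theorem misclass_nonneg (z w : Fin m → Fin K) : 0 ≤ misclass z w := by
  obtain ⟨σ, h⟩ := exists_normHamming_eq_misclass z w
  rw [← h, normHamming]; positivity

/-- Perturbation of a quotient of a block sum and a block count. -/
theorem abs_div_sub_div_le {P p M m V b B d ε c : ℝ} (hV : 0 < V) (hc : 0 < c) (hb : 0 ≤ b)
    (hε : 0 ≤ ε) (hM : 99 / 100 * (V / c) ≤ M) (hm : 0 < m) (hP : |P - p| ≤ 6 * b * (ε * V))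
    (hMm : |M - m| ≤ 2 * (ε * V)) (hp : 0 ≤ p) (hpm : |p - m * B| ≤ d * (m * B)) (hd0 : 0 ≤ d)
    (hd : d ≤ 3 / 8) (hBb : B ≤ b) :
    |P / M - p / m| ≤ 9 * (c * ε) * b ∧ |p / m - B| ≤ d * b := by
  have h1 : |p / m - B| ≤ d * B := by
    have : p / m - B = (p - m * B) / m := by field_simp
    rw [this, abs_div, abs_of_pos hm, div_le_iff₀ hm]
    linarith
  have h2 : p / m ≤ 11 / 8 * b := by
    have h3 := (abs_le.1 h1).2
    have h4 : 0 ≤ d * B := (abs_nonneg _).trans h1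
    have h5 : d * B ≤ d * b := mul_le_mul_of_nonneg_left hBb hd0
    nlinarith
  have hpm0 : 0 ≤ p / m := div_nonneg hp hm.le
  have hM0 : 0 < M := lt_of_lt_of_le (by positivity) hM
  refine ⟨?_, h1.trans (mul_le_mul_of_nonneg_left hBb hd0)⟩
  have h3 : P / M - p / m = ((P - p) + p / m * (m - M)) / M := by field_simp; ring
  rw [h3, abs_div, abs_of_pos hM0, div_le_iff₀ hM0]
  -- The constants give 6 + 2·11/8 = 8.75, below 9·99/100 = 8.91, where 99/100 is the loss in the
  -- denominator.
  have h4 : |P - p + p / m * (m - M)| ≤ 6 * b * (ε * V) + 11 / 8 * b * (2 * (ε * V)) := by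
    refine (abs_add_le _ _).trans (add_le_add hP ?_)
    rw [abs_mul, abs_of_nonneg hpm0, abs_sub_comm]
    exact mul_le_mul h2 hMm (abs_nonneg _) (by positivity)
  refine h4.trans ?_
  have h5 : 9 * (c * ε) * b * (99 / 100 * (V / c)) ≤ 9 * (c * ε) * b * M :=
    mul_le_mul_of_nonneg_left hM (by positivity)
  have h6 : 9 * (c * ε) * b * (99 / 100 * (V / c)) = 891 / 100 * (b * (ε * V)) := by
    field_simp; ring
  have h7 : 0 ≤ b * (ε * V) := by positivity
  linarith

end Misclassified

/-! ### Lower bounds for the test statistic -/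

section Statistic

variable {K : ℕ}

/-- The harmonic mean is at least h and the pooled variance at most 1/4. If the variance vanishes,
the pooled ratio is 0 or 1, which forces both ratios to be equal, and both sides are 0. -/
theorem two_mul_le_term {s₁ m₁ s₂ m₂ h : ℝ} (hh : 0 < h) (h₁ : h ≤ m₁) (h₂ : h ≤ m₂)
    (hs₁ : 0 ≤ s₁) (hs₁' : s₁ ≤ m₁) (hs₂ : 0 ≤ s₂) (hs₂' : s₂ ≤ m₂) :
    2 * h * (s₁ / m₁ - s₂ / m₂) ^ 2 ≤
      2 * m₁ * m₂ / (m₁ + m₂) / (2 * ((s₁ + s₂) / (m₁ + m₂) * (1 - (s₁ + s₂) / (m₁ + m₂)))) *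
        (s₁ / m₁ - s₂ / m₂) ^ 2 := by
  have hm₁ : 0 < m₁ := hh.trans_le h₁
  have hm₂ : 0 < m₂ := hh.trans_le h₂
  have hm : 0 < m₁ + m₂ := add_pos hm₁ hm₂
  set p := (s₁ + s₂) / (m₁ + m₂) with hp
  have hp0 : 0 ≤ p := by positivity
  have hp1 : p ≤ 1 := by rw [hp, div_le_one hm]; linarith
  rcases hp0.eq_or_lt with h0 | hp0
  · have : s₁ + s₂ = 0 := by
      rcases div_eq_zero_iff.1 (hp ▸ h0.symm) with h | h
      · exact h
      · exact absurd h hm.ne'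
    have e1 : s₁ = 0 := by linarith
    have e2 : s₂ = 0 := by linarith
    simp [e1, e2]
  rcases hp1.eq_or_lt with h0 | hp1
  · have : s₁ + s₂ = m₁ + m₂ := by rw [hp, div_eq_one_iff_eq hm.ne'] at h0; exact h0
    have e1 : s₁ = m₁ := by linarith
    have e2 : s₂ = m₂ := by linarith
    rw [e1, e2, div_self hm₁.ne', div_self hm₂.ne']
    simp
  refine mul_le_mul_of_nonneg_right ?_ (sq_nonneg _)
  have hv : 0 < p * (1 - p) := mul_pos hp0 (by linarith)
  have hv4 : p * (1 - p) ≤ 1 / 4 := by nlinarith [sq_nonneg (2 * p - 1)]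
  rw [le_div_iff₀ (by positivity)]
  have h3 : h ≤ 2 * m₁ * m₂ / (m₁ + m₂) := by
    rw [le_div_iff₀ hm]
    nlinarith
  nlinarith

/-- By symmetry the factor 2 accounts for the entries below the diagonal; the diagonal is counted
once too often, which only helps. -/
theorem mul_frobNorm_sq_le_sum {D : Matrix (Fin K) (Fin K) ℝ} (hD : ∀ k l, D k l = D l k)
    {h : ℝ} (hh : 0 ≤ h) :
    h * frobNorm D ^ 2 ≤ ∑ k, ∑ l ∈ Finset.Ici k, 2 * h * D k l ^ 2 := by
  set f : Fin K → Fin K → ℝ := fun k l => if k = l then 0 else D k l ^ 2 with hf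
  have h1 := sum_sum_eq_two_mul (h := f) (fun k l => by simp only [hf, hD k l, eq_comm])
    (fun k => by simp [hf])
  have h2 : ∑ k, ∑ l, D k l ^ 2 = ∑ k, D k k ^ 2 + ∑ k, ∑ l, f k l := by
    rw [← Finset.sum_add_distrib]
    refine Finset.sum_congr rfl fun k _ => ?_
    rw [← Finset.add_sum_erase _ _ (Finset.mem_univ k),
      ← Finset.add_sum_erase _ (f k) (Finset.mem_univ k)]
    have : ∑ l ∈ Finset.univ.erase k, D k l ^ 2 = ∑ l ∈ Finset.univ.erase k, f k l :=
      Finset.sum_congr rfl fun l hl => by simp [hf, (Finset.ne_of_mem_erase hl).symm]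
    rw [this]
    simp [hf]
  have h3 : ∑ k, ∑ l ∈ Finset.Ici k, D k l ^ 2 =
      ∑ k, D k k ^ 2 + ∑ k, ∑ l ∈ Finset.Ioi k, f k l := by
    rw [← Finset.sum_add_distrib]
    refine Finset.sum_congr rfl fun k _ => ?_
    rw [← Finset.Ioi_insert, Finset.sum_insert (by simp)]
    congr 1
    exact Finset.sum_congr rfl fun l hl => by simp [hf, (Finset.mem_Ioi.1 hl).ne]
  simp only [← Finset.mul_sum]
  rw [frobNorm_sq, h2, h1, h3]
  have h4 : 0 ≤ ∑ k, D k k ^ 2 := Finset.sum_nonneg fun k _ => sq_nonneg _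
  nlinarith [mul_nonneg hh h4]

theorem matchDist_le (B₁ B₂ : Matrix (Fin K) (Fin K) ℝ) (σ : Equiv.Perm (Fin K)) :
    matchDist B₁ B₂ ≤ frobNorm (B₂ - permConj σ B₁) :=
  ciInf_le (Set.finite_range _).bddBelow σ

theorem matchDist_nonneg (B₁ B₂ : Matrix (Fin K) (Fin K) ℝ) : 0 ≤ matchDist B₁ B₂ :=
  Real.iInf_nonneg fun _ => frobNorm_nonneg _

theorem matchDist_le_frobNorm_sub (B₁ B₂ : Matrix (Fin K) (Fin K) ℝ)
    (τ₁ τ₂ : Equiv.Perm (Fin K)) :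
    matchDist B₁ B₂ ≤ frobNorm (permConj τ₁ B₁ - permConj τ₂ B₂) := by
  refine (matchDist_le B₁ B₂ (τ₁ * τ₂⁻¹)).trans (le_of_eq ?_)
  rw [← frobNorm_permConj τ₂, ← frobNorm_neg]
  congr 1
  ext k l
  simp [permConj_apply]

/-- Relabelled true matrices are at least the matching distance apart whatever the relabellings, and
the errors keep their norm under relabelling. This is why the global matching may be arbitrary. -/
theorem frobNorm_sub_ge {B₁ B₂ F₁ F₂ : Matrix (Fin K) (Fin K) ℝ} {x₁ x₂ : ℝ}
    (h₁ : frobNorm (F₁ - B₁) ≤ x₁) (h₂ : frobNorm (F₂ - B₂) ≤ x₂) (τ₁ τ₂ : Equiv.Perm (Fin K)) :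
    matchDist B₁ B₂ - x₁ - x₂ ≤ frobNorm (permConj τ₁ F₁ - permConj τ₂ F₂) := by
  have e : permConj τ₁ B₁ - permConj τ₂ B₂ = (permConj τ₁ F₁ - permConj τ₂ F₂) +
      (-permConj τ₁ (F₁ - B₁) + permConj τ₂ (F₂ - B₂)) := by
    ext k l
    simp [permConj_apply]
    ring
  have h3 := matchDist_le_frobNorm_sub B₁ B₂ τ₁ τ₂
  rw [e] at h3
  have h4 := frobNorm_add_le (permConj τ₁ F₁ - permConj τ₂ F₂)
    (-permConj τ₁ (F₁ - B₁) + permConj τ₂ (F₂ - B₂))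
  have h5 := frobNorm_add_le (-permConj τ₁ (F₁ - B₁)) (permConj τ₂ (F₂ - B₂))
  rw [frobNorm_neg, frobNorm_permConj, frobNorm_permConj] at h5
  linarith

end Statistic

namespace TwoSampleSBM

variable {K : ℕ} {Ω : Type*} [MeasurableSpace Ω] {X : TwoSampleSBM K Ω} {q : Params}

theorem epsMax_nonneg (X : TwoSampleSBM K Ω) (ω : Ω) : 0 ≤ X.epsMax ω :=
  Real.iSup_nonneg fun _ => misclass_nonneg _ _

theorem misclass_le_epsMax (X : TwoSampleSBM K Ω) (r : Fin 2) (t : Fin (X.N r)) (ω : Ω) :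
    misclass (X.label r t ω) (X.zhat r t ω) ≤ X.epsMax ω :=
  le_ciSup (f := fun p : Σ r : Fin 2, Fin (X.N r) =>
    misclass (X.label p.1 p.2 ω) (X.zhat p.1 p.2 ω)) (Set.finite_range _).bddAbove ⟨r, t⟩

theorem epsMax_eq_zero (X : TwoSampleSBM K Ω) (hK : K = 1) (ω : Ω) : X.epsMax ω = 0 := by
  subst hK
  have : ∀ p : Σ r : Fin 2, Fin (X.N r),
      misclass (X.label p.1 p.2 ω) (X.zhat p.1 p.2 ω) = 0 := by
    intro p
    obtain ⟨σ, h⟩ := exists_normHamming_eq_misclass (X.label p.1 p.2 ω) (X.zhat p.1 p.2 ω)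
    rw [← h, normHamming, Subsingleton.elim (X.label p.1 p.2 ω) (σ ∘ X.zhat p.1 p.2 ω)]
    simp
  simp [epsMax, this]

/-- If K ≥ 2 then β ≥ K ≥ 2, so β³ ≥ 8 and 48·8 = 384; if K = 1 nothing can be misclassified. -/
theorem Assumptions.epsMax_mul_beta_le (h : X.Assumptions q) {ω : Ω} (hG : ω ∈ X.goodEvent q) :
    X.epsMax ω * X.beta q ≤ 1 / 384 := by
  have hβ := h.one_le_beta
  have hε := X.epsMax_nonneg ω
  rcases Nat.lt_or_ge K 2 with hK | hK
  · have : K = 1 := by have := X.K_pos; omega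
    rw [X.epsMax_eq_zero this]; norm_num
  · have h2 : 2 ≤ X.beta q := le_trans (by exact_mod_cast hK) h.K_le_beta
    have h3 : 8 ≤ X.beta q ^ 3 := by
      calc (8 : ℝ) = 2 ^ 3 := by norm_num
        _ ≤ _ := pow_le_pow_left₀ (by norm_num) h2 3
    have h4 := hG.2
    have h5 := h.one_le_C₂
    have h6 : 0 ≤ X.beta q ^ 4 * X.epsMax ω := by positivity
    have h7 : 48 * (X.beta q ^ 4 * X.epsMax ω) ≤ 1 := by nlinarith
    have h8 : 8 * (X.epsMax ω * X.beta q) ≤ X.beta q ^ 3 * (X.epsMax ω * X.beta q) :=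
      mul_le_mul_of_nonneg_right h3 (by positivity)
    nlinarith

end TwoSampleSBM

end SBMTest

namespace SBMTest

/-! ### Alignment of the networks within a sample -/

section PermConj

variable {K : ℕ}

theorem permConj_sum {ι : Type*} (s : Finset ι) (σ : Equiv.Perm (Fin K))
    (M : ι → Matrix (Fin K) (Fin K) ℝ) :
    permConj σ (∑ i ∈ s, M i) = ∑ i ∈ s, permConj σ (M i) := by
  ext k l
  simp [permConj_apply, Matrix.sum_apply]

theorem permConj_hdiv (σ : Equiv.Perm (Fin K)) (S M : Matrix (Fin K) (Fin K) ℝ) :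
    hdiv (permConj σ S) (permConj σ M) = permConj σ (hdiv S M) := by
  ext k l
  simp [permConj_apply, hdiv]

end PermConj

namespace TwoSampleSBM

variable {K : ℕ} {Ω : Type*} [MeasurableSpace Ω] {X : TwoSampleSBM K Ω} {q : Params}

theorem epsMax_aligned (X : TwoSampleSBM K Ω) (ω : Ω) :
    ∃ σ : (r : Fin 2) → Fin (X.N r) → Equiv.Perm (Fin K), ∀ r t,
      (hammingDist (X.label r t ω) (σ r t ∘ X.zhat r t ω) : ℝ) ≤ X.epsMax ω * X.size r t := by
  have h : ∀ r t, ∃ σ : Equiv.Perm (Fin K),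
      (hammingDist (X.label r t ω) (σ ∘ X.zhat r t ω) : ℝ) ≤ X.epsMax ω * X.size r t := by
    intro r t
    obtain ⟨σ, hσ⟩ := exists_normHamming_eq_misclass (X.label r t ω) (X.zhat r t ω)
    refine ⟨σ, ?_⟩
    have h1 := X.misclass_le_epsMax r t ω
    rw [← hσ, normHamming] at h1
    rcases (Nat.eq_zero_or_pos (X.size r t)) with h0 | h0
    · have : hammingDist (X.label r t ω) (σ ∘ X.zhat r t ω) ≤ 0 := by
        refine hammingDist_le_card_fintype.trans ?_
        simp [h0]
      have h2 := Nat.le_zero.1 this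
      rw [h2, h0]; simp
    · rwa [div_le_iff₀ (by exact_mod_cast h0)] at h1
  choose σ hσ using h
  exact ⟨σ, hσ⟩

section Deterministic

variable {Q : Fin 2 → Matrix (Fin K) (Fin K) ℝ} {lam : Fin 2 → Fin K → ℝ} {ω : Ω}
  {σ : (r : Fin 2) → Fin (X.N r) → Equiv.Perm (Fin K)}

/-- Block counts with the aligned estimated labels are nearly as large as with the true labels. -/
theorem le_blockCount_aligned (h : X.Assumptions q) (hG : ω ∈ X.goodEvent q)
    (hR : X.Regular q Q lam ω)
    (hσ : ∀ r t, (hammingDist (X.label r t ω) (σ r t ∘ X.zhat r t ω) : ℝ) ≤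
      X.epsMax ω * X.size r t) (r : Fin 2) (t : Fin (X.N r)) (k l : Fin K) :
    99 / 100 * ((X.size r t : ℝ) ^ 2 / X.beta q ^ 2) ≤
      blockCount (σ r t ∘ X.zhat r t ω) k l := by
  have hβ := h.beta_pos
  have hm := h.size_pos r t
  have h1 := h.epsMax_mul_beta_le hG
  set m : ℝ := (X.size r t : ℝ)
  have h2 : 383 / 384 * (m / X.beta q) ≤ m / X.beta q - X.epsMax ω * m := by
    have : X.epsMax ω * m = X.epsMax ω * X.beta q * (m / X.beta q) := by field_simp
    rw [this]
    have : 0 ≤ m / X.beta q := by positivity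
    nlinarith
  have h3 : ∀ k, 1 + 383 / 384 * (m / X.beta q) ≤ commSize (σ r t ∘ X.zhat r t ω) k := by
    intro k
    have := hR.good r t k
    have := commSize_le_add (X.label r t ω) (σ r t ∘ X.zhat r t ω) k
    linarith [hσ r t]
  have h0 : 0 ≤ 383 / 384 * (m / X.beta q) := by positivity
  have h4 : (383 / 384 * (m / X.beta q)) * (383 / 384 * (m / X.beta q)) ≤
      blockCount (σ r t ∘ X.zhat r t ω) k l := by
    simp only [blockCount, Matrix.of_apply]
    have h5 := h3 k
    have h6 := h3 l
    refine mul_le_mul (by linarith) ?_ h0 (by linarith)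
    split_ifs <;> linarith
  -- (383/384)² > 99/100.
  refine le_trans ?_ h4
  have : 0 ≤ m ^ 2 / X.beta q ^ 2 := by positivity
  rw [← div_pow] at this ⊢
  nlinarith

/-- Pooled block averages with aligned labels. -/
theorem abs_pooled_sub_le (h : X.Assumptions q) (hG : ω ∈ X.goodEvent q)
    (hR : X.Regular q Q lam ω)
    (hσ : ∀ r t, (hammingDist (X.label r t ω) (σ r t ∘ X.zhat r t ω) : ℝ) ≤
      X.epsMax ω * X.size r t) (r : Fin 2) (T : Finset (Fin (X.N r))) (hT : T.Nonempty) {d : ℝ}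
    (hd0 : 0 ≤ d) (hd : d ≤ 3 / 8) (k l : Fin K)
    (hdev : |∑ t ∈ T, X.sumDev r t ω k l| ≤
      d * ∑ t ∈ T, blockCount (X.label r t ω) k l * X.B r k l) :
    |(∑ t ∈ T, blockSum (adjacency (X.graph r t ω)) (σ r t ∘ X.zhat r t ω) k l) /
        (∑ t ∈ T, blockCount (σ r t ∘ X.zhat r t ω) k l) -
      (∑ t ∈ T, blockSum (adjacency (X.graph r t ω)) (X.label r t ω) k l) /
        (∑ t ∈ T, blockCount (X.label r t ω) k l)| ≤
      9 * (X.beta q ^ 2 * X.epsMax ω) * (q.C₁ * q.ν / q.n) ∧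
    |(∑ t ∈ T, blockSum (adjacency (X.graph r t ω)) (X.label r t ω) k l) /
        (∑ t ∈ T, blockCount (X.label r t ω) k l) - X.B r k l| ≤ d * (q.C₁ * q.ν / q.n) := by
  have hβ := h.beta_pos
  have hC := h.one_le_C₁
  have hν := h.ν_pos
  have hn := h.n_pos'
  have hε := X.epsMax_nonneg ω
  have hb : 0 ≤ q.C₁ * q.ν / q.n := by positivity
  refine abs_div_sub_div_le (V := ∑ t ∈ T, (X.size r t : ℝ) ^ 2) (c := X.beta q ^ 2)
    (Finset.sum_pos (fun t _ => pow_pos (h.size_pos r t) 2) hT) (by positivity) hb hε ?_ ?_ ?_ ?_ ?_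
    ?_ hd0 hd (h.sparsity r k l).2
  · rw [Finset.sum_div, Finset.mul_sum]
    exact Finset.sum_le_sum fun t _ => le_blockCount_aligned h hG hR hσ r t k l
  · refine Finset.sum_pos (fun t _ => ?_) hT
    have := h.size_pos r t
    exact lt_of_lt_of_le (by positivity) ((hR.good r t).le_blockCount h k l)
  · rw [← Finset.sum_sub_distrib]
    refine (Finset.abs_sum_le_sum_abs _ _).trans ?_
    simp only [Finset.mul_sum]
    refine Finset.sum_le_sum fun t _ => ?_
    refine (abs_blockSum_sub_le (adjacency_symm _) (adjacency_nonneg _) (hR.degree r t)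
      (X.label r t ω) (σ r t ∘ X.zhat r t ω) k l).trans ?_
    have h1 := hσ r t
    have h2 : 0 ≤ (X.size r t : ℝ) * (q.C₁ * q.ν / q.n) := by positivity
    have := mul_le_mul_of_nonneg_right h1 h2
    linarith
  · rw [← Finset.sum_sub_distrib]
    refine (Finset.abs_sum_le_sum_abs _ _).trans ?_
    simp only [Finset.mul_sum]
    refine Finset.sum_le_sum fun t _ => ?_
    rw [blockCount_eq_blockSum, blockCount_eq_blockSum]
    refine (abs_blockSum_sub_le offDiagOnes_symm offDiagOnes_nonneg sum_offDiagOnes_le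
      (X.label r t ω) (σ r t ∘ X.zhat r t ω) k l).trans ?_
    have h2 : 0 ≤ (X.size r t : ℝ) := by positivity
    have := mul_le_mul_of_nonneg_right (hσ r t) h2
    linarith
  · exact Finset.sum_nonneg fun t _ => blockSum_nonneg (adjacency_nonneg _) _ _ _
  · have e1 : ∑ t ∈ T, X.sumDev r t ω k l =
        ∑ t ∈ T, blockSum (adjacency (X.graph r t ω)) (X.label r t ω) k l -
          (∑ t ∈ T, blockCount (X.label r t ω) k l) * X.B r k l := by
      rw [Finset.sum_mul, ← Finset.sum_sub_distrib]; rfl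
    rw [e1, ← Finset.sum_mul] at hdev
    exact hdev

theorem sqrt_three_halves_le : Real.sqrt (3 / 2) ≤ 5 / 4 := Real.sqrt_le_iff.2 (by norm_num)

/-- The networks of one sample are matched correctly. -/
theorem Phat1_eq (h : X.Assumptions q) (hG : ω ∈ X.goodEvent q) (hR : X.Regular q Q lam ω)
    (hσ : ∀ r t, (hammingDist (X.label r t ω) (σ r t ∘ X.zhat r t ω) : ℝ) ≤
      X.epsMax ω * X.size r t) (hQ : ∀ r, IsEVD (X.B r) (Q r) (lam r))
    (hgap : ∀ r k l, k ≠ l → q.η < |lam r k - lam r l|)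
    (hcol : ∀ r k, q.θ < |∑ i, Q r i k|) (hδ : 2 ≤ K → X.delta q 1 ≤ 3 / 10)
    (r : Fin 2) (t : Fin (X.N r)) :
    X.Phat1 r t ω = (σ r t)⁻¹ * σ r (X.first r) := by
  rcases Nat.lt_or_ge K 2 with hK | hK
  · have : K = 1 := by have := X.K_pos; omega
    subst this
    exact Subsingleton.elim _ _
  have hβ := h.one_le_beta
  have hβ0 := h.beta_pos
  have hC := h.one_le_C₁
  have hν := h.ν_pos
  have hn := h.n_pos'
  have hε := X.epsMax_nonneg ω
  have hη := h.η_pos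
  have hθ := h.θ_pos
  have hK0 : (0 : ℝ) < K := by exact_mod_cast X.K_pos
  have hδ1 := hδ hK
  have hδ0 := h.delta_nonneg 1
  obtain ⟨b, hb⟩ : ∃ b, q.C₁ * q.ν / q.n = b := ⟨_, rfl⟩
  have hb0 : 0 < b := by rw [← hb]; positivity
  have h2 : Real.sqrt 2 ^ 2 = 2 := Real.sq_sqrt two_pos.le
  have hs2 : 0 < Real.sqrt 2 := by positivity
  have h32 : Real.sqrt (3 / 2) = Real.sqrt 2 * (Real.sqrt 3 / 2) := by
    rw [← Real.sqrt_sq (show (0 : ℝ) ≤ Real.sqrt 2 * (Real.sqrt 3 / 2) by positivity), mul_pow,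
      div_pow, h2, Real.sq_sqrt (by norm_num : (0 : ℝ) ≤ 3)]
    norm_num
  have hs3 : Real.sqrt 3 ≤ 7 / 4 := Real.sqrt_le_iff.2 (by norm_num)
  -- the condition of the event `goodEvent`
  have hg : b * (56 * X.beta q ^ 3 * X.epsMax ω + X.delta q 1) * (2 * Real.sqrt 2 * K) ≤
      q.θ * q.η := by
    have := hG.1
    rw [le_div_iff₀ (by positivity), gamma] at this
    rw [← hb]
    calc _ = q.ν / q.n * (q.C₁ * (56 * X.beta q ^ 3 * X.epsMax ω + X.delta q 1)) *
          (2 * Real.sqrt 2 * K) := by ring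
      _ ≤ _ := this
  have hβ23 : X.beta q ^ 2 * X.epsMax ω ≤ X.beta q ^ 3 * X.epsMax ω :=
    mul_le_mul_of_nonneg_right (pow_le_pow_right₀ hβ (by norm_num)) hε
  set E : Fin (X.N r) → Matrix (Fin K) (Fin K) ℝ := fun t =>
    hdiv (blockSum (adjacency (X.graph r t ω)) (σ r t ∘ X.zhat r t ω))
      (blockCount (σ r t ∘ X.zhat r t ω)) - X.B r with hE
  have hd0 : 0 ≤ Real.sqrt (3 / 2) * X.delta q 1 := mul_nonneg (Real.sqrt_nonneg _) hδ0
  have hd : Real.sqrt (3 / 2) * X.delta q 1 ≤ 3 / 8 := by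
    nlinarith [sqrt_three_halves_le, Real.sqrt_nonneg (3 / 2)]
  have hentry : ∀ t k l, |(E t - X.avgDev r t ω) k l| ≤ 9 * (X.beta q ^ 2 * X.epsMax ω) * b ∧
      |X.avgDev r t ω k l| ≤ Real.sqrt (3 / 2) * X.delta q 1 * b := by
    intro t k l
    have h1 := abs_pooled_sub_le h hG hR hσ r {t} (Finset.singleton_nonempty t) hd0 hd k l (by
      rw [Finset.sum_singleton, Finset.sum_singleton]
      exact hR.single hK r t k l)
    simp only [Finset.sum_singleton, hb] at h1
    simpa [hE, avgDev, hdiv] using h1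
  -- With entries at most √(3/2)·y the norm is at most K√(3/2)·y = (√3/4)(2√2Ky) ≤ (√3/4)θη, and √3
  -- ≤ 7/4.
  have hEn : ∀ t, frobNorm (E t) ≤ 7 / 16 * (q.θ * q.η) := by
    intro t
    set y := b * (56 * X.beta q ^ 3 * X.epsMax ω + X.delta q 1) with hy
    have hy0 : 0 ≤ y := by positivity
    have h1 : ∀ k l, |E t k l| ≤ Real.sqrt (3 / 2) * y := by
      intro k l
      have h3 := hentry t k l
      have h4 : E t k l = (E t - X.avgDev r t ω) k l + X.avgDev r t ω k l := by simp
      rw [h4]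
      refine (abs_add_le _ _).trans ?_
      have h5 : 1 ≤ Real.sqrt (3 / 2) := Real.one_le_sqrt.2 (by norm_num)
      have h6 : 9 * (X.beta q ^ 2 * X.epsMax ω) * b ≤
          Real.sqrt (3 / 2) * (56 * X.beta q ^ 3 * X.epsMax ω * b) := by
        have h7 : 0 ≤ X.beta q ^ 3 * X.epsMax ω * b := by positivity
        have h8 := mul_le_mul_of_nonneg_right hβ23 hb0.le
        nlinarith [mul_le_mul_of_nonneg_right h5 h7]
      have h9 : Real.sqrt (3 / 2) * y = Real.sqrt (3 / 2) * (56 * X.beta q ^ 3 * X.epsMax ω * b) +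
          Real.sqrt (3 / 2) * X.delta q 1 * b := by rw [hy]; ring
      rw [h9]
      linarith [h3.1, h3.2]
    refine (frobNorm_le_of_forall (by positivity) h1).trans ?_
    have h3 : (K : ℝ) * (Real.sqrt (3 / 2) * y) = Real.sqrt 3 / 4 * (y * (2 * Real.sqrt 2 * K)) := by
      rw [h32]; ring
    rw [h3]
    have h4 : 0 ≤ y * (2 * Real.sqrt 2 * K) := by positivity
    nlinarith [mul_pos hθ hη]
  -- θ/2 from the true-label noise and θ/14 from misclassified nodes make 4/7·θ. In the second part
  -- √K ≤ β turns β² into the β³ of γ_n.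
  have hlin : ∀ t k, |resolventVec (Q r) (lam r) k ⬝ᵥ E t *ᵥ (Q r).col k| ≤ 4 / 7 * q.θ := by
    intro t k
    have h1 := hR.lin hK r t k
    have h3 : resolventVec (Q r) (lam r) k ⬝ᵥ E t *ᵥ (Q r).col k =
        resolventVec (Q r) (lam r) k ⬝ᵥ (E t - X.avgDev r t ω) *ᵥ (Q r).col k +
          resolventVec (Q r) (lam r) k ⬝ᵥ X.avgDev r t ω *ᵥ (Q r).col k := by
      rw [← dotProduct_add, ← Matrix.add_mulVec, sub_add_cancel]
    have h4 := abs_dotProduct_mulVec_le (E t - X.avgDev r t ω) (resolventVec (Q r) (lam r) k)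
      ((Q r).col k)
    rw [(hQ r).vnorm_col, mul_one] at h4
    have h5 := frobNorm_le_of_forall (by positivity) fun k l => (hentry t k l).1
    have h6 := (hQ r).vnorm_resolventVec_le hη (hgap r) k
    have h7 : |resolventVec (Q r) (lam r) k ⬝ᵥ (E t - X.avgDev r t ω) *ᵥ (Q r).col k| ≤
        1 / 14 * q.θ := by
      refine h4.trans ((mul_le_mul h5 h6 (vnorm_nonneg _) (by positivity)).trans ?_)
      rw [mul_div_assoc', div_le_iff₀ hη]
      have h8 : Real.sqrt K ≤ X.beta q := by
        refine le_trans ?_ h.K_le_beta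
        rw [Real.sqrt_le_left hK0.le]
        have : (1 : ℝ) ≤ K := by exact_mod_cast X.K_pos
        nlinarith
      have h9 : (K : ℝ) * (9 * (X.beta q ^ 2 * X.epsMax ω) * b) * Real.sqrt K ≤
          9 * K * b * (X.beta q ^ 3 * X.epsMax ω) := by
        have e0 : 0 ≤ 9 * K * b * (X.beta q ^ 2 * X.epsMax ω) := by positivity
        calc (K : ℝ) * (9 * (X.beta q ^ 2 * X.epsMax ω) * b) * Real.sqrt K
            = 9 * K * b * (X.beta q ^ 2 * X.epsMax ω) * Real.sqrt K := by ring
          _ ≤ 9 * K * b * (X.beta q ^ 2 * X.epsMax ω) * X.beta q :=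
              mul_le_mul_of_nonneg_left h8 e0
          _ = _ := by ring
      refine h9.trans ?_
      have h10 : (7 : ℝ) / 5 ≤ Real.sqrt 2 := Real.le_sqrt_of_sq_le (by norm_num)
      have h11 : 0 ≤ b * (X.beta q ^ 3 * X.epsMax ω) * K := by positivity
      have h12 : 0 ≤ b * X.delta q 1 * (2 * Real.sqrt 2 * K) := by positivity
      have h13 : b * (56 * X.beta q ^ 3 * X.epsMax ω) * (2 * Real.sqrt 2 * K) ≤ q.θ * q.η := by
        linarith
      have h14 : 14 / 5 * 56 * (b * (X.beta q ^ 3 * X.epsMax ω) * K) ≤ q.θ * q.η := by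
        nlinarith [mul_le_mul_of_nonneg_right h10 h11]
      linarith
    rw [h3]
    refine (abs_add_le _ _).trans ?_
    linarith
  have hBhat : ∀ t, X.Bhat1 r t ω = permConj (σ r t) (X.B r + E t) := by
    intro t
    rw [hE]
    simp only [add_sub_cancel]
    rw [← permConj_hdiv, blockSum_comp, blockCount_comp]
    rfl
  have hsymm : ∀ t, (X.Bhat1 r t ω).IsSymm := by
    intro t
    refine Matrix.IsSymm.ext fun k l => ?_
    simp only [Bhat1, hdiv, Shat1, mhat1, Matrix.of_apply]
    rw [blockSum_symm (adjacency_symm _), blockCount_eq_blockSum, blockSum_symm offDiagOnes_symm]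
  have hm := X.specMatch_spec _ _ (hsymm t) (hsymm (X.first r))
  rw [hBhat t, hBhat (X.first r)] at hm
  have hθK : q.θ * Real.sqrt K < 1 / 4 := by
    have := h.θ_lt
    rw [lt_div_iff₀ (by positivity)] at this
    linarith
  have := hm.eq_inv_mul (hQ r) hθ hθK hη (hgap r) (hcol r) (hEn t) (hEn _) (hlin t) (hlin _)
  rw [Phat1, hBhat t, hBhat (X.first r)]
  exact this

/-- The pooled sums of sample `r` are relabelled pooled sums of aligned networks. -/
theorem sum_permConj_eq
    (hP : ∀ r t, X.Phat1 r t ω = (σ r t)⁻¹ * σ r (X.first r)) (r : Fin 2)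
    (M : (t : Fin (X.N r)) → Matrix (Fin K) (Fin K) ℝ) :
    ∑ t, permConj (X.Phat1 r t ω) (permConj (σ r t) (M t)) =
      permConj (σ r (X.first r)) (∑ t, M t) := by
  rw [permConj_sum]
  refine Finset.sum_congr rfl fun t _ => ?_
  rw [permConj_permConj, hP, mul_inv_cancel_left]

end Deterministic

end TwoSampleSBM

end SBMTest

namespace SBMTest

/-! ### Lower bound for the statistic and its probability -/

namespace TwoSampleSBM

variable {K : ℕ} {Ω : Type*} [MeasurableSpace Ω] {X : TwoSampleSBM K Ω} {q : Params}

theorem Assumptions.abs_B_sub_le (h : X.Assumptions q) (k l : Fin K) :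
    |(X.B 1 - X.B 0) k l| ≤ (q.C₁ - 1) * (q.ν / q.n) := by
  have h0 := h.sparsity 0 k l
  have h1 := h.sparsity 1 k l
  rw [mul_div_assoc] at h0 h1
  rw [Matrix.sub_apply, abs_le]
  constructor <;> linarith [h0.1, h0.2, h1.1, h1.2]

/-- The signal condition forces the deviations of the pooled estimates to be small. -/
theorem Assumptions.delta_le_of_signal (h : X.Assumptions q) {ω : Ω} (hH : ω ∈ X.signalEvent q)
    (r : Fin 2) : X.delta q (X.N r) ≤ 3 / 10 := by
  have hC := h.one_le_C₁
  have hs := h.scale_pos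
  have hK : (0 : ℝ) < K := by exact_mod_cast X.K_pos
  have h1 : matchDist (X.B 0) (X.B 1) ≤ K * ((q.C₁ - 1) * (q.ν / q.n)) := by
    refine (matchDist_le _ _ 1).trans ?_
    have : permConj 1 (X.B 0) = X.B 0 := by ext k l; simp [permConj_apply]
    rw [this]
    exact frobNorm_le_of_forall (mul_nonneg (by linarith) hs.le) h.abs_B_sub_le
  have h2 : Real.sqrt 12 * K * max (X.xi q 0 ω) (X.xi q 1 ω) ≤ K * (q.C₁ - 1) := by
    refine le_trans hH ?_
    rw [div_le_iff₀ hs]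
    linarith
  have h3 : q.C₁ * X.delta q (X.N r) ≤ X.xi q r ω := by
    rw [xi]
    have := X.epsMax_nonneg ω
    have := h.beta_pos
    refine mul_le_mul_of_nonneg_left ?_ (by linarith)
    have : 0 ≤ 40 * X.beta q ^ 3 * X.epsMax ω := by positivity
    linarith
  have h4 : X.xi q r ω ≤ max (X.xi q 0 ω) (X.xi q 1 ω) := by
    fin_cases r
    · exact le_max_left _ _
    · exact le_max_right _ _
  have h5 : (10 : ℝ) / 3 ≤ Real.sqrt 12 := Real.le_sqrt_of_sq_le (by norm_num)
  -- Sparsity bounds the matching distance by K(C₁ − 1)ν/n, whereas δ > 3/10 and √12 ≥ 10/3 would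
  -- force it to be at least KC₁ν/n.
  by_contra hlt
  push Not at hlt
  have h6 : 3 / 10 * q.C₁ ≤ max (X.xi q 0 ω) (X.xi q 1 ω) := by nlinarith
  have h7 : K * q.C₁ ≤ Real.sqrt 12 * K * max (X.xi q 0 ω) (X.xi q 1 ω) := by
    calc K * q.C₁ = 10 / 3 * K * (3 / 10 * q.C₁) := by ring
      _ ≤ Real.sqrt 12 * K * max (X.xi q 0 ω) (X.xi q 1 ω) := by gcongr
  nlinarith

/-- Two eigenvalues more than η apart both lie within ‖B_r‖ ≤ K·C₁ν/n of 0; K ≥ 2 provides two of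
them. -/
theorem Assumptions.gap_le (h : X.Assumptions q) (hK : 2 ≤ K) {Q : Matrix (Fin K) (Fin K) ℝ}
    {lam : Fin K → ℝ} {r : Fin 2} (hQ : IsEVD (X.B r) Q lam)
    (hgap : ∀ k l, k ≠ l → q.η < |lam k - lam l|) : q.η ≤ 2 * K * (q.C₁ * q.ν / q.n) := by
  have hC := h.one_le_C₁
  have hν := h.ν_pos
  have hn := h.n_pos'
  have h1 : frobNorm (X.B r) ≤ K * (q.C₁ * q.ν / q.n) :=
    frobNorm_le_of_forall (by positivity) fun k l => by
      rw [abs_of_nonneg (X.B_mem r k l).1]; exact (h.sparsity r k l).2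
  have h2 : ∀ k, |lam k| ≤ frobNorm (X.B r) := by
    intro k
    have h3 := vnorm_mulVec_le (X.B r) (Q.col k)
    rwa [hQ.mulVec_col, vnorm_smul, hQ.vnorm_col, mul_one, mul_one] at h3
  have h4 := hgap ⟨0, by omega⟩ ⟨1, by omega⟩ (by simp)
  have h5 := abs_sub (lam ⟨0, by omega⟩) (lam ⟨1, by omega⟩)
  linarith [h2 ⟨0, by omega⟩, h2 ⟨1, by omega⟩]

theorem Assumptions.scale_mul_delta_le (h : X.Assumptions q) {ω : Ω} (hG : ω ∈ X.goodEvent q) :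
    q.C₁ * q.ν / q.n * X.delta q 1 ≤ q.θ * q.η / (2 * Real.sqrt 2 * K) := by
  have hC := h.one_le_C₁
  have hs := h.scale_pos
  have := X.epsMax_nonneg ω
  have := h.beta_pos
  refine le_trans ?_ hG.1
  rw [gamma]
  have h1 : 0 ≤ q.ν / q.n * (q.C₁ * (56 * X.beta q ^ 3 * X.epsMax ω)) := by positivity
  calc q.C₁ * q.ν / q.n * X.delta q 1 = q.ν / q.n * (q.C₁ * X.delta q 1) := by ring
    _ ≤ q.ν / q.n * (q.C₁ * X.delta q 1) +
        q.ν / q.n * (q.C₁ * (56 * X.beta q ^ 3 * X.epsMax ω)) := by linarith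
    _ = _ := by ring

/-- Inserting the bound on η leaves δ ≤ θ, and θ < 1/(4√K) ≤ 1/4. -/
theorem Assumptions.delta_one_le (h : X.Assumptions q)
    (hη : q.η ≤ 2 * K * (q.C₁ * q.ν / q.n))
    (hδ : q.C₁ * q.ν / q.n * X.delta q 1 ≤ q.θ * q.η / (2 * Real.sqrt 2 * K)) :
    X.delta q 1 ≤ 3 / 10 := by
  have hC := h.one_le_C₁
  have hν := h.ν_pos
  have hn := h.n_pos'
  have hθ := h.θ_pos
  have hK : (1 : ℝ) ≤ K := by exact_mod_cast X.K_pos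
  obtain ⟨b, hb⟩ : ∃ b, q.C₁ * q.ν / q.n = b := ⟨_, rfl⟩
  have hb0 : 0 < b := by rw [← hb]; positivity
  rw [hb] at hη hδ
  have h1 : q.θ ≤ 1 / 4 := by
    refine h.θ_lt.le.trans ?_
    have : 1 ≤ Real.sqrt K := Real.one_le_sqrt.2 hK
    exact one_div_le_one_div_of_le (by norm_num) (by linarith)
  have h2 : 1 ≤ Real.sqrt 2 := Real.one_le_sqrt.2 (by norm_num)
  have h3 : q.θ * q.η / (2 * Real.sqrt 2 * K) ≤ q.θ * b := by
    rw [div_le_iff₀ (by positivity)]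
    have e1 : q.θ * q.η ≤ q.θ * (2 * K * b) := mul_le_mul_of_nonneg_left hη hθ.le
    have e2 : 0 ≤ q.θ * b * (2 * K) := by positivity
    nlinarith [mul_le_mul_of_nonneg_left h2 e2]
  have h4 : b * X.delta q 1 ≤ b * (1 / 4) := by nlinarith
  linarith [le_of_mul_le_mul_left h4 hb0]

/-- At regular outcomes in the two events, the test statistic is large. -/
theorem lowerBound_le_That (h : X.Assumptions q) {Q : Fin 2 → Matrix (Fin K) (Fin K) ℝ}
    {lam : Fin 2 → Fin K → ℝ} {ω : Ω} (hG : ω ∈ X.goodEvent q) (hH : ω ∈ X.signalEvent q)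
    (hR : X.Regular q Q lam ω) (hQ : ∀ r, IsEVD (X.B r) (Q r) (lam r))
    (hgap : ∀ r k l, k ≠ l → q.η < |lam r k - lam r l|)
    (hcol : ∀ r k, q.θ < |∑ i, Q r i k|) (hδ : 2 ≤ K → X.delta q 1 ≤ 3 / 10) :
    X.lowerBound q ≤ X.That ω := by
  obtain ⟨σ, hσ⟩ := X.epsMax_aligned ω
  have hP := Phat1_eq h hG hR hσ hQ hgap hcol hδ
  have hβ := h.one_le_beta
  have hβ0 := h.beta_pos
  have hC := h.one_le_C₁
  have hν := h.ν_pos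
  have hn := h.n_pos'
  have hs := h.scale_pos
  have hε := X.epsMax_nonneg ω
  have hK0 : (0 : ℝ) < K := by exact_mod_cast X.K_pos
  -- pooled sums and counts of aligned networks
  set SW : Fin 2 → Matrix (Fin K) (Fin K) ℝ := fun r =>
    ∑ t, blockSum (adjacency (X.graph r t ω)) (σ r t ∘ X.zhat r t ω) with hSW
  set MW : Fin 2 → Matrix (Fin K) (Fin K) ℝ := fun r =>
    ∑ t, blockCount (σ r t ∘ X.zhat r t ω) with hMW
  set ρ : Fin 2 → Equiv.Perm (Fin K) := fun r => σ r (X.first r) with hρ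
  -- The global matching enters only through ρ', which may be any permutation.
  set ρ' : Equiv.Perm (Fin K) := ρ 1 * X.Phat ω with hρ'
  have hShat : ∀ r, X.Shat r ω = permConj (ρ r) (SW r) := by
    intro r
    rw [hρ, hSW, ← sum_permConj_eq hP]
    refine Finset.sum_congr rfl fun t _ => ?_
    rw [blockSum_comp]; rfl
  have hmhat : ∀ r, X.mhat r ω = permConj (ρ r) (MW r) := by
    intro r
    rw [hρ, hMW, ← sum_permConj_eq hP]
    refine Finset.sum_congr rfl fun t _ => ?_
    rw [blockCount_comp]; rfl
  have hS2 : X.Shat2' ω = permConj ρ' (SW 1) := by rw [Shat2', hShat, permConj_permConj]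
  have hm2 : X.mhat2' ω = permConj ρ' (MW 1) := by rw [mhat2', hmhat, permConj_permConj]
  -- size of the counts
  set N : ℝ := ((min (X.N 0) (X.N 1) : ℕ) : ℝ) with hN
  have hN0 : 0 < N := by
    rw [hN]; exact_mod_cast lt_min (X.N_pos 0) (X.N_pos 1)
  have hNr : ∀ r, N ≤ X.N r := by
    intro r
    rw [hN]
    have : min (X.N 0) (X.N 1) ≤ X.N r := by
      fin_cases r
      · exact min_le_left _ _
      · exact min_le_right _ _
    exact_mod_cast this
  set H : ℝ := 99 / 100 * (N * (q.n : ℝ) ^ 2 / X.beta q ^ 2) with hHdef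
  have hH0 : 0 < H := by positivity
  have hMWge : ∀ r k l, H ≤ MW r k l := by
    intro r k l
    simp only [hMW, Matrix.sum_apply]
    calc H ≤ 99 / 100 * ((X.N r : ℝ) * (q.n : ℝ) ^ 2 / X.beta q ^ 2) := by
          rw [hHdef]
          have := hNr r
          gcongr
      _ = ∑ _t : Fin (X.N r), 99 / 100 * ((q.n : ℝ) ^ 2 / X.beta q ^ 2) := by
          rw [Finset.sum_const, Finset.card_univ, Fintype.card_fin, nsmul_eq_mul]; ring
      _ ≤ _ := by
          refine Finset.sum_le_sum fun t _ => le_trans ?_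
            (le_blockCount_aligned h hG hR hσ r t k l)
          have := (h.sizes r t).1
          gcongr
  have hSW0 : ∀ r k l, 0 ≤ SW r k l := by
    intro r k l
    simp only [hSW, Matrix.sum_apply]
    exact Finset.sum_nonneg fun t _ => blockSum_nonneg (adjacency_nonneg _) _ _ _
  have hSWle : ∀ r k l, SW r k l ≤ MW r k l := by
    intro r k l
    simp only [hSW, hMW, Matrix.sum_apply]
    refine Finset.sum_le_sum fun t _ => ?_
    rw [blockCount_eq_blockSum]
    exact blockSum_mono (adjacency_le _) _ _ _
  have hSWs : ∀ r k l, SW r k l = SW r l k := by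
    intro r k l
    simp only [hSW, Matrix.sum_apply]
    exact Finset.sum_congr rfl fun t _ => blockSum_symm (adjacency_symm _) _ _ _
  have hMWs : ∀ r k l, MW r k l = MW r l k := by
    intro r k l
    simp only [hMW, Matrix.sum_apply, blockCount_eq_blockSum]
    exact Finset.sum_congr rfl fun t _ => blockSum_symm offDiagOnes_symm _ _ _
  -- the two pooled estimates
  have hest : ∀ r, frobNorm (hdiv (SW r) (MW r) - X.B r) ≤
      K * (Real.sqrt (3 / 2) * (X.xi q r ω * (q.ν / q.n))) := by
    intro r
    have hδ0 := h.delta_nonneg (X.N r)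
    have h5 : 1 ≤ Real.sqrt (3 / 2) := Real.one_le_sqrt.2 (by norm_num)
    have hxi : 0 ≤ X.xi q r ω := by rw [xi]; positivity
    refine frobNorm_le_of_forall (by positivity) fun k l => ?_
    have h1 := abs_pooled_sub_le h hG hR hσ r Finset.univ ⟨X.first r, Finset.mem_univ _⟩
      (d := Real.sqrt (3 / 2) * X.delta q (X.N r)) (by positivity)
      (by nlinarith [sqrt_three_halves_le, h.delta_le_of_signal hH r]) k l (hR.pooled r k l)
    have h2 : (hdiv (SW r) (MW r) - X.B r) k l =
        (∑ t, blockSum (adjacency (X.graph r t ω)) (σ r t ∘ X.zhat r t ω) k l) /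
          (∑ t, blockCount (σ r t ∘ X.zhat r t ω) k l) - X.B r k l := by
      simp [hdiv, hSW, hMW, Matrix.sum_apply]
    rw [h2]
    refine (abs_sub_le _ _ _).trans ((add_le_add h1.1 h1.2).trans ?_)
    rw [xi]
    have hβ23 : X.beta q ^ 2 * X.epsMax ω ≤ X.beta q ^ 3 * X.epsMax ω :=
      mul_le_mul_of_nonneg_right (pow_le_pow_right₀ hβ (by norm_num)) hε
    obtain ⟨b, hb⟩ : ∃ b, q.C₁ * q.ν / q.n = b := ⟨_, rfl⟩
    have hb0 : 0 < b := by rw [← hb]; positivity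
    have e1 : Real.sqrt (3 / 2) * (q.C₁ * (40 * X.beta q ^ 3 * X.epsMax ω + X.delta q (X.N r)) *
        (q.ν / q.n)) = Real.sqrt (3 / 2) * (40 * (X.beta q ^ 3 * X.epsMax ω) * b) +
          Real.sqrt (3 / 2) * X.delta q (X.N r) * b := by rw [← hb]; ring
    rw [e1, hb]
    have h7 : 0 ≤ X.beta q ^ 3 * X.epsMax ω * b := by positivity
    have h8 := mul_le_mul_of_nonneg_right hβ23 hb0.le
    nlinarith [mul_le_mul_of_nonneg_right h5 h7]
  set D : Matrix (Fin K) (Fin K) ℝ :=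
    permConj (ρ 0) (hdiv (SW 0) (MW 0)) - permConj ρ' (hdiv (SW 1) (MW 1)) with hD
  have hDge := frobNorm_sub_ge (hest 0) (hest 1) (ρ 0) ρ'
  rw [← hD] at hDge
  set d := matchDist (X.B 0) (X.B 1) with hd
  have hd0 : 0 ≤ d := matchDist_nonneg _ _
  -- the error is at most `d / √2`
  have herr : K * (Real.sqrt (3 / 2) * (X.xi q 0 ω * (q.ν / q.n))) +
      K * (Real.sqrt (3 / 2) * (X.xi q 1 ω * (q.ν / q.n))) ≤ d * (7075 / 10000) := by
    set x := max (X.xi q 0 ω) (X.xi q 1 ω) with hx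
    have h1 : Real.sqrt 12 * K * x * (q.ν / q.n) ≤ d := by
      have h0 : Real.sqrt 12 * K * x ≤ d / (q.ν / q.n) := hH
      rwa [le_div_iff₀ hs] at h0
    have h2 : Real.sqrt 12 = 2 * Real.sqrt 2 * Real.sqrt (3 / 2) := by
      rw [mul_assoc, ← Real.sqrt_mul (by norm_num)]
      rw [show (12 : ℝ) = 2 ^ 2 * (2 * (3 / 2)) by norm_num, Real.sqrt_mul (by norm_num),
        Real.sqrt_sq (by norm_num)]
    have h3 : (1414 : ℝ) / 1000 ≤ Real.sqrt 2 := Real.le_sqrt_of_sq_le (by norm_num)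
    have h4 : X.xi q 0 ω ≤ x := le_max_left _ _
    have h5 : X.xi q 1 ω ≤ x := le_max_right _ _
    have h0 : 0 ≤ X.xi q 0 ω := by
      have := h.delta_nonneg (X.N 0)
      rw [xi]; positivity
    have hx0 : 0 ≤ x := h0.trans h4
    have h6 : K * (Real.sqrt (3 / 2) * (X.xi q 0 ω * (q.ν / q.n))) ≤
        K * (Real.sqrt (3 / 2) * (x * (q.ν / q.n))) := by gcongr
    have h7 : K * (Real.sqrt (3 / 2) * (X.xi q 1 ω * (q.ν / q.n))) ≤
        K * (Real.sqrt (3 / 2) * (x * (q.ν / q.n))) := by gcongr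
    set y := K * (Real.sqrt (3 / 2) * (x * (q.ν / q.n))) with hy
    have hy0 : 0 ≤ y := by positivity
    have h8 : Real.sqrt 12 * K * x * (q.ν / q.n) = 2 * Real.sqrt 2 * y := by rw [h2, hy]; ring
    rw [h8] at h1
    nlinarith [mul_le_mul_of_nonneg_right h3 hy0]
  -- 1 − 0.7075 = 0.2925, with square above 0.0855; finally 0.99·0.0855 > 1/12.
  have hDd : d * (2925 / 10000) ≤ frobNorm D := by linarith
  have hDsq : d ^ 2 * (855 / 10000) ≤ frobNorm D ^ 2 := by
    have := pow_le_pow_left₀ (by positivity) hDd 2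
    nlinarith [sq_nonneg d]
  have hlow : X.lowerBound q ≤ H * frobNorm D ^ 2 := by
    have h1 : X.lowerBound q = 1 / 12 * (N * (q.n : ℝ) ^ 2 / X.beta q ^ 2) * d ^ 2 := by
      rw [lowerBound, ← hN, ← hd]
      field_simp
    have h2 : 0 ≤ N * (q.n : ℝ) ^ 2 / X.beta q ^ 2 := by positivity
    rw [h1, hHdef]
    nlinarith [mul_le_mul_of_nonneg_left hDsq h2, mul_nonneg h2 (sq_nonneg d)]
  refine hlow.trans ((mul_frobNorm_sq_le_sum (fun k l => ?_) hH0.le).trans ?_)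
  · simp only [hD, Matrix.sub_apply, permConj_apply, hdiv, Matrix.of_apply]
    rw [hSWs 0, hMWs 0, hSWs 1, hMWs 1]
  · rw [That]
    refine Finset.sum_le_sum fun k _ => Finset.sum_le_sum fun l _ => ?_
    have := two_mul_le_term hH0 (hMWge 0 (ρ 0 k) (ρ 0 l)) (hMWge 1 (ρ' k) (ρ' l))
      (hSW0 0 _ _) (hSWle 0 _ _) (hSW0 1 _ _) (hSWle 1 _ _)
    simpa only [hHat, varHat, Bpool, hShat, hmhat, hS2, hm2, hdiv, Matrix.of_apply, permConj_apply,
      Matrix.add_apply, hD, Matrix.sub_apply] using this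

/-- The inequalities between parameters that concentration requires do not involve the outcome, so a
single outcome in 𝒢 ∩ ℋ supplies them. If there is none, or if the error bound is at least 1, the
left side is at most 0. -/
theorem Assumptions.prob_lowerBound_le (h : X.Assumptions q) :
    1 - X.errorBound q - X.μ.real (X.goodEvent q ∩ X.signalEvent q)ᶜ ≤
      X.μ.real {ω | X.lowerBound q ≤ X.That ω} := by
  have := X.isProb
  rcases le_or_gt 1 (X.errorBound q) with he | he
  · have h1 : 0 ≤ X.μ.real (X.goodEvent q ∩ X.signalEvent q)ᶜ := measureReal_nonneg
    have h2 : 0 ≤ X.μ.real {ω | X.lowerBound q ≤ X.That ω} := measureReal_nonneg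
    linarith
  have he0 : 0 ≤ X.errorBound q := by
    rw [errorBound]
    have := Real.rpow_nonneg h.n_pos'.le (-q.α)
    positivity
  rcases (X.goodEvent q ∩ X.signalEvent q).eq_empty_or_nonempty with hempty | ⟨ω₀, hG₀, hH₀⟩
  · rw [hempty, Set.compl_empty, probReal_univ]
    have h2 : 0 ≤ X.μ.real {ω | X.lowerBound q ≤ X.That ω} := measureReal_nonneg
    linarith
  choose Q lam hQ hgap hcol using h.friendly
  have hK : 2 ≤ K → X.delta q 1 ≤ 3 / 10 ∧ q.η ≤ 2 * K * (q.C₁ * q.ν / q.n) ∧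
      q.C₁ * q.ν / q.n * X.delta q 1 ≤ q.θ * q.η / (2 * Real.sqrt 2 * K) := by
    intro h2
    have h3 := h.gap_le h2 (hQ 0) (hgap 0)
    have h4 := h.scale_mul_delta_le hG₀
    exact ⟨h.delta_one_le h3 h4, h3, h4⟩
  have hreg := h.prob_not_regular_le he hQ hgap (h.delta_le_of_signal hH₀) hK
  set R := {ω | ¬ X.Regular q Q lam ω}
  set S := X.goodEvent q ∩ X.signalEvent q
  set T := {ω | X.lowerBound q ≤ X.That ω}
  have hcov : (Set.univ : Set Ω) ⊆ T ∪ (R ∪ Sᶜ) := by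
    intro ω _
    by_cases hR : ω ∈ R
    · exact Or.inr (Or.inl hR)
    by_cases hS : ω ∈ S
    · exact Or.inl (lowerBound_le_That h hS.1 hS.2 (not_not.1 hR) hQ hgap hcol fun h2 => (hK h2).1)
    · exact Or.inr (Or.inr hS)
  have h1 := (measureReal_mono (μ := X.μ) hcov).trans ((measureReal_union_le _ _).trans
    (add_le_add le_rfl (measureReal_union_le R Sᶜ)))
  rw [probReal_univ] at h1
  linarith

end TwoSampleSBM

end SBMTest

theorem mainTheorem3 {K : ℕ} :
    (∀ {Ω : Type*} [MeasurableSpace Ω] (X : SBMTest.TwoSampleSBM K Ω) (q : SBMTest.Params),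
      X.Assumptions q →
      1 - X.errorBound q - X.μ.real (X.goodEvent q ∩ X.signalEvent q)ᶜ ≤
        X.μ.real {ω | X.lowerBound q ≤ X.That ω}) ∧
    (∀ (Ω : ℕ → Type*) [∀ j, MeasurableSpace (Ω j)]
      (X : (j : ℕ) → SBMTest.TwoSampleSBM K (Ω j)) (q : ℕ → SBMTest.Params),
      (∀ j, (X j).Assumptions (q j)) →
      Tendsto (fun j => (X j).errorBound (q j)) atTop (𝓝 0) →
      Tendsto (fun j => (X j).μ.real ((X j).goodEvent (q j) ∩ (X j).signalEvent (q j))ᶜ)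
        atTop (𝓝 0) →
      Tendsto (fun j => (X j).lowerBound (q j)) atTop atTop →
      ∀ M : ℝ, Tendsto (fun j => (X j).μ.real {ω | M ≤ (X j).That ω}) atTop (𝓝 1)) := by
  refine ⟨fun X q h => h.prob_lowerBound_le, ?_⟩
  intro Ω _ X q h he hμ hlow M
  have h1 : Tendsto (fun j => 1 - (X j).errorBound (q j) -
      (X j).μ.real ((X j).goodEvent (q j) ∩ (X j).signalEvent (q j))ᶜ) atTop (𝓝 1) := by
    simpa using (tendsto_const_nhds (x := (1 : ℝ))).sub he |>.sub hμ
  refine tendsto_of_tendsto_of_tendsto_of_le_of_le' h1 tendsto_const_nhds ?_ ?_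
  · filter_upwards [hlow.eventually_ge_atTop M] with j hj
    have := (X j).isProb
    exact (h j).prob_lowerBound_le.trans (measureReal_mono fun ω hω => hj.trans hω)
  · filter_upwards with j
    have := (X j).isProb
    exact measureReal_le_one
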